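/- Let $N,m\ge 1$ be integers, let $\Omega\subset\mathbb R^N$ be a nonempty bounded open convex set and let $\phi:\Omega\to(0,+\infty)$ be $\frac1m$-concave, i.e. $\phi^{1/m}$ is concave on $\Omega$. Extend $\phi$ by $0$ outside $\Omega$, let $\mu_\phi:=\phi\,\mathcal L^N$, and write $|E|_\phi:=\int_{E\cap\Omega}\phi$ for Lebesgue measurable $E$. Let $L^1_\phi(\Omega)$ be the Lebesgue space with weight $\phi$, and let $W^{1,1}_\phi(\Omega)$ be the space of $u\in L^1_\phi(\Omega)$ whose weak gradient $\nabla u$ on $\Omega$ satisfies $\int_\Omega|\nabla u|\phi<+\infty$. For $u\in L^1_\phi(\Omega)$ let $$|D_\phi u|(\Omega):=\sup\Big\{-\int_\Omega u\,g\,\phi\Big\}\in[0,+\infty],$$ the supremum being over all $\sigma\in L^\infty_{\mu_\phi}(\mathbb R^N;\mathbb R^N)$ with $|\sigma|\le1$ a.e. on $\Omega$ for which there is $g\in L^\infty_{\mu_\phi}(\mathbb R^N)$ with $\operatorname{div}(\sigma\mu_\phi)=g\mu_\phi$ as distributions on $\mathbb R^N$, i.e. $\int g\psi\,d\mu_\phi=-\int\sigma\cdot\nabla\psi\,d\mu_\phi$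 for all $\psi\in C_c^\infty(\mathbb R^N)$. Let $BV_\phi(\Omega):=\{u\in L^1_\phi(\Omega):|D_\phi u|(\Omega)<+\infty\}$; a Lebesgue measurable set $E$ has finite $\phi$-perimeter if $\chi_E\in BV_\phi(\Omega)$, and then $\mathrm{Per}_\phi(E,\Omega):=|D_\phi\chi_E|(\Omega)$. Define $$\mu_1(\Omega,\phi):=\inf\Big\{\frac{\int_\Omega|\nabla u|\phi}{\int_\Omega|u|\phi}:\ u\in W^{1,1}_\phi(\Omega),\ u\not\equiv0,\ \int_\Omega(\operatorname{sign}u)\phi=0\Big\}\quad(\operatorname{sign}0=0),$$ $$\overline\mu_1(\Omega,\phi):=\inf\Big\{\frac{|D_\phi u|(\Omega)}{\int_\Omega|u|\phi}:\ u\in BV_\phi(\Omega),\ u\ge0 \text{ a.e.},\ u\not\equiv0,\ |\{u>0\}|_\phi\le\tfrac12|\Omega|_\phi\Big\},$$ $$\mu_1^*(\Omega,\phi):=\inf\Big\{\frac{\mathrm{Per}_\phi(E,\Omega)}{|E|_\phi}:\ E\subset\Omega \text{ of finite } \phi\text{-perimeter},\ 0<|E|_\phi\le\tfrac12|\Omega|_\phi\Big\}.$$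 Then the infima defining $\overline\mu_1(\Omega,\phi)$ and $\mu_1^*(\Omega,\phi)$ are attained, and $$\mu_1(\Omega,\phi)=\overline\mu_1(\Omega,\phi)=\mu_1^*(\Omega,\phi).$$ Moreover, if $u$ attains $\overline\mu_1(\Omega,\phi)$, then for almost every $t>0$ with $|\{u>t\}|_\phi>0$ the level set $\{x\in\Omega:u(x)>t\}$ attains $\mu_1^*(\Omega,\phi)$. -/

import Mathlib

open MeasureTheory Set
open scoped ENNReal

noncomputable section

namespace WeightedBV

/-- The measure `φ 𝓛ᴺ` on `ℝᴺ`, with `φ` extended by zero outside `Ω`; its value on `E` is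
the weighted volume of `E ∩ Ω`. Only the values of `φ` on `Ω` matter. -/
def weightedMeasure {N : ℕ} (Ω : Set (EuclideanSpace ℝ (Fin N)))
    (φ : EuclideanSpace ℝ (Fin N) → ℝ) : Measure (EuclideanSpace ℝ (Fin N)) :=
  (volume.restrict Ω).withDensity (fun x => ENNReal.ofReal (φ x))

/-- `div (σ μ) = g μ` in the sense of distributions on the whole of `ℝᴺ`. -/
def HasMeasureDiv {N : ℕ} (μ : Measure (EuclideanSpace ℝ (Fin N)))
    (σ : EuclideanSpace ℝ (Fin N) → EuclideanSpace ℝ (Fin N))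
    (g : EuclideanSpace ℝ (Fin N) → ℝ) : Prop :=
  ∀ ψ : EuclideanSpace ℝ (Fin N) → ℝ, ContDiff ℝ (⊤ : ℕ∞) ψ → HasCompactSupport ψ →
    ∫ x, g x * ψ x ∂μ = - ∫ x, fderiv ℝ ψ x (σ x) ∂μ

/-- Pairs `(σ, g)` where `σ` is a bounded field with `|σ| ≤ 1` a.e. whose weighted divergence
`div (σ μ)` is represented by the bounded density `g`. -/
def IsAdmissibleField {N : ℕ} (μ : Measure (EuclideanSpace ℝ (Fin N)))
    (σ : EuclideanSpace ℝ (Fin N) → EuclideanSpace ℝ (Fin N))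
    (g : EuclideanSpace ℝ (Fin N) → ℝ) : Prop :=
  MemLp σ ⊤ μ ∧ MemLp g ⊤ μ ∧ (∀ᵐ x ∂μ, ‖σ x‖ ≤ 1) ∧ HasMeasureDiv μ σ g

/-- The total variation `|D_φ u|(Ω)`: the supremum of `-⟨u, div (σ μ_φ)⟩`. Since `σ = 0` is
admissible, truncating the pairing at zero does not change the supremum. -/
def totalVariation {N : ℕ} (Ω : Set (EuclideanSpace ℝ (Fin N)))
    (φ u : EuclideanSpace ℝ (Fin N) → ℝ) : ℝ≥0∞ :=
  ⨆ (σ : EuclideanSpace ℝ (Fin N) → EuclideanSpace ℝ (Fin N))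
    (g : EuclideanSpace ℝ (Fin N) → ℝ)
    (_ : IsAdmissibleField (weightedMeasure Ω φ) σ g),
    ENNReal.ofReal (- ∫ x, u x * g x ∂(weightedMeasure Ω φ))

/-- `u ∈ BV_φ(Ω)`. -/
def MemBV {N : ℕ} (Ω : Set (EuclideanSpace ℝ (Fin N)))
    (φ u : EuclideanSpace ℝ (Fin N) → ℝ) : Prop :=
  Integrable u (weightedMeasure Ω φ) ∧ totalVariation Ω φ u < ⊤

/-- `Per_φ(E, Ω) = |D_φ χ_E|(Ω)`. -/
def perimeter {N : ℕ} (Ω : Set (EuclideanSpace ℝ (Fin N)))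
    (φ : EuclideanSpace ℝ (Fin N) → ℝ) (E : Set (EuclideanSpace ℝ (Fin N))) : ℝ≥0∞ :=
  totalVariation Ω φ (E.indicator (fun _ => 1))

/-- `G` is the weak gradient of `u` on `Ω`. -/
def HasWeakGradient {N : ℕ} (Ω : Set (EuclideanSpace ℝ (Fin N)))
    (u : EuclideanSpace ℝ (Fin N) → ℝ)
    (G : EuclideanSpace ℝ (Fin N) → EuclideanSpace ℝ (Fin N)) : Prop :=
  LocallyIntegrableOn u Ω volume ∧ LocallyIntegrableOn G Ω volume ∧
    ∀ ψ : EuclideanSpace ℝ (Fin N) → ℝ, ContDiff ℝ (⊤ : ℕ∞) ψ → HasCompactSupport ψ →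
      tsupport ψ ⊆ Ω → ∀ v : EuclideanSpace ℝ (Fin N),
        ∫ x in Ω, u x * fderiv ℝ ψ x v = - ∫ x in Ω, inner ℝ (G x) v * ψ x

/-- `u ∈ W^{1,1}_φ(Ω)` with weak gradient `G`. -/
def MemW11 {N : ℕ} (Ω : Set (EuclideanSpace ℝ (Fin N)))
    (φ u : EuclideanSpace ℝ (Fin N) → ℝ)
    (G : EuclideanSpace ℝ (Fin N) → EuclideanSpace ℝ (Fin N)) : Prop :=
  Integrable u (weightedMeasure Ω φ) ∧ Integrable G (weightedMeasure Ω φ) ∧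
    HasWeakGradient Ω u G

/-- `∫_Ω |u| φ`. -/
def massL1 {N : ℕ} (Ω : Set (EuclideanSpace ℝ (Fin N)))
    (φ u : EuclideanSpace ℝ (Fin N) → ℝ) : ℝ≥0∞ :=
  ∫⁻ x, ‖u x‖ₑ ∂(weightedMeasure Ω φ)

/-- The constant `μ₁(Ω, φ)`: the infimum of `∫ |∇u| φ / ∫ |u| φ` over the nonzero
`u ∈ W^{1,1}_φ(Ω)` with `∫ (sign u) φ = 0`. -/
def muOne {N : ℕ} (Ω : Set (EuclideanSpace ℝ (Fin N)))
    (φ : EuclideanSpace ℝ (Fin N) → ℝ) : ℝ≥0∞ :=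
  sInf {q | ∃ (u : EuclideanSpace ℝ (Fin N) → ℝ)
      (G : EuclideanSpace ℝ (Fin N) → EuclideanSpace ℝ (Fin N)),
      MemW11 Ω φ u G ∧ ∫ x, Real.sign (u x) ∂(weightedMeasure Ω φ) = 0 ∧
      massL1 Ω φ u ≠ 0 ∧
      q = (∫⁻ x, ‖G x‖ₑ ∂(weightedMeasure Ω φ)) / massL1 Ω φ u}

/-- Competitors of the relaxed problem: nonzero nonnegative `u ∈ BV_φ(Ω)` whose positivity set
has at most half of the weighted volume. -/
def IsBarCompetitor {N : ℕ} (Ω : Set (EuclideanSpace ℝ (Fin N)))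
    (φ u : EuclideanSpace ℝ (Fin N) → ℝ) : Prop :=
  MemBV Ω φ u ∧ (∀ᵐ x ∂(weightedMeasure Ω φ), 0 ≤ u x) ∧ massL1 Ω φ u ≠ 0 ∧
    weightedMeasure Ω φ {x | 0 < u x} ≤ weightedMeasure Ω φ Ω / 2

/-- The infimum of the relaxed problem. -/
def muBar {N : ℕ} (Ω : Set (EuclideanSpace ℝ (Fin N)))
    (φ : EuclideanSpace ℝ (Fin N) → ℝ) : ℝ≥0∞ :=
  sInf {q | ∃ u, IsBarCompetitor Ω φ u ∧ q = totalVariation Ω φ u / massL1 Ω φ u}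

/-- `u` attains the infimum of the relaxed problem. -/
def IsBarOptimal {N : ℕ} (Ω : Set (EuclideanSpace ℝ (Fin N)))
    (φ u : EuclideanSpace ℝ (Fin N) → ℝ) : Prop :=
  IsBarCompetitor Ω φ u ∧ totalVariation Ω φ u / massL1 Ω φ u = muBar Ω φ

/-- Competitors of the isoperimetric problem: Lebesgue measurable subsets of `Ω` of finite
`φ`-perimeter with positive weighted volume, at most half of that of `Ω`. -/
def IsStarCompetitor {N : ℕ} (Ω : Set (EuclideanSpace ℝ (Fin N)))
    (φ : EuclideanSpace ℝ (Fin N) → ℝ) (E : Set (EuclideanSpace ℝ (Fin N))) : Prop :=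
  E ⊆ Ω ∧ NullMeasurableSet E volume ∧ MemBV Ω φ (E.indicator (fun _ => 1)) ∧
    weightedMeasure Ω φ E ≠ 0 ∧ weightedMeasure Ω φ E ≤ weightedMeasure Ω φ Ω / 2

/-- The infimum of the isoperimetric problem. -/
def muStar {N : ℕ} (Ω : Set (EuclideanSpace ℝ (Fin N)))
    (φ : EuclideanSpace ℝ (Fin N) → ℝ) : ℝ≥0∞ :=
  sInf {q | ∃ E, IsStarCompetitor Ω φ E ∧ q = perimeter Ω φ E / weightedMeasure Ω φ E}

/-- `E` attains the infimum of the isoperimetric problem. -/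
def IsStarOptimal {N : ℕ} (Ω : Set (EuclideanSpace ℝ (Fin N)))
    (φ : EuclideanSpace ℝ (Fin N) → ℝ) (E : Set (EuclideanSpace ℝ (Fin N))) : Prop :=
  IsStarCompetitor Ω φ E ∧ perimeter Ω φ E / weightedMeasure Ω φ E = muStar Ω φ

end WeightedBV

end

/-! Concavity of φ^(1/m) enters through one inequality: φ(x) ≤ s^(-m) φ(s x + (1 - s) z) for x, z ∈
Ω and 0 < s ≤ 1. With the Jacobian s^(-N) it shows that a homothety of ratio s centred in Ω distorts
μ_φ by a factor at most s^(-(m+N)), which tends to 1 as s → 1 (`map_smul_add_le`). Averaging u over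
such homotheties, with centres in a fixed ball of Ω, gives a smoothing that reads u only on a
compact subset of Ω and is a test function on ℝ^N. Its weighted gradient norm is at most s^(-(m+N))
|D_φ u|(Ω), because the adjoint of the smoothing turns unit fields into admissible fields up to that
factor (`isAdmissibleField_dual`). Hence test functions are dense in BV_φ for strict convergence
(`exists_testFunctions`), with no regularity of the boundary of Ω.

Three consequences carry the theorem: |D_φ u|(Ω) ≤ ∫ |∇u| φ on W^{1,1}_φ
(`totalVariation_le_of_memW11`); the coarea inequality (`exists_coarea`); and L¹ compactness
(`exists_subseq_tendsto`), where the gradient bound makes the smoothing error uniformly small and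
Arzelà–Ascoli applies at a fixed ratio.

If {u > 0} and {u < 0} each carry at most half of the mass, every signed level of u is, up to sign,
the indicator of a set of at most half the mass. Integrating over the levels gives μ₁* ∫ |u| φ ≤
|D_φ u|(Ω) (`muStar_mul_massL1_le`), the lower bound for both functional problems. Indicators give
the converse for the relaxed problem. For μ₁ ≤ μ₁* (`muOne_le_muStar`), χ_E is approximated by test
functions, a small multiple of a coordinate is added so that all level sets become null, and an
exact median is subtracted; since |E|_φ is at most half, subtracting a constant from χ_E cannot
bring its L¹ norm below |E|_φ.

The direct method yields a minimizer of the relaxed problem. For any minimizer the integrated level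
inequality is an equality, hence so is the one at almost every level: almost every non-null
superlevel set is isoperimetric. This gives the last claim and the existence of an optimal set. -/

noncomputable section

namespace WeightedBV

open Filter Topology Metric

/-! ### Concave weights and homotheties -/

/-- A positive weight `φ` on a nonempty bounded open set such that `φ ^ (1 / m)` is concave. -/
structure ConcaveWeight {N : ℕ} (m : ℕ) (Ω : Set (EuclideanSpace ℝ (Fin N)))
    (φ : EuclideanSpace ℝ (Fin N) → ℝ) : Prop where
  exponent_pos : 0 < m
  nonempty : Ω.Nonempty
  isOpen : IsOpen Ω
  isBounded : Bornology.IsBounded Ω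
  pos : ∀ x ∈ Ω, 0 < φ x
  concave : ConcaveOn ℝ Ω (fun x => φ x ^ (1 / (m : ℝ)))

variable {N m : ℕ} {Ω : Set (EuclideanSpace ℝ (Fin N))} {φ : EuclideanSpace ℝ (Fin N) → ℝ}

namespace ConcaveWeight

theorem convex (h : ConcaveWeight m Ω φ) : Convex ℝ Ω := h.concave.1

theorem root_pow (h : ConcaveWeight m Ω φ) {x : EuclideanSpace ℝ (Fin N)} (hx : x ∈ Ω) :
    (φ x ^ (1 / (m : ℝ))) ^ m = φ x := by
  rw [one_div]
  exact Real.rpow_inv_natCast_pow (h.pos x hx).le h.exponent_pos.ne'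

theorem continuousOn (h : ConcaveWeight m Ω φ) : ContinuousOn φ Ω :=
  ((h.concave.continuousOn h.isOpen).pow m).congr fun _ hx => (h.root_pow hx).symm

/-- Concavity of the root along the segment from `z` to `x`: discard the nonnegative term coming
from `z`, then raise to the power `m`. -/
theorem le_inv_pow_mul (h : ConcaveWeight m Ω φ) {x z : EuclideanSpace ℝ (Fin N)} (hx : x ∈ Ω)
    (hz : z ∈ Ω) {s : ℝ} (hs : 0 < s) (hs1 : s ≤ 1) :
    φ x ≤ (s ^ m)⁻¹ * φ (s • x + (1 - s) • z) := by
  have hy : s • x + (1 - s) • z ∈ Ω := h.convex hx hz hs.le (by linarith) (by ring)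
  have h1 := h.concave.2 hx hz hs.le (by linarith : (0 : ℝ) ≤ 1 - s) (by ring)
  simp only [smul_eq_mul] at h1
  have h2 : 0 ≤ (1 - s) * φ z ^ (1 / (m : ℝ)) :=
    mul_nonneg (by linarith) (Real.rpow_nonneg (h.pos z hz).le _)
  have h0 : 0 ≤ s * φ x ^ (1 / (m : ℝ)) :=
    mul_nonneg hs.le (Real.rpow_nonneg (h.pos x hx).le _)
  have h3 := pow_le_pow_left₀ h0 ((le_add_of_nonneg_right h2).trans h1) m
  rw [h.root_pow hy, mul_pow, h.root_pow hx] at h3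
  rw [inv_mul_eq_div, le_div_iff₀ (by positivity)]
  linarith

theorem exists_le (h : ConcaveWeight m Ω φ) : ∃ M : ℝ, 0 < M ∧ ∀ x ∈ Ω, φ x ≤ M := by
  obtain ⟨x₀, hx₀⟩ := h.nonempty
  obtain ⟨r, hr, hball⟩ := Metric.isOpen_iff.1 h.isOpen x₀ hx₀
  obtain ⟨D, hD, hΩ⟩ := h.isBounded.subset_ball_lt 0 x₀
  -- `x₀` is a fixed convex combination of `x` and a point of the ball around `x₀`
  set s : ℝ := r / (r + D) with hs
  have hs0 : 0 < s := by positivity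
  have hs1 : s < 1 := by rw [hs, div_lt_one (by positivity)]; linarith
  have h1s : 1 - s = D / (r + D) := by rw [hs]; field_simp; ring
  refine ⟨(s ^ m)⁻¹ * φ x₀, mul_pos (by positivity) (h.pos _ hx₀), fun x hx => ?_⟩
  have hxD : dist x x₀ < D := hΩ hx
  -- The factor `r / D` keeps this point within distance `r` of `x₀`, and `s` is chosen with `(1 -
  -- s) * (r / D) = s`, so the combination in `e` is exactly `x₀`, whatever `x` is.
  have hz : x₀ - (r / D) • (x - x₀) ∈ Ω := by
    apply hball
    rw [mem_ball, dist_eq_norm, sub_sub_cancel_left, norm_neg, norm_smul, Real.norm_eq_abs,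
      abs_of_pos (by positivity), ← dist_eq_norm, div_mul_eq_mul_div, div_lt_iff₀ hD]
    exact mul_lt_mul_of_pos_left hxD hr
  have := h.le_inv_pow_mul hx hz hs0 hs1.le
  have e : s • x + (1 - s) • (x₀ - (r / D) • (x - x₀)) = x₀ := by
    have e1 : (1 - s) * (r / D) = s := by rw [h1s, hs]; field_simp
    rw [smul_sub, smul_smul, e1, sub_smul, one_smul, smul_sub]
    abel
  rwa [e] at this

theorem exists_pos_le (h : ConcaveWeight m Ω φ) {K : Set (EuclideanSpace ℝ (Fin N))}
    (hK : IsCompact K) (hKΩ : K ⊆ Ω) : ∃ c : ℝ, 0 < c ∧ ∀ x ∈ K, c ≤ φ x := by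
  rcases K.eq_empty_or_nonempty with rfl | hne
  · exact ⟨1, one_pos, by simp⟩
  · obtain ⟨x, hx, hmin⟩ := hK.exists_isMinOn hne (h.continuousOn.mono hKΩ)
    exact ⟨φ x, h.pos x (hKΩ hx), fun y hy => hmin hy⟩

/-- The density of the weighted measure with respect to the Lebesgue measure. -/
theorem measurable_density (h : ConcaveWeight m Ω φ) :
    Measurable (Ω.indicator fun x => ENNReal.ofReal (φ x)) := by
  classical
  have := h.continuousOn.measurable_piecewise (continuousOn_const (c := (0 : ℝ)))
    h.isOpen.measurableSet
  convert ENNReal.measurable_ofReal.comp this using 1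
  ext x
  by_cases hx : x ∈ Ω <;> simp [hx]

theorem weightedMeasure_eq (h : ConcaveWeight m Ω φ) :
    weightedMeasure Ω φ = volume.withDensity (Ω.indicator fun x => ENNReal.ofReal (φ x)) := by
  rw [weightedMeasure, withDensity_indicator h.isOpen.measurableSet]

theorem isFiniteMeasure (h : ConcaveWeight m Ω φ) : IsFiniteMeasure (weightedMeasure Ω φ) := by
  obtain ⟨M, -, hM⟩ := h.exists_le
  refine ⟨?_⟩
  rw [weightedMeasure, withDensity_apply _ MeasurableSet.univ, Measure.restrict_univ]
  refine (setLIntegral_mono measurable_const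
    (fun x hx => ENNReal.ofReal_le_ofReal (hM x hx))).trans_lt ?_
  rw [setLIntegral_const]
  exact ENNReal.mul_lt_top ENNReal.ofReal_lt_top h.isBounded.measure_lt_top

theorem aemeasurable (h : ConcaveWeight m Ω φ) :
    AEMeasurable φ ((volume : Measure (EuclideanSpace ℝ (Fin N))).restrict Ω) :=
  h.continuousOn.aemeasurable h.isOpen.measurableSet

/-- Positivity of the weight makes its null sets Lebesgue null in Ω, so statements holding almost
everywhere for the weighted measure transfer back to Lebesgue measure. -/
theorem restrict_absolutelyContinuous (h : ConcaveWeight m Ω φ) :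
    volume.restrict Ω ≪ weightedMeasure Ω φ := by
  refine withDensity_absolutelyContinuous' h.aemeasurable.ennreal_ofReal ?_
  filter_upwards [ae_restrict_mem h.isOpen.measurableSet] with x hx
  simpa using h.pos x hx

theorem absolutelyContinuous_restrict : weightedMeasure Ω φ ≪ volume.restrict Ω :=
  withDensity_absolutelyContinuous _ _

theorem absolutelyContinuous : weightedMeasure Ω φ ≪ volume :=
  absolutelyContinuous_restrict.trans Measure.restrict_le_self.absolutelyContinuous

theorem ae_mem (h : ConcaveWeight m Ω φ) : ∀ᵐ x ∂(weightedMeasure Ω φ), x ∈ Ω :=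
  absolutelyContinuous_restrict (ae_restrict_mem h.isOpen.measurableSet)

theorem measure_univ (h : ConcaveWeight m Ω φ) :
    weightedMeasure Ω φ univ = weightedMeasure Ω φ Ω := by
  refine measure_congr ?_
  filter_upwards [h.ae_mem] with x hx
  exact propext ⟨fun _ => hx, fun _ => mem_univ x⟩

theorem measure_ne_zero (h : ConcaveWeight m Ω φ) : weightedMeasure Ω φ Ω ≠ 0 := fun h0 => by
  have := h.restrict_absolutelyContinuous h0
  rw [Measure.restrict_apply_self] at this
  exact (h.isOpen.measure_pos volume h.nonempty).ne' this

theorem lintegral_eq (h : ConcaveWeight m Ω φ) {f : EuclideanSpace ℝ (Fin N) → ℝ≥0∞}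
    (hf : Measurable f) : ∫⁻ x, f x ∂(weightedMeasure Ω φ) =
      ∫⁻ x, Ω.indicator (fun x => ENNReal.ofReal (φ x)) x * f x := by
  rw [h.weightedMeasure_eq, lintegral_withDensity_eq_lintegral_mul _ h.measurable_density hf]
  rfl

theorem lintegral_comp_smul_add {f : EuclideanSpace ℝ (Fin N) → ℝ≥0∞} (hf : Measurable f)
    {s : ℝ} (hs : 0 < s) (p : EuclideanSpace ℝ (Fin N)) :
    ∫⁻ x, f (s • x + p) = ENNReal.ofReal (s ^ N)⁻¹ * ∫⁻ x, f x := by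
  have h1 : ∫⁻ x, f (s • x + p) = ∫⁻ y, f (y + p) ∂(Measure.map (s • ·) volume) :=
    (lintegral_map (μ := (volume : Measure (EuclideanSpace ℝ (Fin N))))
      (f := fun y => f (y + p)) (by fun_prop) (measurable_const_smul s)).symm
  rw [h1, Measure.map_addHaar_smul _ hs.ne', lintegral_smul_measure,
    lintegral_add_right_eq_self f p, finrank_euclideanSpace_fin, abs_of_pos (by positivity)]
  rfl

/-- Homotheties centred in `Ω` distort the weighted measure by a controlled factor. -/
theorem map_smul_add_le (h : ConcaveWeight m Ω φ) {z : EuclideanSpace ℝ (Fin N)} (hz : z ∈ Ω)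
    {s : ℝ} (hs : 0 < s) (hs1 : s ≤ 1) :
    Measure.map (fun x => s • x + (1 - s) • z) (weightedMeasure Ω φ) ≤
      ENNReal.ofReal (s ^ (m + N))⁻¹ • weightedMeasure Ω φ := by
  refine Measure.le_iff.2 fun S hS => ?_
  have hd := h.measurable_density
  set d := Ω.indicator fun x => ENNReal.ofReal (φ x) with hd_def
  -- Convexity keeps the image of Ω in Ω, so the comparison of weights also holds for their
  -- extensions by zero.
  have hle : ∀ x, d x ≤ ENNReal.ofReal (s ^ m)⁻¹ * d (s • x + (1 - s) • z) := fun x => by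
    by_cases hx : x ∈ Ω
    · have hy : s • x + (1 - s) • z ∈ Ω := h.convex hx hz hs.le (by linarith) (by ring)
      rw [hd_def, indicator_of_mem hx, indicator_of_mem hy, ← ENNReal.ofReal_mul (by positivity)]
      exact ENNReal.ofReal_le_ofReal (h.le_inv_pow_mul hx hz hs hs1)
    · simp [hd_def, hx]
  have hone : Measurable (S.indicator (1 : EuclideanSpace ℝ (Fin N) → ℝ≥0∞)) :=
    measurable_one.indicator hS
  calc Measure.map (fun x => s • x + (1 - s) • z) (weightedMeasure Ω φ) S
      = ∫⁻ x, S.indicator 1 (s • x + (1 - s) • z) ∂(weightedMeasure Ω φ) := by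
        rw [← lintegral_map hone (by fun_prop), lintegral_indicator_one hS]
    _ = ∫⁻ x, d x * S.indicator 1 (s • x + (1 - s) • z) :=
        h.lintegral_eq (hone.comp (by fun_prop))
    _ ≤ ∫⁻ x, ENNReal.ofReal (s ^ m)⁻¹ * (d (s • x + (1 - s) • z) *
          S.indicator 1 (s • x + (1 - s) • z)) := by
        refine lintegral_mono fun x => ?_
        rw [← mul_assoc]
        gcongr
        exact hle x
    -- The power `m` comes from the weight and the power `N` from the Jacobian of the homothety.
    _ = ENNReal.ofReal (s ^ m)⁻¹ * (ENNReal.ofReal (s ^ N)⁻¹ * ∫⁻ x, d x * S.indicator 1 x) := by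
        rw [lintegral_const_mul _ (by fun_prop),
          lintegral_comp_smul_add (f := fun x => d x * S.indicator 1 x) (hd.mul hone) hs]
    _ = (ENNReal.ofReal (s ^ (m + N))⁻¹ • weightedMeasure Ω φ) S := by
        rw [← h.lintegral_eq hone, lintegral_indicator_one hS, ← mul_assoc,
          ← ENNReal.ofReal_mul (by positivity), ← mul_inv, ← pow_add]
        rfl

end ConcaveWeight

/-! ### The total variation: semicontinuity and test functions -/

theorem IsAdmissibleField.neg {μ : Measure (EuclideanSpace ℝ (Fin N))}
    {σ : EuclideanSpace ℝ (Fin N) → EuclideanSpace ℝ (Fin N)} {g : EuclideanSpace ℝ (Fin N) → ℝ}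
    (h : IsAdmissibleField μ σ g) : IsAdmissibleField μ (-σ) (-g) := by
  refine ⟨h.1.neg, h.2.1.neg, by simpa using h.2.2.1, fun ψ hψ hc => ?_⟩
  have := h.2.2.2 ψ hψ hc
  simp [integral_neg, this]

theorem le_totalVariation (u : EuclideanSpace ℝ (Fin N) → ℝ)
    {σ : EuclideanSpace ℝ (Fin N) → EuclideanSpace ℝ (Fin N)} {g : EuclideanSpace ℝ (Fin N) → ℝ}
    (h : IsAdmissibleField (weightedMeasure Ω φ) σ g) :
    ENNReal.ofReal (- ∫ x, u x * g x ∂(weightedMeasure Ω φ)) ≤ totalVariation Ω φ u :=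
  le_iSup_of_le σ (le_iSup_of_le g (le_iSup_of_le h le_rfl))

theorem totalVariation_congr {u v : EuclideanSpace ℝ (Fin N) → ℝ}
    (h : u =ᵐ[weightedMeasure Ω φ] v) : totalVariation Ω φ u = totalVariation Ω φ v := by
  unfold totalVariation
  refine iSup_congr fun σ => iSup_congr fun g => iSup_congr fun _ => ?_
  congr 2
  refine integral_congr_ae ?_
  filter_upwards [h] with x hx
  rw [hx]

theorem totalVariation_neg_le (u : EuclideanSpace ℝ (Fin N) → ℝ) :
    totalVariation Ω φ (-u) ≤ totalVariation Ω φ u := by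
  refine iSup_le fun σ => iSup_le fun g => iSup_le fun h => ?_
  refine le_trans (le_of_eq ?_) (le_totalVariation u h.neg)
  simp

theorem totalVariation_neg (u : EuclideanSpace ℝ (Fin N) → ℝ) :
    totalVariation Ω φ (-u) = totalVariation Ω φ u :=
  le_antisymm (totalVariation_neg_le u) (by simpa using totalVariation_neg_le (-u))

/-- The total variation is lower semicontinuous for the weighted `L¹` convergence. -/
theorem totalVariation_le_liminf {ι : Type*} {l : Filter ι} [l.NeBot]
    {v : ι → EuclideanSpace ℝ (Fin N) → ℝ} {u : EuclideanSpace ℝ (Fin N) → ℝ}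
    (hv : ∀ i, Integrable (v i) (weightedMeasure Ω φ)) (hu : Integrable u (weightedMeasure Ω φ))
    (hlim : Tendsto (fun i => ∫⁻ x, ‖v i x - u x‖ₑ ∂(weightedMeasure Ω φ)) l (𝓝 0)) :
    totalVariation Ω φ u ≤ liminf (fun i => totalVariation Ω φ (v i)) l := by
  refine iSup_le fun σ => iSup_le fun g => iSup_le fun h => ?_
  have hg := h.2.1
  have hgtop : eLpNorm g ⊤ (weightedMeasure Ω φ) ≠ ⊤ := hg.2.ne
  -- Since `g` is bounded, each single pairing is continuous for the weighted L¹ convergence; a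
  -- supremum of continuous functionals is lower semicontinuous.
  have hL1 : Tendsto (fun i => ∫⁻ x, ‖v i x * g x - u x * g x‖ₑ ∂(weightedMeasure Ω φ)) l
      (𝓝 0) := by
    have h0 := ENNReal.Tendsto.const_mul hlim (Or.inr hgtop)
    rw [mul_zero] at h0
    refine tendsto_of_tendsto_of_tendsto_of_le_of_le tendsto_const_nhds h0
      (fun _ => zero_le) fun i => ?_
    dsimp only
    rw [← lintegral_const_mul' _ _ hgtop]
    refine lintegral_mono_ae ?_
    filter_upwards [enorm_ae_le_eLpNormEssSup g (weightedMeasure Ω φ)] with x hx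
    rw [← eLpNorm_exponent_top] at hx
    rw [← sub_mul, enorm_mul, mul_comm]
    gcongr
  have hlim' := tendsto_integral_of_L1 (fun x => u x * g x) (hu.mul_of_top_left hg).1
    (.of_forall fun i => (hv i).mul_of_top_left hg) hL1
  have h2 := (ENNReal.continuous_ofReal.tendsto _).comp hlim'.neg
  rw [← h2.liminf_eq]
  exact liminf_le_liminf (.of_forall fun i => le_totalVariation (v i) h)

theorem ofReal_integral_le {α : Type*} [MeasurableSpace α] {μ : Measure α} (f : α → ℝ) :
    ENNReal.ofReal (∫ x, f x ∂μ) ≤ ∫⁻ x, ‖f x‖ₑ ∂μ :=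
  (Real.ofReal_le_enorm _).trans (enorm_integral_le_lintegral_enorm f)

/-- For test functions the total variation is at most the weighted `L¹` norm of the gradient. -/
theorem totalVariation_le_lintegral_fderiv {ψ : EuclideanSpace ℝ (Fin N) → ℝ}
    (hψ : ContDiff ℝ (⊤ : ℕ∞) ψ) (hc : HasCompactSupport ψ) :
    totalVariation Ω φ ψ ≤ ∫⁻ x, ‖fderiv ℝ ψ x‖ₑ ∂(weightedMeasure Ω φ) := by
  refine iSup_le fun σ => iSup_le fun g => iSup_le fun h => ?_
  -- The divergence is taken on all of ℝ^N, so `ψ` itself may be inserted although it need not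
  -- vanish near the boundary of Ω.
  have := h.2.2.2 ψ hψ hc
  simp_rw [mul_comm (ψ _)]
  rw [this, neg_neg]
  refine (ofReal_integral_le _).trans (lintegral_mono_ae ?_)
  filter_upwards [h.2.2.1] with x hx
  have := (fderiv ℝ ψ x).le_opNorm_of_le hx
  rw [mul_one] at this
  exact enorm_le_iff_norm_le.2 this

theorem fderiv_comp_const_sub {f : EuclideanSpace ℝ (Fin N) → ℝ} (hf : Differentiable ℝ f)
    (a y e : EuclideanSpace ℝ (Fin N)) :
    fderiv ℝ (fun y => f (a - y)) y e = - fderiv ℝ f (a - y) e := by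
  have h2 : HasFDerivAt (fun y => f (a - y)) _ y :=
    (hf (a - y)).hasFDerivAt.comp y ((hasFDerivAt_id y).const_sub a)
  rw [h2.fderiv]
  simp

/-! ### Mollifiers and the smoothing operator -/

/-- A smooth probability density supported in the ball of radius `δ` around the origin. -/
structure IsMollifier (δ : ℝ) (ρ : EuclideanSpace ℝ (Fin N) → ℝ) : Prop where
  contDiff : ContDiff ℝ (⊤ : ℕ∞) ρ
  nonneg : ∀ x, 0 ≤ ρ x
  tsupport_subset : tsupport ρ ⊆ closedBall 0 δ
  integral_eq_one : ∫ x, ρ x = 1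

theorem exists_isMollifier {δ : ℝ} (hδ : 0 < δ) :
    ∃ ρ : EuclideanSpace ℝ (Fin N) → ℝ, IsMollifier δ ρ := by
  let b : ContDiffBump (0 : EuclideanSpace ℝ (Fin N)) := ⟨δ / 2, δ, by linarith, by linarith⟩
  exact ⟨b.normed volume, b.contDiff_normed, b.nonneg_normed, b.tsupport_normed_eq.subset,
    b.integral_normed⟩

namespace IsMollifier

variable {δ : ℝ} {ρ : EuclideanSpace ℝ (Fin N) → ℝ}

theorem hasCompactSupport (h : IsMollifier δ ρ) : HasCompactSupport ρ :=
  (isCompact_closedBall (0 : EuclideanSpace ℝ (Fin N)) δ).of_isClosed_subset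
    (isClosed_tsupport ρ) h.tsupport_subset

theorem eq_zero (h : IsMollifier δ ρ) {w : EuclideanSpace ℝ (Fin N)} (hw : ¬ ‖w‖ ≤ δ) :
    ρ w = 0 :=
  image_eq_zero_of_notMem_tsupport fun hmem => hw (by simpa using h.tsupport_subset hmem)

theorem fderiv_eq_zero (h : IsMollifier δ ρ) {w : EuclideanSpace ℝ (Fin N)} (hw : ¬ ‖w‖ ≤ δ) :
    fderiv ℝ ρ w = 0 :=
  image_eq_zero_of_notMem_tsupport fun hmem =>
    hw (by simpa using h.tsupport_subset (tsupport_fderiv_subset ℝ hmem))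

theorem continuous (h : IsMollifier δ ρ) : Continuous ρ := h.contDiff.continuous

theorem continuous_fderiv (h : IsMollifier δ ρ) : Continuous (fderiv ℝ ρ) :=
  h.contDiff.continuous_fderiv (by simp)

theorem integrable (h : IsMollifier δ ρ) : Integrable ρ :=
  h.continuous.integrable_of_hasCompactSupport h.hasCompactSupport

theorem lintegral_eq_one (h : IsMollifier δ ρ) : ∫⁻ x, ENNReal.ofReal (ρ x) = 1 := by
  rw [← ofReal_integral_eq_lintegral_ofReal h.integrable (.of_forall h.nonneg),
    h.integral_eq_one, ENNReal.ofReal_one]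

theorem exists_bound (h : IsMollifier δ ρ) : ∃ C : ℝ, 0 ≤ C ∧ ∀ x, ‖ρ x‖ ≤ C := by
  obtain ⟨C, hC⟩ := h.hasCompactSupport.exists_bound_of_continuous h.continuous
  exact ⟨C, (norm_nonneg _).trans (hC 0), hC⟩

theorem exists_fderiv_bound (h : IsMollifier δ ρ) : ∃ C : ℝ, 0 ≤ C ∧ ∀ x, ‖fderiv ℝ ρ x‖ ≤ C := by
  obtain ⟨C, hC⟩ := (h.hasCompactSupport.fderiv ℝ).exists_bound_of_continuous h.continuous_fderiv
  exact ⟨C, (norm_nonneg _).trans (hC 0), hC⟩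

end IsMollifier

/-- The compact set of all `s • x + (1 - s) • z` with `x` in the closure of `Ω` and `z` in the
closed ball of radius `r` around `x₀`. -/
def core (Ω : Set (EuclideanSpace ℝ (Fin N))) (x₀ : EuclideanSpace ℝ (Fin N)) (r s : ℝ) :
    Set (EuclideanSpace ℝ (Fin N)) :=
  (fun p : EuclideanSpace ℝ (Fin N) × EuclideanSpace ℝ (Fin N) => s • p.1 + (1 - s) • p.2) ''
    (closure Ω ×ˢ closedBall x₀ r)

/-- The smoothing operator: mollification composed with the homothety of ratio `s` centred
at `x₀`. -/
def smoothing (Ω : Set (EuclideanSpace ℝ (Fin N))) (x₀ : EuclideanSpace ℝ (Fin N)) (r s : ℝ)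
    (ρ u : EuclideanSpace ℝ (Fin N) → ℝ) (x : EuclideanSpace ℝ (Fin N)) : ℝ :=
  ∫ y in core Ω x₀ r s, u y * ρ (s • x + (1 - s) • x₀ - y)

/-- The data needed for the smoothing operator. -/
structure SmoothingData (m : ℕ) (Ω : Set (EuclideanSpace ℝ (Fin N)))
    (φ : EuclideanSpace ℝ (Fin N) → ℝ) (x₀ : EuclideanSpace ℝ (Fin N)) (r s : ℝ)
    (ρ : EuclideanSpace ℝ (Fin N) → ℝ) : Prop where
  weight : ConcaveWeight m Ω φ
  radius_pos : 0 < r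
  ball_subset : closedBall x₀ r ⊆ Ω
  ratio_pos : 0 < s
  ratio_lt_one : s < 1
  mollifier : IsMollifier ((1 - s) * r) ρ

/-- Translating by `w` after the homothety only moves its centre, from `x₀` to `x₀ - (1 - s)⁻¹ • w`.
The bound on `w` keeps the new centre in the ball, hence in Ω, and `map_smul_add_le` applies. -/
theorem ConcaveWeight.lintegral_comp_le (h : ConcaveWeight m Ω φ)
    {x₀ : EuclideanSpace ℝ (Fin N)} {r : ℝ} (hr : 0 ≤ r) (hball : closedBall x₀ r ⊆ Ω) {s : ℝ}
    (hs : 0 < s) (hs1 : s ≤ 1)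
    {w : EuclideanSpace ℝ (Fin N)} (hw : ‖w‖ ≤ (1 - s) * r)
    {f : EuclideanSpace ℝ (Fin N) → ℝ≥0∞} (hf : Measurable f) :
    ∫⁻ x, f (s • x + (1 - s) • x₀ - w) ∂(weightedMeasure Ω φ) ≤
      ENNReal.ofReal (s ^ (m + N))⁻¹ * ∫⁻ x, f x ∂(weightedMeasure Ω φ) := by
  obtain ⟨z, hz, hzw⟩ : ∃ z ∈ Ω, (1 - s) • z = (1 - s) • x₀ - w := by
    rcases hs1.eq_or_lt with rfl | hlt
    · have : w = 0 := by simpa using hw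
      exact ⟨x₀, hball (mem_closedBall_self hr), by simp [this]⟩
    · have h1 : (0 : ℝ) < 1 - s := by linarith
      refine ⟨x₀ - (1 - s)⁻¹ • w, hball ?_, ?_⟩
      · rw [mem_closedBall, dist_eq_norm, sub_sub_cancel_left, norm_neg, norm_smul, norm_inv,
          Real.norm_eq_abs, abs_of_pos h1, inv_mul_le_iff₀ h1]
        exact hw
      · rw [smul_sub, smul_inv_smul₀ h1.ne']
  have e : ∀ x, s • x + (1 - s) • x₀ - w = s • x + (1 - s) • z := fun x => by
    rw [hzw, add_sub_assoc]
  simp_rw [e]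
  rw [← lintegral_map hf (by fun_prop)]
  refine (lintegral_mono' (h.map_smul_add_le hz hs hs1) le_rfl).trans ?_
  rw [lintegral_smul_measure]
  rfl

namespace SmoothingData

variable {x₀ : EuclideanSpace ℝ (Fin N)} {r s : ℝ} {ρ : EuclideanSpace ℝ (Fin N) → ℝ}

theorem one_sub_pos (D : SmoothingData m Ω φ x₀ r s ρ) : 0 < 1 - s := by
  linarith [D.ratio_lt_one]

theorem isCompact_core (D : SmoothingData m Ω φ x₀ r s ρ) : IsCompact (core Ω x₀ r s) :=
  (D.weight.isBounded.isCompact_closure.prod (isCompact_closedBall x₀ r)).image (by fun_prop)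

theorem measurableSet_core (D : SmoothingData m Ω φ x₀ r s ρ) :
    MeasurableSet (core Ω x₀ r s) := D.isCompact_core.isClosed.measurableSet

/-- A proper convex combination of a point of the closure and an interior point of a convex set is
interior. This permits the closure in `core`, hence its compactness. -/
theorem core_subset (D : SmoothingData m Ω φ x₀ r s ρ) : core Ω x₀ r s ⊆ Ω := by
  rintro _ ⟨⟨x, z⟩, ⟨hx, hz⟩, rfl⟩
  have hz' : z ∈ interior Ω := by
    rw [D.weight.isOpen.interior_eq]
    exact D.ball_subset hz
  exact interior_subset (D.weight.convex.combo_closure_interior_mem_interior hx hz'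
    D.ratio_pos.le D.one_sub_pos (by ring))

theorem exists_eq (D : SmoothingData m Ω φ x₀ r s ρ) (x : EuclideanSpace ℝ (Fin N))
    {w : EuclideanSpace ℝ (Fin N)} (hw : ‖w‖ ≤ (1 - s) * r) :
    ∃ z ∈ closedBall x₀ r, s • x + (1 - s) • x₀ - w = s • x + (1 - s) • z := by
  have h1 := D.one_sub_pos
  refine ⟨x₀ - (1 - s)⁻¹ • w, ?_, ?_⟩
  · rw [mem_closedBall, dist_eq_norm, sub_sub_cancel_left, norm_neg, norm_smul, norm_inv,
      Real.norm_eq_abs, abs_of_pos h1, inv_mul_le_iff₀ h1]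
    exact hw
  · rw [smul_sub, smul_inv_smul₀ h1.ne', add_sub_assoc]

theorem mem_core (D : SmoothingData m Ω φ x₀ r s ρ) {x : EuclideanSpace ℝ (Fin N)}
    (hx : x ∈ Ω) {w : EuclideanSpace ℝ (Fin N)} (hw : ‖w‖ ≤ (1 - s) * r) :
    s • x + (1 - s) • x₀ - w ∈ core Ω x₀ r s := by
  obtain ⟨z, hz, e⟩ := D.exists_eq x hw
  exact ⟨(x, z), ⟨subset_closure hx, hz⟩, e.symm⟩

/-- For `x ∈ Ω` the kernel `y ↦ ρ (s • x + (1 - s) • x₀ - y)` therefore vanishes off the core, and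
integrals against it may be taken over the core, Ω or the whole space alike. -/
theorem norm_sub_not_le (D : SmoothingData m Ω φ x₀ r s ρ) {x y : EuclideanSpace ℝ (Fin N)}
    (hx : x ∈ Ω) (hy : y ∉ core Ω x₀ r s) : ¬ ‖s • x + (1 - s) • x₀ - y‖ ≤ (1 - s) * r :=
  fun hle => hy (by simpa using D.mem_core hx hle)

/-- The weight is bounded below on the compact core, so weighted integrability gives Lebesgue
integrability there. -/
theorem exists_restrict_core_le (D : SmoothingData m Ω φ x₀ r s ρ) :
    ∃ c : ℝ, 0 < c ∧ volume.restrict (core Ω x₀ r s) ≤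
      ENNReal.ofReal c • weightedMeasure Ω φ := by
  obtain ⟨c, hc, hφ⟩ := D.weight.exists_pos_le D.isCompact_core D.core_subset
  refine ⟨c⁻¹, inv_pos.2 hc, Measure.le_iff.2 fun S hS => ?_⟩
  have hone : Measurable (S.indicator (1 : EuclideanSpace ℝ (Fin N) → ℝ≥0∞)) :=
    measurable_one.indicator hS
  rw [Measure.smul_apply, ← lintegral_indicator_one hS, ← lintegral_indicator_one hS,
    D.weight.lintegral_eq hone, smul_eq_mul, ← lintegral_const_mul' _ _ ENNReal.ofReal_ne_top,
    ← lintegral_indicator D.measurableSet_core]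
  refine lintegral_mono fun x => ?_
  by_cases hx : x ∈ core Ω x₀ r s
  · rw [indicator_of_mem hx, indicator_of_mem (D.core_subset hx), ← mul_assoc,
      ← ENNReal.ofReal_mul (inv_pos.2 hc).le]
    refine le_mul_of_one_le_left zero_le ?_
    rw [ENNReal.one_le_ofReal, inv_mul_eq_div, one_le_div hc]
    exact hφ x hx
  · simp [hx]

theorem integrableOn_core (D : SmoothingData m Ω φ x₀ r s ρ)
    {u : EuclideanSpace ℝ (Fin N) → ℝ} (hu : Integrable u (weightedMeasure Ω φ)) :
    IntegrableOn u (core Ω x₀ r s) := by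
  obtain ⟨c, -, hle⟩ := D.exists_restrict_core_le
  exact (hu.smul_measure ENNReal.ofReal_ne_top).mono_measure hle

/-- With the cutoff to the core this holds at every point of ℝ^N, not only on Ω. Smoothness, compact
support and the derivative formula then follow from convolution theory. -/
theorem smoothing_eq_convolution (D : SmoothingData m Ω φ x₀ r s ρ)
    (u : EuclideanSpace ℝ (Fin N) → ℝ) :
    smoothing Ω x₀ r s ρ u = fun x => convolution ((core Ω x₀ r s).indicator u) ρ
      (ContinuousLinearMap.lsmul ℝ ℝ) volume (s • x + (1 - s) • x₀) := by
  ext x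
  rw [smoothing, convolution, ← integral_indicator D.measurableSet_core]
  refine integral_congr_ae (.of_forall fun y => ?_)
  by_cases hy : y ∈ core Ω x₀ r s <;> simp [hy]

theorem contDiff_smoothing (D : SmoothingData m Ω φ x₀ r s ρ)
    {u : EuclideanSpace ℝ (Fin N) → ℝ} (hu : Integrable u (weightedMeasure Ω φ)) :
    ContDiff ℝ (⊤ : ℕ∞) (smoothing Ω x₀ r s ρ u) := by
  rw [D.smoothing_eq_convolution]
  have hi := ((integrable_indicator_iff D.measurableSet_core).2
    (D.integrableOn_core hu)).locallyIntegrable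
  exact (D.mollifier.hasCompactSupport.contDiff_convolution_right
    (ContinuousLinearMap.lsmul ℝ ℝ) hi D.mollifier.contDiff).comp (by fun_prop)

theorem hasCompactSupport_smoothing (D : SmoothingData m Ω φ x₀ r s ρ)
    (u : EuclideanSpace ℝ (Fin N) → ℝ) :
    HasCompactSupport (smoothing Ω x₀ r s ρ u) := by
  rw [D.smoothing_eq_convolution]
  have hc : HasCompactSupport ((core Ω x₀ r s).indicator u) :=
    HasCompactSupport.intro D.isCompact_core fun x hx => indicator_of_notMem hx u
  exact (hc.convolution (ContinuousLinearMap.lsmul ℝ ℝ)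
    D.mollifier.hasCompactSupport).comp_homeomorph
      ((Homeomorph.smulOfNeZero s D.ratio_pos.ne').trans (Homeomorph.addRight ((1 - s) • x₀)))

theorem fderiv_smoothing_apply (D : SmoothingData m Ω φ x₀ r s ρ)
    {u : EuclideanSpace ℝ (Fin N) → ℝ} (hu : Integrable u (weightedMeasure Ω φ))
    (x e : EuclideanSpace ℝ (Fin N)) :
    fderiv ℝ (smoothing Ω x₀ r s ρ u) x e =
      ∫ y in core Ω x₀ r s, u y * (s * fderiv ℝ ρ (s • x + (1 - s) • x₀ - y) e) := by
  rw [D.smoothing_eq_convolution]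
  have hi := ((integrable_indicator_iff D.measurableSet_core).2
    (D.integrableOn_core hu)).locallyIntegrable
  have h1 := D.mollifier.hasCompactSupport.hasFDerivAt_convolution_right
    (ContinuousLinearMap.lsmul ℝ ℝ) hi (D.mollifier.contDiff.of_le (by simp))
    (s • x + (1 - s) • x₀)
  have h2 : HasFDerivAt (fun x : EuclideanSpace ℝ (Fin N) => s • x + (1 - s) • x₀)
      (s • ContinuousLinearMap.id ℝ (EuclideanSpace ℝ (Fin N))) x :=
    ((hasFDerivAt_id x).const_smul s).add_const _
  have h3 := h1.comp x h2
  simp only [Function.comp_def] at h3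
  rw [h3.fderiv, ContinuousLinearMap.comp_apply, convolution_precompR_apply _ hi (D.mollifier.hasCompactSupport.fderiv ℝ)
      D.mollifier.continuous_fderiv, convolution, ← integral_indicator D.measurableSet_core]
  refine integral_congr_ae (.of_forall fun y => ?_)
  by_cases hy : y ∈ core Ω x₀ r s <;> simp [hy]

theorem smoothing_eq_integral (D : SmoothingData m Ω φ x₀ r s ρ)
    (u : EuclideanSpace ℝ (Fin N) → ℝ) {x : EuclideanSpace ℝ (Fin N)} (hx : x ∈ Ω) :
    smoothing Ω x₀ r s ρ u x = ∫ w, u (s • x + (1 - s) • x₀ - w) * ρ w := by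
  rw [smoothing, setIntegral_eq_integral_of_forall_compl_eq_zero fun y hy => by
    rw [D.mollifier.eq_zero (D.norm_sub_not_le hx hy), mul_zero],
    ← integral_sub_left_eq_self _ _ (s • x + (1 - s) • x₀)]
  simp

theorem smoothing_congr (D : SmoothingData m Ω φ x₀ r s ρ)
    {u v : EuclideanSpace ℝ (Fin N) → ℝ} (h : u =ᵐ[weightedMeasure Ω φ] v) :
    smoothing Ω x₀ r s ρ u = smoothing Ω x₀ r s ρ v := by
  ext x
  have h' : u =ᵐ[volume.restrict (core Ω x₀ r s)] v := ae_mono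
    (Measure.restrict_mono D.core_subset le_rfl) (D.weight.restrict_absolutelyContinuous.ae_eq h)
  refine integral_congr_ae ?_
  filter_upwards [h'] with y hy
  rw [hy]

theorem integrable_comp_mul (D : SmoothingData m Ω φ x₀ r s ρ)
    {u : EuclideanSpace ℝ (Fin N) → ℝ} (hu : Integrable u (weightedMeasure Ω φ))
    {x : EuclideanSpace ℝ (Fin N)} (hx : x ∈ Ω) :
    Integrable fun w => u (s • x + (1 - s) • x₀ - w) * ρ w := by
  obtain ⟨C, -, hC⟩ := D.mollifier.exists_bound
  have h1 : Integrable fun y => ρ (s • x + (1 - s) • x₀ - y) * (core Ω x₀ r s).indicator u y :=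
    ((integrable_indicator_iff D.measurableSet_core).2 (D.integrableOn_core hu)).bdd_mul
      (D.mollifier.continuous.comp (by fun_prop)).aestronglyMeasurable
      (.of_forall fun y => hC _)
  have h2 := (integrable_comp_sub_left _ (s • x + (1 - s) • x₀)).2 h1
  refine h2.congr (.of_forall fun w => ?_)
  simp only [sub_sub_cancel]
  by_cases hw : ‖w‖ ≤ (1 - s) * r
  · rw [indicator_of_mem (D.mem_core hx hw), mul_comm]
  · simp [D.mollifier.eq_zero hw]

/-- Since `ρ` has integral 1, the constant `u x` can be brought inside the average. -/
theorem enorm_smoothing_sub_le (D : SmoothingData m Ω φ x₀ r s ρ)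
    {u : EuclideanSpace ℝ (Fin N) → ℝ} (hu : Integrable u (weightedMeasure Ω φ))
    {x : EuclideanSpace ℝ (Fin N)} (hx : x ∈ Ω) :
    ‖smoothing Ω x₀ r s ρ u x - u x‖ₑ ≤
      ∫⁻ w, ENNReal.ofReal (ρ w) * ‖u (s • x + (1 - s) • x₀ - w) - u x‖ₑ := by
  have e : smoothing Ω x₀ r s ρ u x - u x =
      ∫ w, (u (s • x + (1 - s) • x₀ - w) - u x) * ρ w := by
    simp_rw [sub_mul]
    rw [integral_sub (D.integrable_comp_mul hu hx) (D.mollifier.integrable.const_mul _),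
      integral_const_mul, D.mollifier.integral_eq_one, mul_one, D.smoothing_eq_integral u hx]
  rw [e]
  refine (enorm_integral_le_lintegral_enorm _).trans (le_of_eq (lintegral_congr fun w => ?_))
  rw [enorm_mul, mul_comm, Real.enorm_of_nonneg (D.mollifier.nonneg w)]

/-- Averaged form of `ConcaveWeight.lintegral_comp_le`. -/
theorem lintegral_lintegral_le_of_forall (D : SmoothingData m Ω φ x₀ r s ρ)
    {F : EuclideanSpace ℝ (Fin N) → EuclideanSpace ℝ (Fin N) → ℝ≥0∞}
    (hF : Measurable (Function.uncurry F)) {B : ℝ≥0∞}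
    (hB : ∀ w, ‖w‖ ≤ (1 - s) * r → ∫⁻ x, F x w ∂(weightedMeasure Ω φ) ≤ B) :
    ∫⁻ x, (∫⁻ w, ENNReal.ofReal (ρ w) * F x w) ∂(weightedMeasure Ω φ) ≤ B := by
  have := D.weight.isFiniteMeasure
  have hρ : Measurable fun w => ENNReal.ofReal (ρ w) :=
    ENNReal.measurable_ofReal.comp D.mollifier.continuous.measurable
  rw [lintegral_lintegral_swap ((hρ.comp measurable_snd).mul hF).aemeasurable]
  calc ∫⁻ w, ∫⁻ x, ENNReal.ofReal (ρ w) * F x w ∂(weightedMeasure Ω φ)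
      ≤ ∫⁻ w, ENNReal.ofReal (ρ w) * B := by
        refine lintegral_mono fun w => ?_
        rw [lintegral_const_mul' _ _ ENNReal.ofReal_ne_top]
        by_cases hw : ‖w‖ ≤ (1 - s) * r
        · gcongr
          exact hB w hw
        · simp [D.mollifier.eq_zero hw]
    _ = B := by rw [lintegral_mul_const _ hρ, D.mollifier.lintegral_eq_one, one_mul]

/-- Smoothing increases the weighted `L¹` norm of the gradient by a controlled factor. -/
theorem lintegral_fderiv_smoothing_le (D : SmoothingData m Ω φ x₀ r s ρ)
    {u : EuclideanSpace ℝ (Fin N) → ℝ} {G : EuclideanSpace ℝ (Fin N) → EuclideanSpace ℝ (Fin N)}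
    (h : MemW11 Ω φ u G) :
    ∫⁻ x, ‖fderiv ℝ (smoothing Ω x₀ r s ρ u) x‖ₑ ∂(weightedMeasure Ω φ) ≤
      ENNReal.ofReal (s ^ (m + N))⁻¹ * ∫⁻ x, ‖G x‖ₑ ∂(weightedMeasure Ω φ) := by
  obtain ⟨hu, hG, -, -, hw⟩ := h
  obtain ⟨G', hG'm, hGG'⟩ := hG.1
  have hGΩ : G =ᵐ[volume.restrict Ω] G' := D.weight.restrict_absolutelyContinuous.ae_eq hGG'
  have key : ∀ x ∈ Ω, ‖fderiv ℝ (smoothing Ω x₀ r s ρ u) x‖ₑ ≤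
      ∫⁻ w, ENNReal.ofReal (ρ w) * ‖G' (s • x + (1 - s) • x₀ - w)‖ₑ := fun x hx => by
    refine ContinuousLinearMap.opENorm_le_bound _ fun e => ?_
    set a := s • x + (1 - s) • x₀ with ha
    -- The kernel seen from `x` is supported in the core, hence compactly in Ω, so it is a
    -- legitimate test function for the weak gradient.
    set ψ : EuclideanSpace ℝ (Fin N) → ℝ := fun y => ρ (a - y) with hψ
    have hψs : ContDiff ℝ (⊤ : ℕ∞) ψ := D.mollifier.contDiff.comp (by fun_prop)
    have hψc : HasCompactSupport ψ :=
      D.mollifier.hasCompactSupport.comp_homeomorph (Homeomorph.subLeft a)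
    have hψt : tsupport ψ ⊆ Ω := by
      refine Subset.trans (closure_minimal ?_ D.isCompact_core.isClosed) D.core_subset
      intro y hy
      by_contra hyK
      exact hy (D.mollifier.eq_zero (D.norm_sub_not_le hx hyK))
    have hψd : ∀ y, fderiv ℝ ψ y e = - fderiv ℝ ρ (a - y) e := fun y =>
      fderiv_comp_const_sub (D.mollifier.contDiff.differentiable (by simp)) a y e
    have hval : fderiv ℝ (smoothing Ω x₀ r s ρ u) x e =
        s * ∫ y in Ω, inner ℝ (G' y) e * ψ y := by
      have h1 := hw ψ hψs hψc hψt e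
      simp_rw [hψd, mul_neg, integral_neg, neg_inj] at h1
      have h2 : ∫ y in Ω, inner ℝ (G y) e * ψ y = ∫ y in Ω, inner ℝ (G' y) e * ψ y := by
        refine integral_congr_ae ?_
        filter_upwards [hGΩ] with y hy
        rw [hy]
      rw [← h2, ← h1, D.fderiv_smoothing_apply hu, ← integral_const_mul,
        setIntegral_eq_integral_of_forall_compl_eq_zero fun y hy => by
          rw [D.mollifier.fderiv_eq_zero (D.norm_sub_not_le hx hy)]; simp,
        setIntegral_eq_integral_of_forall_compl_eq_zero fun y hy => by
          rw [ha, D.mollifier.fderiv_eq_zero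
            (D.norm_sub_not_le hx fun hK => hy (D.core_subset hK))]; simp]
      exact integral_congr_ae (.of_forall fun y => by ring)
    have hs1 : ‖s‖ₑ ≤ 1 := by
      rw [Real.enorm_of_nonneg D.ratio_pos.le, ENNReal.ofReal_le_one]
      exact D.ratio_lt_one.le
    calc ‖fderiv ℝ (smoothing Ω x₀ r s ρ u) x e‖ₑ
        = ‖s‖ₑ * ‖∫ y in Ω, inner ℝ (G' y) e * ψ y‖ₑ := by rw [hval, enorm_mul]
      _ ≤ 1 * ∫⁻ y in Ω, ‖inner ℝ (G' y) e * ψ y‖ₑ := by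
          gcongr
          exact enorm_integral_le_lintegral_enorm _
      _ ≤ ∫⁻ y, ‖inner ℝ (G' y) e * ψ y‖ₑ := by
          rw [one_mul]
          exact lintegral_mono' Measure.restrict_le_self le_rfl
      _ ≤ ∫⁻ y, (ENNReal.ofReal (ρ (a - y)) * ‖G' y‖ₑ) * ‖e‖ₑ := by
          refine lintegral_mono fun y => ?_
          rw [enorm_mul, hψ, Real.enorm_of_nonneg (D.mollifier.nonneg _), mul_comm, mul_assoc]
          gcongr
          rw [← enorm_norm (G' y), ← enorm_norm e, ← enorm_mul]
          refine enorm_le_iff_norm_le.2 ?_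
          simpa using norm_inner_le_norm (𝕜 := ℝ) (G' y) e
      _ = (∫⁻ w, ENNReal.ofReal (ρ w) * ‖G' (a - w)‖ₑ) * ‖e‖ₑ := by
          rw [lintegral_mul_const' _ _ enorm_ne_top]
          congr 1
          rw [← lintegral_sub_left_eq_self _ a]
          simp
  calc ∫⁻ x, ‖fderiv ℝ (smoothing Ω x₀ r s ρ u) x‖ₑ ∂(weightedMeasure Ω φ)
      ≤ ∫⁻ x, (∫⁻ w, ENNReal.ofReal (ρ w) * ‖G' (s • x + (1 - s) • x₀ - w)‖ₑ)
          ∂(weightedMeasure Ω φ) := by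
        refine lintegral_mono_ae ?_
        filter_upwards [D.weight.ae_mem] with x hx using key x hx
    _ ≤ ENNReal.ofReal (s ^ (m + N))⁻¹ * ∫⁻ x, ‖G' x‖ₑ ∂(weightedMeasure Ω φ) := by
        refine D.lintegral_lintegral_le_of_forall
          (F := fun x w => ‖G' (s • x + (1 - s) • x₀ - w)‖ₑ) ?_ fun w hw => ?_
        · exact hG'm.measurable.enorm.comp (by fun_prop)
        · exact D.weight.lintegral_comp_le D.radius_pos.le D.ball_subset D.ratio_pos
            D.ratio_lt_one.le hw (f := fun x => ‖G' x‖ₑ) hG'm.measurable.enorm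
    _ = _ := by
        congr 1
        refine lintegral_congr_ae ?_
        filter_upwards [hGG'] with x hx
        rw [hx]

end SmoothingData

theorem ConcaveWeight.integrable_of_continuous {F : Type*} [NormedAddCommGroup F]
    (h : ConcaveWeight m Ω φ) {f : EuclideanSpace ℝ (Fin N) → F} (hf : Continuous f) :
    Integrable f (weightedMeasure Ω φ) := by
  have := h.isFiniteMeasure
  have h1 : IntegrableOn f (closure Ω) (weightedMeasure Ω φ) :=
    hf.continuousOn.integrableOn_compact h.isBounded.isCompact_closure
  rwa [IntegrableOn, Measure.restrict_eq_self_of_ae_mem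
    (h.ae_mem.mono fun x hx => subset_closure hx)] at h1

theorem ConcaveWeight.aemeasurable_weightedMeasure (h : ConcaveWeight m Ω φ) :
    AEMeasurable φ (weightedMeasure Ω φ) :=
  h.aemeasurable.mono_ac ConcaveWeight.absolutelyContinuous_restrict

/-! ### The adjoint of the smoothing and the gradient bound -/

namespace SmoothingData

variable {x₀ : EuclideanSpace ℝ (Fin N)} {r s : ℝ} {ρ : EuclideanSpace ℝ (Fin N) → ℝ}

theorem setIntegral_core_eq (D : SmoothingData m Ω φ x₀ r s ρ)
    (f : EuclideanSpace ℝ (Fin N) → ℝ) :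
    ∫ y in core Ω x₀ r s, f y =
      ∫ y, (core Ω x₀ r s).indicator (fun y => (φ y)⁻¹ * f y) y ∂(weightedMeasure Ω φ) := by
  rw [D.weight.weightedMeasure_eq,
    integral_withDensity_eq_integral_toReal_smul D.weight.measurable_density
      (.of_forall fun x => by by_cases hx : x ∈ Ω <;> simp [hx]),
    ← integral_indicator D.measurableSet_core]
  refine integral_congr_ae (.of_forall fun y => ?_)
  by_cases hy : y ∈ core Ω x₀ r s
  · have hΩ := D.core_subset hy
    have hφ := D.weight.pos y hΩ
    simp only [indicator_of_mem hy, indicator_of_mem hΩ, ENNReal.toReal_ofReal hφ.le, smul_eq_mul]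
    field_simp
  · simp [hy]

/-- The density of the weighted divergence of the field dual to the gradient of a smoothing. -/
def dualDensity (Ω : Set (EuclideanSpace ℝ (Fin N))) (φ : EuclideanSpace ℝ (Fin N) → ℝ)
    (x₀ : EuclideanSpace ℝ (Fin N)) (s : ℝ) (ρ : EuclideanSpace ℝ (Fin N) → ℝ)
    (τ : EuclideanSpace ℝ (Fin N) → EuclideanSpace ℝ (Fin N))
    (y : EuclideanSpace ℝ (Fin N)) : ℝ :=
  ∫ x, s * fderiv ℝ ρ (s • x + (1 - s) • x₀ - y) (τ x) ∂(weightedMeasure Ω φ)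

/-- The field dual to the gradient of a smoothing, times the weight. -/
def dualField (Ω : Set (EuclideanSpace ℝ (Fin N))) (φ : EuclideanSpace ℝ (Fin N) → ℝ)
    (x₀ : EuclideanSpace ℝ (Fin N)) (s : ℝ) (ρ : EuclideanSpace ℝ (Fin N) → ℝ)
    (τ : EuclideanSpace ℝ (Fin N) → EuclideanSpace ℝ (Fin N))
    (y : EuclideanSpace ℝ (Fin N)) : EuclideanSpace ℝ (Fin N) :=
  ∫ x, (s * ρ (s • x + (1 - s) • x₀ - y)) • τ x ∂(weightedMeasure Ω φ)

variable {τ : EuclideanSpace ℝ (Fin N) → EuclideanSpace ℝ (Fin N)}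

theorem stronglyMeasurable_dualDensity_integrand (D : SmoothingData m Ω φ x₀ r s ρ)
    (hτ : Measurable τ) : StronglyMeasurable
      fun p : EuclideanSpace ℝ (Fin N) × EuclideanSpace ℝ (Fin N) =>
        s * fderiv ℝ ρ (s • p.1 + (1 - s) • x₀ - p.2) (τ p.1) := by
  have h1 : Measurable fun p : EuclideanSpace ℝ (Fin N) × EuclideanSpace ℝ (Fin N) =>
      fderiv ℝ ρ (s • p.1 + (1 - s) • x₀ - p.2) :=
    (D.mollifier.continuous_fderiv.comp (by fun_prop)).measurable
  have h2 : Measurable fun p : EuclideanSpace ℝ (Fin N) × EuclideanSpace ℝ (Fin N) =>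
      fderiv ℝ ρ (s • p.1 + (1 - s) • x₀ - p.2) (τ p.1) :=
    (isBoundedBilinearMap_apply (𝕜 := ℝ) (E := EuclideanSpace ℝ (Fin N))
      (F := ℝ)).continuous.measurable.comp (h1.prodMk (hτ.comp measurable_fst))
  exact (h2.const_mul s).stronglyMeasurable

theorem stronglyMeasurable_dualField_integrand (D : SmoothingData m Ω φ x₀ r s ρ)
    (hτ : Measurable τ) : StronglyMeasurable
      fun p : EuclideanSpace ℝ (Fin N) × EuclideanSpace ℝ (Fin N) =>
        (s * ρ (s • p.1 + (1 - s) • x₀ - p.2)) • τ p.1 := by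
  have h1 : Measurable fun p : EuclideanSpace ℝ (Fin N) × EuclideanSpace ℝ (Fin N) =>
      s * ρ (s • p.1 + (1 - s) • x₀ - p.2) :=
    (continuous_const.mul (D.mollifier.continuous.comp (by fun_prop))).measurable
  exact (h1.smul (hτ.comp measurable_fst)).stronglyMeasurable

theorem measurable_dualDensity (D : SmoothingData m Ω φ x₀ r s ρ) (hτ : Measurable τ) :
    StronglyMeasurable (dualDensity Ω φ x₀ s ρ τ) := by
  have := D.weight.isFiniteMeasure
  exact (D.stronglyMeasurable_dualDensity_integrand hτ).integral_prod_left

theorem measurable_dualField (D : SmoothingData m Ω φ x₀ r s ρ) (hτ : Measurable τ) :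
    StronglyMeasurable (dualField Ω φ x₀ s ρ τ) := by
  have := D.weight.isFiniteMeasure
  exact (D.stronglyMeasurable_dualField_integrand hτ).integral_prod_left

theorem exists_dualDensity_bound (D : SmoothingData m Ω φ x₀ r s ρ) (hτ1 : ∀ x, ‖τ x‖ ≤ 1) :
    ∃ C : ℝ, 0 ≤ C ∧ ∀ y, ‖dualDensity Ω φ x₀ s ρ τ y‖ ≤ C := by
  have := D.weight.isFiniteMeasure
  obtain ⟨L, hL0, hL⟩ := D.mollifier.exists_fderiv_bound
  refine ⟨s * L * (weightedMeasure Ω φ).real univ,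
    mul_nonneg (mul_nonneg D.ratio_pos.le hL0) measureReal_nonneg, fun y => ?_⟩
  refine norm_integral_le_of_norm_le_const (.of_forall fun x => ?_)
  rw [norm_mul, Real.norm_of_nonneg D.ratio_pos.le]
  refine mul_le_mul_of_nonneg_left ?_ D.ratio_pos.le
  simpa using ((fderiv ℝ ρ (s • x + (1 - s) • x₀ - y)).le_opNorm_of_le (hτ1 x)).trans
    (mul_le_mul_of_nonneg_right (hL _) zero_le_one)

/-- Where the kernel is nonzero, `y = s • x + (1 - s) • z` with `z` in the ball, so `φ x ≤ (s ^ m)⁻¹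
* φ y`. What remains is the integral of the dilated mollifier, `(s ^ N)⁻¹`. The factor `φ y` on the
right is what makes the dual field admissible after division by the weight. -/
theorem lintegral_mollifier_le (D : SmoothingData m Ω φ x₀ r s ρ)
    (y : EuclideanSpace ℝ (Fin N)) :
    ∫⁻ x, ENNReal.ofReal (ρ (s • x + (1 - s) • x₀ - y)) ∂(weightedMeasure Ω φ) ≤
      ENNReal.ofReal ((s ^ (m + N))⁻¹ * φ y) := by
  have hρ : Measurable fun y' => ENNReal.ofReal (ρ (y' - y)) :=
    ENNReal.measurable_ofReal.comp (D.mollifier.continuous.comp (by fun_prop)).measurable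
  have hs := D.ratio_pos
  rw [D.weight.lintegral_eq (f := fun x => ENNReal.ofReal (ρ (s • x + (1 - s) • x₀ - y)))
    (hρ.comp (by fun_prop : Measurable fun x : EuclideanSpace ℝ (Fin N) =>
      s • x + (1 - s) • x₀))]
  calc ∫⁻ x, Ω.indicator (fun x => ENNReal.ofReal (φ x)) x *
        ENNReal.ofReal (ρ (s • x + (1 - s) • x₀ - y))
      ≤ ∫⁻ x, ENNReal.ofReal ((s ^ m)⁻¹ * φ y) *
        ENNReal.ofReal (ρ (s • x + (1 - s) • x₀ - y)) := by
        refine lintegral_mono fun x => ?_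
        by_cases hx : x ∈ Ω
        · by_cases hw : ‖s • x + (1 - s) • x₀ - y‖ ≤ (1 - s) * r
          · obtain ⟨z, hz, e⟩ := D.exists_eq x hw
            rw [sub_sub_cancel] at e
            rw [indicator_of_mem hx]
            gcongr
            rw [e]
            exact D.weight.le_inv_pow_mul hx (D.ball_subset hz) hs D.ratio_lt_one.le
          · simp [D.mollifier.eq_zero hw]
        · simp [hx]
    _ = ENNReal.ofReal ((s ^ m)⁻¹ * φ y) * (ENNReal.ofReal (s ^ N)⁻¹ * 1) := by
        rw [lintegral_const_mul' _ _ ENNReal.ofReal_ne_top,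
          ConcaveWeight.lintegral_comp_smul_add hρ hs,
          lintegral_sub_right_eq_self (fun x => ENNReal.ofReal (ρ x)),
          D.mollifier.lintegral_eq_one]
    _ = ENNReal.ofReal ((s ^ (m + N))⁻¹ * φ y) := by
        rw [mul_one, mul_comm, ← ENNReal.ofReal_mul (by positivity), pow_add, mul_inv]
        congr 1
        ring

theorem norm_dualField_le (D : SmoothingData m Ω φ x₀ r s ρ) (hτ1 : ∀ x, ‖τ x‖ ≤ 1)
    {y : EuclideanSpace ℝ (Fin N)} (hy : y ∈ Ω) :
    ‖dualField Ω φ x₀ s ρ τ y‖ ≤ (s ^ (m + N))⁻¹ * φ y := by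
  have hs := D.ratio_pos
  have h0 : 0 ≤ (s ^ (m + N))⁻¹ * φ y := mul_nonneg (by positivity) (D.weight.pos y hy).le
  rw [← ENNReal.ofReal_le_ofReal_iff h0, ofReal_norm]
  refine (enorm_integral_le_lintegral_enorm _).trans
    (le_trans (lintegral_mono fun x => ?_) (D.lintegral_mollifier_le y))
  have hρ := D.mollifier.nonneg (s • x + (1 - s) • x₀ - y)
  rw [← ofReal_norm, norm_smul, Real.norm_of_nonneg (mul_nonneg hs.le hρ)]
  refine ENNReal.ofReal_le_ofReal ?_
  calc s * ρ (s • x + (1 - s) • x₀ - y) * ‖τ x‖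
      ≤ 1 * ρ (s • x + (1 - s) • x₀ - y) * 1 := by
        have := D.ratio_lt_one.le
        gcongr
        exact hτ1 x
    _ = _ := by ring

/-- Duality between the gradient of the smoothing and `dualDensity`. -/
theorem integral_fderiv_smoothing (D : SmoothingData m Ω φ x₀ r s ρ)
    {u : EuclideanSpace ℝ (Fin N) → ℝ} (hu : Integrable u (weightedMeasure Ω φ))
    (hτ : Measurable τ) (hτ1 : ∀ x, ‖τ x‖ ≤ 1) :
    ∫ x, fderiv ℝ (smoothing Ω x₀ r s ρ u) x (τ x) ∂(weightedMeasure Ω φ) =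
      ∫ y in core Ω x₀ r s, u y * dualDensity Ω φ x₀ s ρ τ y := by
  have := D.weight.isFiniteMeasure
  obtain ⟨L, hL0, hL⟩ := D.mollifier.exists_fderiv_bound
  simp_rw [D.fderiv_smoothing_apply hu]
  rw [integral_integral_swap]
  · refine integral_congr_ae (.of_forall fun y => ?_)
    simp only [dualDensity]
    rw [integral_const_mul]
  · have h1 : Integrable (fun p : EuclideanSpace ℝ (Fin N) × EuclideanSpace ℝ (Fin N) => u p.2)
        ((weightedMeasure Ω φ).prod (volume.restrict (core Ω x₀ r s))) :=
      Integrable.comp_snd (D.integrableOn_core hu) _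
    refine (h1.bdd_mul (D.stronglyMeasurable_dualDensity_integrand hτ).aestronglyMeasurable
      (c := s * L) (.of_forall fun p => ?_)).congr (.of_forall fun p => mul_comm _ _)
    rw [norm_mul, Real.norm_of_nonneg D.ratio_pos.le]
    refine mul_le_mul_of_nonneg_left ?_ D.ratio_pos.le
    simpa using ((fderiv ℝ ρ (s • p.1 + (1 - s) • x₀ - p.2)).le_opNorm_of_le (hτ1 p.1)).trans
      (mul_le_mul_of_nonneg_right (hL _) zero_le_one)

/-- Integration by parts moves the derivative from the kernel to `ψ`. There is no boundary term,
because the kernel seen from `x ∈ Ω` vanishes off the core. -/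
theorem fderiv_smoothing_testFunction (D : SmoothingData m Ω φ x₀ r s ρ)
    {ψ : EuclideanSpace ℝ (Fin N) → ℝ} (hψ : ContDiff ℝ (⊤ : ℕ∞) ψ) (hc : HasCompactSupport ψ)
    {x : EuclideanSpace ℝ (Fin N)} (hx : x ∈ Ω) (e : EuclideanSpace ℝ (Fin N)) :
    fderiv ℝ (smoothing Ω x₀ r s ρ ψ) x e =
      ∫ y in core Ω x₀ r s, fderiv ℝ ψ y ((s * ρ (s • x + (1 - s) • x₀ - y)) • e) := by
  have hd := D.mollifier.contDiff.differentiable (by simp)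
  have hψd := hψ.differentiable (by simp)
  have hψc := hψ.continuous_fderiv (by simp)
  have hρc := D.mollifier.continuous
  have hρc' := D.mollifier.continuous_fderiv
  rw [D.fderiv_smoothing_apply (D.weight.integrable_of_continuous hψ.continuous)]
  set a := s • x + (1 - s) • x₀ with ha
  rw [setIntegral_eq_integral_of_forall_compl_eq_zero fun y hy => by
      rw [D.mollifier.fderiv_eq_zero (D.norm_sub_not_le hx hy)]; simp,
    setIntegral_eq_integral_of_forall_compl_eq_zero fun y hy => by
      rw [D.mollifier.eq_zero (D.norm_sub_not_le hx hy)]; simp]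
  have hibp := integral_mul_fderiv_eq_neg_fderiv_mul_of_integrable
    (μ := (volume : Measure (EuclideanSpace ℝ (Fin N)))) (f := ψ) (g := fun y => ρ (a - y)) (v := e)
    ?_ ?_ ?_ (fun y _ => hψd y) (fun y _ => by fun_prop)
  · simp_rw [fderiv_comp_const_sub hd, mul_neg, integral_neg, neg_inj] at hibp
    simp_rw [map_smul, smul_eq_mul]
    calc ∫ y, ψ y * (s * fderiv ℝ ρ (a - y) e) = s * ∫ y, ψ y * fderiv ℝ ρ (a - y) e := by
          rw [← integral_const_mul]
          exact integral_congr_ae (.of_forall fun y => by ring)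
      _ = s * ∫ y, fderiv ℝ ψ y e * ρ (a - y) := by rw [hibp]
      _ = _ := by
          rw [← integral_const_mul]
          exact integral_congr_ae (.of_forall fun y => by ring)
  · exact Continuous.integrable_of_hasCompactSupport (by fun_prop)
      ((hc.fderiv_apply ℝ e).mul_right)
  · simp_rw [fderiv_comp_const_sub hd]
    exact Continuous.integrable_of_hasCompactSupport (by fun_prop) hc.mul_right
  · exact Continuous.integrable_of_hasCompactSupport (by fun_prop) hc.mul_right

/-- Compared with `integral_fderiv_smoothing` for the same `ψ`, this identifies the distributional
divergence of `dualField`, cut off to the core, as minus `dualDensity` there. -/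
theorem integral_fderiv_smoothing_testFunction (D : SmoothingData m Ω φ x₀ r s ρ)
    {ψ : EuclideanSpace ℝ (Fin N) → ℝ} (hψ : ContDiff ℝ (⊤ : ℕ∞) ψ) (hc : HasCompactSupport ψ)
    (hτ : Measurable τ) (hτ1 : ∀ x, ‖τ x‖ ≤ 1) :
    ∫ x, fderiv ℝ (smoothing Ω x₀ r s ρ ψ) x (τ x) ∂(weightedMeasure Ω φ) =
      ∫ y in core Ω x₀ r s, fderiv ℝ ψ y (dualField Ω φ x₀ s ρ τ y) := by
  have := D.weight.isFiniteMeasure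
  obtain ⟨L, hL0, hL⟩ := D.mollifier.exists_bound
  have hψc := hψ.continuous_fderiv (by simp)
  obtain ⟨B, hB⟩ := (hc.fderiv ℝ).exists_bound_of_continuous hψc
  have hB0 : 0 ≤ B := (norm_nonneg _).trans (hB 0)
  have hfin : IsFiniteMeasure ((volume : Measure (EuclideanSpace ℝ (Fin N))).restrict
      (core Ω x₀ r s)) := ⟨by simpa using D.isCompact_core.measure_lt_top⟩
  have hm := D.stronglyMeasurable_dualField_integrand hτ
  have hbd : ∀ p : EuclideanSpace ℝ (Fin N) × EuclideanSpace ℝ (Fin N),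
      ‖(s * ρ (s • p.1 + (1 - s) • x₀ - p.2)) • τ p.1‖ ≤ s * L * 1 := fun p => by
    rw [norm_smul, norm_mul, Real.norm_of_nonneg D.ratio_pos.le]
    have := D.ratio_pos
    gcongr
    exacts [hL _, hτ1 _]
  rw [integral_congr_ae (D.weight.ae_mem.mono fun x hx =>
    D.fderiv_smoothing_testFunction hψ hc hx (τ x)), integral_integral_swap]
  · refine integral_congr_ae (.of_forall fun y => ?_)
    refine (fderiv ℝ ψ y).integral_comp_comm ?_
    exact Integrable.of_bound
      (hm.comp_measurable (measurable_prodMk_right (y := y))).aestronglyMeasurable (s * L * 1)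
      (.of_forall fun x => hbd (x, y))
  · refine Integrable.of_bound ?_ (B * (s * L * 1)) (.of_forall fun p => ?_)
    · have h1 : Measurable fun p : EuclideanSpace ℝ (Fin N) × EuclideanSpace ℝ (Fin N) =>
          fderiv ℝ ψ p.2 := hψc.measurable.comp measurable_snd
      exact ((isBoundedBilinearMap_apply (𝕜 := ℝ) (E := EuclideanSpace ℝ (Fin N))
        (F := ℝ)).continuous.measurable.comp (h1.prodMk hm.measurable)).aestronglyMeasurable
    · exact (ContinuousLinearMap.le_opNorm _ _).trans
        (mul_le_mul (hB _) (hbd p) (norm_nonneg _) hB0)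

/-- The norm bound is `norm_dualField_le`; the divergence identity is the equality of the two Fubini
formulas for test functions, rewritten against the weighted measure. -/
theorem isAdmissibleField_dual (D : SmoothingData m Ω φ x₀ r s ρ)
    (hτ : Measurable τ) (hτ1 : ∀ x, ‖τ x‖ ≤ 1) :
    IsAdmissibleField (weightedMeasure Ω φ)
      ((core Ω x₀ r s).indicator fun y =>
        (φ y)⁻¹ • (s ^ (m + N)) • dualField Ω φ x₀ s ρ τ y)
      ((core Ω x₀ r s).indicator fun y =>
        (φ y)⁻¹ * -(s ^ (m + N) * dualDensity Ω φ x₀ s ρ τ y)) := by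
  have := D.weight.isFiniteMeasure
  have hs := D.ratio_pos
  have hφi := D.weight.aemeasurable_weightedMeasure.inv
  -- This lower bound on the weight makes the divergence density bounded.
  obtain ⟨c, hc, hcφ⟩ := D.weight.exists_pos_le D.isCompact_core D.core_subset
  obtain ⟨C, hC0, hC⟩ := D.exists_dualDensity_bound hτ1
  have hle : ∀ y, ‖(core Ω x₀ r s).indicator (fun y =>
      (φ y)⁻¹ • (s ^ (m + N)) • dualField Ω φ x₀ s ρ τ y) y‖ ≤ 1 := fun y => by
    by_cases hy : y ∈ core Ω x₀ r s
    · have hφ := D.weight.pos y (D.core_subset hy)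
      have h1 := D.norm_dualField_le hτ1 (D.core_subset hy)
      rw [indicator_of_mem hy, norm_smul, norm_smul, norm_inv, Real.norm_of_nonneg hφ.le,
        Real.norm_of_nonneg (by positivity : 0 ≤ s ^ (m + N)), inv_mul_le_iff₀ hφ, mul_one]
      rwa [inv_mul_eq_div, le_div_iff₀ (by positivity), mul_comm] at h1
    · simp [hy]
  refine ⟨?_, ?_, .of_forall hle, fun ψ hψ hψc => ?_⟩
  · refine MemLp.of_bound ?_ 1 (.of_forall hle)
    exact (hφi.aestronglyMeasurable.smul ((D.measurable_dualField hτ).const_smul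
      (s ^ (m + N))).aestronglyMeasurable).indicator D.measurableSet_core
  · refine MemLp.of_bound (C := c⁻¹ * (s ^ (m + N) * C)) ?_ (.of_forall fun y => ?_)
    · exact (hφi.aestronglyMeasurable.mul (((D.measurable_dualDensity hτ).const_mul
        (s ^ (m + N))).neg).aestronglyMeasurable).indicator D.measurableSet_core
    · by_cases hy : y ∈ core Ω x₀ r s
      · have hφ := D.weight.pos y (D.core_subset hy)
        rw [indicator_of_mem hy, norm_mul, norm_neg, norm_mul, norm_inv,
          Real.norm_of_nonneg hφ.le, Real.norm_of_nonneg (by positivity : 0 ≤ s ^ (m + N))]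
        gcongr
        exacts [hcφ y hy, hC y]
      · rw [indicator_of_notMem hy, norm_zero]
        positivity
  · have e1 := D.setIntegral_core_eq fun y => ψ y * dualDensity Ω φ x₀ s ρ τ y
    have e2 := D.setIntegral_core_eq fun y => fderiv ℝ ψ y (dualField Ω φ x₀ s ρ τ y)
    rw [← D.integral_fderiv_smoothing (D.weight.integrable_of_continuous hψ.continuous) hτ hτ1]
      at e1
    rw [← D.integral_fderiv_smoothing_testFunction hψ hψc hτ hτ1, e1] at e2
    calc _ = -(s ^ (m + N)) * ∫ y, (core Ω x₀ r s).indicator (fun y => (φ y)⁻¹ *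
            (ψ y * dualDensity Ω φ x₀ s ρ τ y)) y ∂(weightedMeasure Ω φ) := by
          rw [← integral_const_mul]
          refine integral_congr_ae (.of_forall fun y => ?_)
          by_cases hy : y ∈ core Ω x₀ r s
          · simp only [indicator_of_mem hy]; ring
          · simp [hy]
      _ = _ := by
          rw [e2, neg_mul, ← integral_const_mul]
          congr 1
          refine integral_congr_ae (.of_forall fun y => ?_)
          by_cases hy : y ∈ core Ω x₀ r s
          · simp only [indicator_of_mem hy, map_smul, smul_eq_mul]; ring
          · simp [hy]

/-- The gradient of a smoothing is controlled by the total variation. -/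
theorem lintegral_fderiv_smoothing_le_totalVariation (D : SmoothingData m Ω φ x₀ r s ρ)
    {u : EuclideanSpace ℝ (Fin N) → ℝ} (hu : Integrable u (weightedMeasure Ω φ)) :
    ∫⁻ x, ‖fderiv ℝ (smoothing Ω x₀ r s ρ u) x‖ₑ ∂(weightedMeasure Ω φ) ≤
      ENNReal.ofReal (s ^ (m + N))⁻¹ * totalVariation Ω φ u := by
  have hs := D.ratio_pos
  have hsp : 0 < s ^ (m + N) := by positivity
  have hcont : Continuous (fderiv ℝ (smoothing Ω x₀ r s ρ u)) :=
    (D.contDiff_smoothing hu).continuous_fderiv (by simp)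
  set L := fderiv ℝ (smoothing Ω x₀ r s ρ u) with hL
  set γ : EuclideanSpace ℝ (Fin N) → EuclideanSpace ℝ (Fin N) :=
    fun x => (InnerProductSpace.toDual ℝ (EuclideanSpace ℝ (Fin N))).symm (L x) with hγ
  have hγc : Continuous γ := (LinearIsometryEquiv.continuous _).comp hcont
  have hγn : ∀ x, ‖γ x‖ = ‖L x‖ := fun x => LinearIsometryEquiv.norm_map _ _
  -- The unit field along the gradient, which recovers the full norm in the duality pairing; it is
  -- zero where the gradient vanishes.
  set τ : EuclideanSpace ℝ (Fin N) → EuclideanSpace ℝ (Fin N) := fun x => ‖γ x‖⁻¹ • γ x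
  have hτ : Measurable τ := hγc.norm.measurable.inv.smul hγc.measurable
  have hτ1 : ∀ x, ‖τ x‖ ≤ 1 := fun x => by
    rw [norm_smul, norm_inv, norm_norm]
    exact inv_mul_le_one
  have hLτ : ∀ x, L x (τ x) = ‖L x‖ := fun x => by
    have : L x (γ x) = ‖γ x‖ * ‖γ x‖ := by
      rw [← real_inner_self_eq_norm_mul_norm]
      exact (InnerProductSpace.toDual_symm_apply).symm
    rw [map_smul, this, smul_eq_mul, hγn]
    by_cases h0 : ‖L x‖ = 0
    · simp [h0]
    · field_simp
  have hLi : Integrable (fun x => ‖L x‖) (weightedMeasure Ω φ) :=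
    D.weight.integrable_of_continuous hcont.norm
  have hadm := le_totalVariation u (D.isAdmissibleField_dual hτ hτ1)
  have hpair := D.integral_fderiv_smoothing hu hτ hτ1
  rw [D.setIntegral_core_eq] at hpair
  have e : - ∫ x, u x * (core Ω x₀ r s).indicator (fun y =>
        (φ y)⁻¹ * -(s ^ (m + N) * dualDensity Ω φ x₀ s ρ τ y)) x ∂(weightedMeasure Ω φ) =
      s ^ (m + N) * ∫ x, ‖L x‖ ∂(weightedMeasure Ω φ) := by
    rw [← integral_congr_ae (.of_forall hLτ), hpair, ← integral_const_mul, ← integral_neg]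
    refine integral_congr_ae (.of_forall fun y => ?_)
    by_cases hy : y ∈ core Ω x₀ r s
    · simp only [indicator_of_mem hy]; ring
    · simp [hy]
  rw [e, ENNReal.ofReal_mul hsp.le,
    ofReal_integral_eq_lintegral_ofReal hLi (.of_forall fun x => norm_nonneg _)] at hadm
  simp_rw [ofReal_norm] at hadm
  calc ∫⁻ x, ‖L x‖ₑ ∂(weightedMeasure Ω φ)
      = ENNReal.ofReal (s ^ (m + N))⁻¹ *
          (ENNReal.ofReal (s ^ (m + N)) * ∫⁻ x, ‖L x‖ₑ ∂(weightedMeasure Ω φ)) := by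
        rw [← mul_assoc, ← ENNReal.ofReal_mul (by positivity), inv_mul_cancel₀ hsp.ne',
          ENNReal.ofReal_one, one_mul]
    _ ≤ _ := by gcongr

end SmoothingData

/-! ### Convergence of the smoothings and strict density of test functions -/

theorem ConcaveWeight.exists_smoothingData (h : ConcaveWeight m Ω φ) :
    ∃ (x₀ : EuclideanSpace ℝ (Fin N)) (r : ℝ) (s : ℕ → ℝ)
      (ρ : ℕ → EuclideanSpace ℝ (Fin N) → ℝ),
      (∀ n, SmoothingData m Ω φ x₀ r (s n) (ρ n)) ∧ Tendsto s atTop (𝓝 1) := by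
  obtain ⟨x₀, hx₀⟩ := h.nonempty
  obtain ⟨r, hr, hball⟩ := Metric.nhds_basis_closedBall.mem_iff.1 (h.isOpen.mem_nhds hx₀)
  -- The ratio is `1 - 1 / (n + 2)`; the shift keeps it positive at `n = 0`.
  have hlim : Tendsto (fun n : ℕ => 1 - 1 / (((n + 1 : ℕ) : ℝ) + 1)) atTop (𝓝 1) := by
    simpa using (tendsto_one_div_add_atTop_nhds_zero_nat.comp (tendsto_add_atTop_nat 1)).const_sub
      (1 : ℝ)
  have hpos : ∀ n : ℕ, 0 < 1 - (1 - 1 / (((n + 1 : ℕ) : ℝ) + 1)) := fun n => by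
    rw [sub_sub_cancel]
    positivity
  choose ρ hρ using fun n : ℕ => exists_isMollifier (N := N) (mul_pos (hpos n) hr)
  refine ⟨x₀, r, _, ρ, fun n => ⟨h, hr, hball, ?_, sub_pos.1 (hpos n), hρ n⟩, hlim⟩
  rw [sub_pos, div_lt_one (by positivity)]
  push_cast
  linarith [(Nat.cast_nonneg n : (0 : ℝ) ≤ n)]

theorem tendsto_ofReal_inv_pow {s : ℕ → ℝ} (hs : Tendsto s atTop (𝓝 1)) (k : ℕ) :
    Tendsto (fun n => ENNReal.ofReal (s n ^ k)⁻¹) atTop (𝓝 1) := by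
  have h1 : Tendsto (fun n => (s n ^ k)⁻¹) atTop (𝓝 1) := by
    simpa using (hs.pow k).inv₀ (by simp)
  simpa [Function.comp_def] using (ENNReal.continuous_ofReal.tendsto _).comp h1

theorem SmoothingData.norm_sub_le {x₀ : EuclideanSpace ℝ (Fin N)} {r s R : ℝ}
    {ρ : EuclideanSpace ℝ (Fin N) → ℝ} (D : SmoothingData m Ω φ x₀ r s ρ)
    {x w : EuclideanSpace ℝ (Fin N)} (hx : ‖x - x₀‖ ≤ R) (hw : ‖w‖ ≤ (1 - s) * r) :
    ‖s • x + (1 - s) • x₀ - w - x‖ ≤ (1 - s) * (R + r) := by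
  have e : s • x + (1 - s) • x₀ - w - x = -((1 - s) • (x - x₀) + w) := by module
  rw [e, norm_neg, mul_add]
  refine (norm_add_le _ _).trans (add_le_add ?_ hw)
  rw [norm_smul, Real.norm_of_nonneg D.one_sub_pos.le]
  exact mul_le_mul_of_nonneg_left hx D.one_sub_pos.le

theorem ConcaveWeight.exists_norm_sub_le (h : ConcaveWeight m Ω φ)
    (x₀ : EuclideanSpace ℝ (Fin N)) : ∃ R : ℝ, 0 < R ∧ ∀ x ∈ Ω, ‖x - x₀‖ ≤ R := by
  obtain ⟨R, hR, hΩ⟩ := h.isBounded.subset_ball_lt 0 x₀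
  exact ⟨R, hR, fun x hx => by simpa [dist_eq_norm] using (mem_ball.1 (hΩ hx)).le⟩

/-- It suffices to control the translates when comparing a function with its smoothing. -/
theorem SmoothingData.lintegral_smoothing_sub_le {x₀ : EuclideanSpace ℝ (Fin N)} {r s : ℝ}
    {ρ : EuclideanSpace ℝ (Fin N) → ℝ} (D : SmoothingData m Ω φ x₀ r s ρ)
    {u : EuclideanSpace ℝ (Fin N) → ℝ} (hu : Integrable u (weightedMeasure Ω φ))
    (hum : Measurable u) {B : ℝ≥0∞}
    (hB : ∀ w, ‖w‖ ≤ (1 - s) * r →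
      ∫⁻ x, ‖u (s • x + (1 - s) • x₀ - w) - u x‖ₑ ∂(weightedMeasure Ω φ) ≤ B) :
    ∫⁻ x, ‖smoothing Ω x₀ r s ρ u x - u x‖ₑ ∂(weightedMeasure Ω φ) ≤ B := by
  refine le_trans (lintegral_mono_ae ?_) (D.lintegral_lintegral_le_of_forall
    (F := fun x w => ‖u (s • x + (1 - s) • x₀ - w) - u x‖ₑ) ?_ hB)
  · filter_upwards [D.weight.ae_mem] with x hx using D.enorm_smoothing_sub_le hu hx
  · have h1 : Measurable fun p : EuclideanSpace ℝ (Fin N) × EuclideanSpace ℝ (Fin N) =>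
        u (s • p.1 + (1 - s) • x₀ - p.2) := hum.comp (by fun_prop)
    exact (h1.sub (hum.comp measurable_fst)).enorm

theorem tendsto_smoothing {x₀ : EuclideanSpace ℝ (Fin N)} {r : ℝ} {s : ℕ → ℝ}
    {ρ : ℕ → EuclideanSpace ℝ (Fin N) → ℝ}
    (hD : ∀ n, SmoothingData m Ω φ x₀ r (s n) (ρ n)) (hs : Tendsto s atTop (𝓝 1))
    {u : EuclideanSpace ℝ (Fin N) → ℝ} (hu : Integrable u (weightedMeasure Ω φ)) :
    Tendsto (fun n => ∫⁻ x, ‖smoothing Ω x₀ r (s n) (ρ n) u x - u x‖ₑ ∂(weightedMeasure Ω φ))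
      atTop (𝓝 0) := by
  have h := (hD 0).weight
  have := h.isFiniteMeasure
  wlog hum : Measurable u generalizing u with H
  · obtain ⟨u', hu'm, huu'⟩ := hu.1
    have := H (hu.congr huu') hu'm.measurable
    refine this.congr fun n => ?_
    rw [(hD n).smoothing_congr huu']
    refine lintegral_congr_ae ?_
    filter_upwards [huu'] with x hx
    rw [hx]
  refine ENNReal.tendsto_nhds_zero.2 fun ε hε => ?_
  set M := weightedMeasure Ω φ univ with hM
  have hMtop : M ≠ ⊤ := measure_ne_top _ _
  -- Three errors add up: `2 * η` from replacing the shifted `u` by a continuous `f` (the distortion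
  -- factor is eventually at most 2), `η * M` from the uniform continuity of `f`, and `η` from
  -- replacing `u` itself.
  set η := ε / (2 + M + 1) with hη
  have hη0 : η ≠ 0 := (ENNReal.div_pos hε.ne' (by finiteness)).ne'
  obtain ⟨f, hfc, hfu, hf, hfi⟩ := hu.exists_hasCompactSupport_lintegral_sub_le hη0
  obtain ⟨R, hR, hΩR⟩ := h.exists_norm_sub_le x₀
  obtain ⟨δ, hδ, hfδ⟩ := EMetric.uniformContinuous_iff.1
    (hfc.uniformContinuous_of_continuous hf) η hη0.bot_lt
  have hev1 : ∀ᶠ n in atTop, ENNReal.ofReal (s n ^ (m + N))⁻¹ ≤ 2 :=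
    (tendsto_ofReal_inv_pow hs (m + N)).eventually_le_const ENNReal.one_lt_two
  have hev2 : ∀ᶠ n in atTop, ENNReal.ofReal ((1 - s n) * (R + r)) < δ := by
    have h1 : Tendsto (fun n => (1 - s n) * (R + r)) atTop (𝓝 0) := by
      simpa using (hs.const_sub 1).mul_const (R + r)
    have h2 := (ENNReal.continuous_ofReal.tendsto _).comp h1
    rw [ENNReal.ofReal_zero] at h2
    exact h2.eventually_lt_const hδ
  filter_upwards [hev1, hev2] with n hn1 hn2
  have D := hD n
  refine (D.lintegral_smoothing_sub_le hu hum (B := (2 + M + 1) * η) fun w hw => ?_).trans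
    ENNReal.mul_div_le
  have hfm := hf.measurable
  have hshift : Measurable fun x : EuclideanSpace ℝ (Fin N) =>
      s n • x + (1 - s n) • x₀ - w := by fun_prop
  have m1 : Measurable fun x : EuclideanSpace ℝ (Fin N) =>
      ‖u (s n • x + (1 - s n) • x₀ - w) - f (s n • x + (1 - s n) • x₀ - w)‖ₑ :=
    ((hum.sub hfm).comp hshift).enorm
  have m2 : Measurable fun x : EuclideanSpace ℝ (Fin N) =>
      ‖f (s n • x + (1 - s n) • x₀ - w) - f x‖ₑ := ((hfm.comp hshift).sub hfm).enorm
  calc ∫⁻ x, ‖u (s n • x + (1 - s n) • x₀ - w) - u x‖ₑ ∂(weightedMeasure Ω φ)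
      ≤ ∫⁻ x, (‖u (s n • x + (1 - s n) • x₀ - w) - f (s n • x + (1 - s n) • x₀ - w)‖ₑ
          + ‖f (s n • x + (1 - s n) • x₀ - w) - f x‖ₑ + ‖u x - f x‖ₑ) ∂(weightedMeasure Ω φ) := by
        refine lintegral_mono fun x => ?_
        rw [enorm_sub_rev (u x) (f x)]
        simpa [edist_eq_enorm_sub] using
          edist_triangle4 (u (s n • x + (1 - s n) • x₀ - w))
            (f (s n • x + (1 - s n) • x₀ - w)) (f x) (u x)
    _ = ∫⁻ x, ‖u (s n • x + (1 - s n) • x₀ - w) - f (s n • x + (1 - s n) • x₀ - w)‖ₑ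
            ∂(weightedMeasure Ω φ)
          + ∫⁻ x, ‖f (s n • x + (1 - s n) • x₀ - w) - f x‖ₑ ∂(weightedMeasure Ω φ)
          + ∫⁻ x, ‖u x - f x‖ₑ ∂(weightedMeasure Ω φ) := by
        rw [lintegral_add_left (f := fun x => _ + _) (m1.add m2), lintegral_add_left m1]
    _ ≤ 2 * η + η * M + η := by
        gcongr
        · refine (h.lintegral_comp_le D.radius_pos.le D.ball_subset D.ratio_pos
            D.ratio_lt_one.le hw (f := fun x => ‖u x - f x‖ₑ) (hum.sub hfm).enorm).trans ?_
          gcongr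
        · rw [hM, ← lintegral_const]
          refine lintegral_mono_ae ?_
          filter_upwards [h.ae_mem] with x hx
          rw [← edist_eq_enorm_sub]
          refine (hfδ ?_).le
          rw [edist_eq_enorm_sub, ← ofReal_norm]
          exact (ENNReal.ofReal_le_ofReal (D.norm_sub_le (hΩR x hx) hw)).trans_lt hn2
    _ = (2 + M + 1) * η := by ring

/-- Density of test functions in `BV_φ` for the strict convergence. -/
theorem ConcaveWeight.exists_testFunctions (h : ConcaveWeight m Ω φ)
    {u : EuclideanSpace ℝ (Fin N) → ℝ} (hu : Integrable u (weightedMeasure Ω φ)) :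
    ∃ (ψ : ℕ → EuclideanSpace ℝ (Fin N) → ℝ) (c : ℕ → ℝ≥0∞),
      (∀ n, ContDiff ℝ (⊤ : ℕ∞) (ψ n)) ∧ (∀ n, HasCompactSupport (ψ n)) ∧
      Tendsto (fun n => ∫⁻ x, ‖ψ n x - u x‖ₑ ∂(weightedMeasure Ω φ)) atTop (𝓝 0) ∧
      Tendsto c atTop (𝓝 1) ∧
      ∀ n, ∫⁻ x, ‖fderiv ℝ (ψ n) x‖ₑ ∂(weightedMeasure Ω φ) ≤ c n * totalVariation Ω φ u := by
  obtain ⟨x₀, r, s, ρ, hD, hs⟩ := h.exists_smoothingData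
  exact ⟨fun n => smoothing Ω x₀ r (s n) (ρ n) u, _, fun n => (hD n).contDiff_smoothing hu,
    fun n => (hD n).hasCompactSupport_smoothing u, tendsto_smoothing hD hs hu,
    tendsto_ofReal_inv_pow hs (m + N),
    fun n => (hD n).lintegral_fderiv_smoothing_le_totalVariation hu⟩

/-- Functions of `W^{1,1}_φ` have total variation at most `∫ |∇u| φ`. -/
theorem ConcaveWeight.totalVariation_le_of_memW11 (h : ConcaveWeight m Ω φ)
    {u : EuclideanSpace ℝ (Fin N) → ℝ} {G : EuclideanSpace ℝ (Fin N) → EuclideanSpace ℝ (Fin N)}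
    (hu : MemW11 Ω φ u G) :
    totalVariation Ω φ u ≤ ∫⁻ x, ‖G x‖ₑ ∂(weightedMeasure Ω φ) := by
  obtain ⟨x₀, r, s, ρ, hD, hs⟩ := h.exists_smoothingData
  refine (totalVariation_le_liminf (fun n => h.integrable_of_continuous
    ((hD n).contDiff_smoothing hu.1).continuous) hu.1 (tendsto_smoothing hD hs hu.1)).trans ?_
  have hlim := ENNReal.Tendsto.mul_const (b := ∫⁻ x, ‖G x‖ₑ ∂(weightedMeasure Ω φ))
    (tendsto_ofReal_inv_pow hs (m + N)) (Or.inl one_ne_zero)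
  rw [one_mul] at hlim
  rw [← hlim.liminf_eq]
  exact liminf_le_liminf (.of_forall fun n => (totalVariation_le_lintegral_fderiv
    ((hD n).contDiff_smoothing hu.1) ((hD n).hasCompactSupport_smoothing u)).trans
      ((hD n).lintegral_fderiv_smoothing_le hu))

/-- Smooth functions belong to `W^{1,1}_φ`, with their classical gradient. -/
theorem ConcaveWeight.exists_memW11 (h : ConcaveWeight m Ω φ)
    {u : EuclideanSpace ℝ (Fin N) → ℝ} (hu : ContDiff ℝ 1 u) :
    ∃ G, MemW11 Ω φ u G ∧ ∀ x, ‖G x‖ₑ = ‖fderiv ℝ u x‖ₑ := by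
  have hcont : Continuous (fderiv ℝ u) := hu.continuous_fderiv one_ne_zero
  have hd : Differentiable ℝ u := hu.differentiable one_ne_zero
  set γ : EuclideanSpace ℝ (Fin N) → EuclideanSpace ℝ (Fin N) :=
    fun x => (InnerProductSpace.toDual ℝ (EuclideanSpace ℝ (Fin N))).symm (fderiv ℝ u x) with hγ
  have hγc : Continuous γ := (LinearIsometryEquiv.continuous _).comp hcont
  refine ⟨γ, ⟨h.integrable_of_continuous hu.continuous, h.integrable_of_continuous hγc,
    hu.continuous.locallyIntegrable.locallyIntegrableOn Ω,
    hγc.locallyIntegrable.locallyIntegrableOn Ω, fun ψ hψ hc ht v => ?_⟩, fun x => ?_⟩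
  · have hψd := hψ.differentiable (by simp)
    have hψc := hψ.continuous_fderiv (by simp)
    have huc := hu.continuous
    have hψc' := hψ.continuous
    have hzero : ∀ x ∉ Ω, ψ x = 0 := fun x hx =>
      image_eq_zero_of_notMem_tsupport fun hmem => hx (ht hmem)
    have hzero' : ∀ x ∉ Ω, fderiv ℝ ψ x = 0 := fun x hx =>
      image_eq_zero_of_notMem_tsupport fun hmem => hx (ht (tsupport_fderiv_subset ℝ hmem))
    rw [setIntegral_eq_integral_of_forall_compl_eq_zero fun x hx => by simp [hzero' x hx],
      setIntegral_eq_integral_of_forall_compl_eq_zero fun x hx => by simp [hzero x hx]]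
    have hin : ∀ x, inner ℝ (γ x) v = fderiv ℝ u x v := fun x =>
      InnerProductSpace.toDual_symm_apply
    simp_rw [hin]
    refine integral_mul_fderiv_eq_neg_fderiv_mul_of_integrable ?_ ?_ ?_ (fun x _ => hd x)
      (fun x _ => hψd x)
    · exact Continuous.integrable_of_hasCompactSupport (by fun_prop) hc.mul_left
    · exact Continuous.integrable_of_hasCompactSupport (by fun_prop)
        (hc.fderiv_apply ℝ v).mul_left
    · exact Continuous.integrable_of_hasCompactSupport (by fun_prop) hc.mul_left
  · rw [← ofReal_norm, ← ofReal_norm, hγ, LinearIsometryEquiv.norm_map]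

/-! ### Level functions and the coarea inequality -/

/-- The function of `a` with integral `a` over `t ∈ ℝ`: the indicator of `t < a` for `0 ≤ t`,
and minus the indicator of `a ≤ t` for `t < 0`. -/
def signedLevel (t a : ℝ) : ℝ := (Ioi t).indicator 1 a - (Ioi t).indicator 1 0

theorem measurable_signedLevel : Measurable (Function.uncurry signedLevel) := by
  have h : ∀ f : ℝ × ℝ → ℝ, Measurable f →
      Measurable fun p : ℝ × ℝ => (Ioi p.1).indicator (1 : ℝ → ℝ) (f p) := fun f hf => by
    have : (fun p : ℝ × ℝ => (Ioi p.1).indicator (1 : ℝ → ℝ) (f p)) =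
        {p : ℝ × ℝ | p.1 < f p}.indicator 1 := by
      ext p
      by_cases hp : p.1 < f p <;> simp [hp]
    rw [this]
    exact measurable_one.indicator (measurableSet_lt measurable_fst hf)
  exact (h _ measurable_snd).sub (h _ measurable_const)

theorem signedLevel_of_nonneg {t : ℝ} (ht : 0 ≤ t) (a : ℝ) :
    signedLevel t a = (Ioi t).indicator 1 a := by
  simp [signedLevel, not_lt.2 ht]

theorem signedLevel_of_neg {t : ℝ} (ht : t < 0) (a : ℝ) :
    signedLevel t a = -(Iic t).indicator 1 a := by
  by_cases h : t < a
  · simp [signedLevel, ht, h]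
  · simp [signedLevel, ht, h, not_lt.1 h]

theorem enorm_signedLevel_le (t a : ℝ) : ‖signedLevel t a‖ₑ ≤ 1 := by
  rcases le_or_gt 0 t with ht | ht
  · rw [signedLevel_of_nonneg ht]
    by_cases h : t < a <;> simp [h]
  · rw [signedLevel_of_neg ht]
    by_cases h : a ≤ t <;> simp [h]

/-- The constants at 0 cancel, and for `b ≤ a` the difference is, as a function of `t`, the
indicator of `[b, a)`. -/
theorem lintegral_enorm_signedLevel_sub (a b : ℝ) :
    ∫⁻ t, ‖signedLevel t a - signedLevel t b‖ₑ = ‖a - b‖ₑ := by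
  wlog hab : b ≤ a generalizing a b with H
  · rw [enorm_sub_rev a b, ← H b a (le_of_not_ge hab)]
    exact lintegral_congr fun t => enorm_sub_rev _ _
  have e : ∀ t, ‖signedLevel t a - signedLevel t b‖ₑ = (Ico b a).indicator 1 t := fun t => by
    by_cases h1 : t < a <;> by_cases h2 : t < b
    · simp [signedLevel, h1, h2]
    · simp [signedLevel, h1, h2, not_lt.1 h2]
    · exact absurd (h2.trans_le hab) h1
    · simp [signedLevel, h1, h2]
  simp_rw [e]
  rw [lintegral_indicator_one measurableSet_Ico, Real.volume_Ico,
    Real.enorm_of_nonneg (sub_nonneg.2 hab)]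

theorem lintegral_enorm_signedLevel (a : ℝ) : ∫⁻ t, ‖signedLevel t a‖ₑ = ‖a‖ₑ := by
  simpa [signedLevel] using lintegral_enorm_signedLevel_sub a 0

/-- A smooth approximation of `signedLevel`, at scale `h`. -/
def smoothLevel (h t a : ℝ) : ℝ :=
  Real.smoothTransition ((a - t) / h) - Real.smoothTransition ((0 - t) / h)

theorem continuous_smoothLevel (h : ℝ) : Continuous (Function.uncurry (smoothLevel h)) := by
  have := Real.smoothTransition.continuous
  unfold smoothLevel Function.uncurry
  fun_prop

theorem contDiff_smoothLevel (h t : ℝ) : ContDiff ℝ (⊤ : ℕ∞) (smoothLevel h t) := by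
  have : ContDiff ℝ (⊤ : ℕ∞) Real.smoothTransition := Real.smoothTransition.contDiff
  exact (this.comp (by fun_prop)).sub contDiff_const

/-- Subtracting the value at 0 makes the composition with a compactly supported function compactly
supported, hence again a test function. -/
theorem smoothLevel_zero (h t : ℝ) : smoothLevel h t 0 = 0 := by simp [smoothLevel]

theorem hasDerivAt_smoothLevel (h t a : ℝ) :
    HasDerivAt (smoothLevel h t) (deriv Real.smoothTransition ((a - t) / h) / h) a := by
  have h1 : HasDerivAt Real.smoothTransition (deriv Real.smoothTransition ((a - t) / h))
      ((a - t) / h) := ((Real.smoothTransition.contDiff (n := 1)).differentiable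
        one_ne_zero _).hasDerivAt
  have h2 := h1.comp a (((hasDerivAt_id a).sub_const t).div_const h)
  refine HasDerivAt.congr_deriv (h2.sub_const (Real.smoothTransition ((0 - t) / h))) ?_
  rw [mul_one_div]

theorem continuous_deriv_smoothTransition : Continuous (deriv Real.smoothTransition) :=
  (Real.smoothTransition.contDiff (n := 1)).continuous_deriv le_rfl

/-- The two functions differ only for `t` in `[a - h, a)`, and there by at most 1. -/
theorem lintegral_smoothTransition_sub_le {h : ℝ} (hh : 0 < h) (a : ℝ) :
    ∫⁻ t, ‖Real.smoothTransition ((a - t) / h) - (Ioi t).indicator 1 a‖ₑ ≤ ENNReal.ofReal h := by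
  have hle : ∀ t, ‖Real.smoothTransition ((a - t) / h) - (Ioi t).indicator 1 a‖ₑ ≤
      (Ico (a - h) a).indicator 1 t := fun t => by
    by_cases h1 : t < a
    · by_cases h2 : a - h ≤ t
      · have hm : t ∈ Ico (a - h) a := ⟨h2, h1⟩
        rw [indicator_of_mem hm, indicator_of_mem (mem_Ioi.2 h1), Pi.one_apply, Pi.one_apply,
          ← enorm_one (G := ℝ)]
        refine enorm_le_iff_norm_le.2 ?_
        have := Real.smoothTransition.le_one ((a - t) / h)
        have := Real.smoothTransition.nonneg ((a - t) / h)
        rw [Real.norm_eq_abs, norm_one, abs_le]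
        constructor <;> linarith
      · rw [Real.smoothTransition.one_of_one_le (by rw [one_le_div hh]; linarith)]
        simp [h1]
    · rw [Real.smoothTransition.zero_of_nonpos (div_nonpos_of_nonpos_of_nonneg (by linarith) hh.le)]
      simp [h1]
  refine (lintegral_mono hle).trans ?_
  rw [lintegral_indicator_one measurableSet_Ico, Real.volume_Ico]
  simp

theorem lintegral_smoothLevel_sub_le {h : ℝ} (hh : 0 < h) (a b : ℝ) :
    ∫⁻ t, ‖smoothLevel h t a - signedLevel t b‖ₑ ≤
      ENNReal.ofReal h + ENNReal.ofReal h + ‖a - b‖ₑ := by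
  have hc := Real.smoothTransition.continuous
  have hm : ∀ c : ℝ, Measurable fun t =>
      ‖Real.smoothTransition ((c - t) / h) - (Ioi t).indicator (1 : ℝ → ℝ) c‖ₑ := fun c => by
    have h1 : Measurable fun t : ℝ => (Ioi t).indicator (1 : ℝ → ℝ) c := by
      have : (fun t : ℝ => (Ioi t).indicator (1 : ℝ → ℝ) c) = (Iio c).indicator 1 := by
        ext t
        by_cases ht : t < c <;> simp [ht]
      rw [this]
      exact measurable_one.indicator measurableSet_Iio
    exact ((by fun_prop : Continuous fun t =>
      Real.smoothTransition ((c - t) / h)).measurable.sub h1).enorm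
  rw [← lintegral_enorm_signedLevel_sub a b]
  refine le_trans ?_ (add_le_add_left (add_le_add (lintegral_smoothTransition_sub_le hh a)
    (lintegral_smoothTransition_sub_le hh 0)) _)
  rw [← lintegral_add_left (hm a),
    ← lintegral_add_left (f := fun t => _ + _) ((hm a).add (hm 0))]
  refine lintegral_mono fun t => ?_
  have e : smoothLevel h t a - signedLevel t b =
      (Real.smoothTransition ((a - t) / h) - (Ioi t).indicator 1 a)
      - (Real.smoothTransition ((0 - t) / h) - (Ioi t).indicator 1 0)
      + (signedLevel t a - signedLevel t b) := by
    simp only [smoothLevel, signedLevel]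
    ring
  rw [e]
  refine (enorm_add_le _ _).trans (add_le_add_left ?_ _)
  exact enorm_sub_le

/-- The integrand is nonnegative, and its integral in `t` is the total rise of the transition, from
0 to 1. Integrating over `t` first thus makes the coarea formula at scale `h` a mere use of Fubini.
-/
theorem lintegral_enorm_deriv_smoothLevel {h : ℝ} (hh : 0 < h) (a : ℝ) :
    ∫⁻ t, ‖deriv Real.smoothTransition ((a - t) / h) / h‖ₑ = 1 := by
  have hc := continuous_deriv_smoothTransition
  set f' : ℝ → ℝ := fun t => deriv Real.smoothTransition ((a - t) / h) / h with hf'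
  have hf'c : Continuous f' := by fun_prop
  have hnonneg : ∀ t, 0 ≤ f' t := fun t =>
    div_nonneg Real.smoothTransition.monotone.deriv_nonneg hh.le
  have hderiv : ∀ t, HasDerivAt (fun t => - Real.smoothTransition ((a - t) / h)) (f' t) t :=
    fun t => by
      have h1 : HasDerivAt Real.smoothTransition (deriv Real.smoothTransition ((a - t) / h))
        ((a - t) / h) := ((Real.smoothTransition.contDiff (n := 1)).differentiable
          one_ne_zero _).hasDerivAt
      have h2 := (h1.comp t (((hasDerivAt_id t).const_sub a).div_const h)).neg
      refine HasDerivAt.congr_deriv h2 ?_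
      rw [hf', neg_div, mul_neg, neg_neg, mul_one_div]
  have hzero : ∀ t ∉ Icc (a - h) a, f' t = 0 := fun t ht => by
    have : t < a - h ∨ a < t := by
      by_contra! hcon
      exact ht hcon
    rcases this with ht | ht
    · have he : Real.smoothTransition =ᶠ[𝓝 ((a - t) / h)] fun _ => 1 := by
        have : 1 < (a - t) / h := by rw [one_lt_div hh]; linarith
        filter_upwards [lt_mem_nhds this] with y hy
        exact Real.smoothTransition.one_of_one_le hy.le
      simp [hf', he.deriv_eq]
    · have he : Real.smoothTransition =ᶠ[𝓝 ((a - t) / h)] fun _ => 0 := by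
        have : (a - t) / h < 0 := div_neg_of_neg_of_pos (by linarith) hh
        filter_upwards [gt_mem_nhds this] with y hy
        exact Real.smoothTransition.zero_of_nonpos hy.le
      simp [hf', he.deriv_eq]
  have hinteg : Integrable f' :=
    hf'c.integrable_of_hasCompactSupport (HasCompactSupport.intro isCompact_Icc hzero)
  have hbot : Tendsto (fun t => - Real.smoothTransition ((a - t) / h)) atBot (𝓝 (-1)) := by
    refine tendsto_const_nhds.congr' ?_
    filter_upwards [eventually_le_atBot (a - h)] with t ht
    rw [Real.smoothTransition.one_of_one_le (by rw [one_le_div hh]; linarith)]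
  have htop : Tendsto (fun t => - Real.smoothTransition ((a - t) / h)) atTop (𝓝 0) := by
    refine tendsto_const_nhds.congr' ?_
    filter_upwards [eventually_ge_atTop a] with t ht
    rw [Real.smoothTransition.zero_of_nonpos (div_nonpos_of_nonpos_of_nonneg (by linarith) hh.le),
      neg_zero]
  have hI := integral_of_hasDerivAt_of_tendsto hderiv hinteg hbot htop
  rw [lintegral_congr fun t => Real.enorm_of_nonneg (hnonneg t),
    ← ofReal_integral_eq_lintegral_ofReal hinteg (.of_forall hnonneg), hI]
  simp

theorem ConcaveWeight.integrable_signedLevel (h : ConcaveWeight m Ω φ)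
    {u : EuclideanSpace ℝ (Fin N) → ℝ} (hu : AEMeasurable u (weightedMeasure Ω φ)) (t : ℝ) :
    Integrable (fun x => signedLevel t (u x)) (weightedMeasure Ω φ) := by
  have := h.isFiniteMeasure
  refine Integrable.of_bound ((measurable_signedLevel.comp
    measurable_prodMk_left).comp_aemeasurable hu).aestronglyMeasurable 1 (.of_forall fun x => ?_)
  have := enorm_signedLevel_le t (u x)
  rw [← enorm_one (G := ℝ)] at this
  simpa using enorm_le_iff_norm_le.1 this

/-- The coarea inequality. -/
theorem ConcaveWeight.exists_coarea (h : ConcaveWeight m Ω φ)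
    {u : EuclideanSpace ℝ (Fin N) → ℝ} (hu : Integrable u (weightedMeasure Ω φ)) :
    ∃ P : ℝ → ℝ≥0∞, Measurable P ∧ ∫⁻ t, P t ≤ totalVariation Ω φ u ∧
      ∀ᵐ t, totalVariation Ω φ (fun x => signedLevel t (u x)) ≤ P t := by
  have := h.isFiniteMeasure
  wlog hum : Measurable u generalizing u with H
  · obtain ⟨u', hu'm, huu'⟩ := hu.1
    obtain ⟨P, hP, hPle, hPt⟩ := H (hu.congr huu') hu'm.measurable
    refine ⟨P, hP, hPle.trans_eq (totalVariation_congr huu').symm, ?_⟩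
    filter_upwards [hPt] with t ht
    refine (totalVariation_congr ?_).trans_le ht
    filter_upwards [huu'] with x hx
    rw [hx]
  obtain ⟨ψ, c, hψs, hψc, hψu, hc, hgrad⟩ := h.exists_testFunctions hu
  set η : ℕ → ℝ := fun n => 1 / ((n : ℝ) + 1) with hη
  have hη0 : ∀ n, 0 < η n := fun n => by positivity
  have hηlim : Tendsto (fun n => ENNReal.ofReal (η n)) atTop (𝓝 0) := by
    simpa [Function.comp_def, hη] using (ENNReal.continuous_ofReal.tendsto _).comp
      (tendsto_one_div_add_atTop_nhds_zero_nat (𝕜 := ℝ))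
  set M := weightedMeasure Ω φ univ with hM
  have hMtop : M ≠ ⊤ := measure_ne_top _ _
  set D : ℕ → ℝ → ℝ≥0∞ := fun n t =>
    ∫⁻ x, ‖smoothLevel (η n) t (ψ n x) - signedLevel t (u x)‖ₑ ∂(weightedMeasure Ω φ) with hD
  set e : ℕ → ℝ≥0∞ := fun n => (ENNReal.ofReal (η n) + ENNReal.ofReal (η n)) * M
    + ∫⁻ x, ‖ψ n x - u x‖ₑ ∂(weightedMeasure Ω φ) with he
  have hmeas : ∀ n, Measurable (Function.uncurry fun (t : ℝ) x =>
      ‖smoothLevel (η n) t (ψ n x) - signedLevel t (u x)‖ₑ) := fun n =>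
    (((continuous_smoothLevel (η n)).measurable.comp
      (measurable_fst.prodMk ((hψs n).continuous.measurable.comp measurable_snd))).sub
      (measurable_signedLevel.comp (measurable_fst.prodMk (hum.comp measurable_snd)))).enorm
  have hDm : ∀ n, Measurable (D n) := fun n => (hmeas n).lintegral_prod_right'
  have hDe : ∀ n, ∫⁻ t, D n t ≤ e n := fun n => by
    rw [hD]
    dsimp only
    rw [lintegral_lintegral_swap (hmeas n).aemeasurable, he]
    dsimp only
    rw [hM, ← lintegral_const, ← lintegral_add_left measurable_const]
    exact lintegral_mono fun x => lintegral_smoothLevel_sub_le (hη0 n) _ _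
  have helim : Tendsto e atTop (𝓝 0) := by
    have h1 := ENNReal.Tendsto.mul_const (hηlim.add hηlim) (Or.inr hMtop)
    simpa using h1.add hψu
  -- Only the integral over `t` of the level errors tends to zero. A subsequence with geometrically
  -- small integrals has summable errors, hence convergence at almost every `t`.
  obtain ⟨k, hk, hke⟩ := extraction_forall_of_eventually
    (P := fun j n => e n ≤ (2 : ℝ≥0∞)⁻¹ ^ j) fun j =>
      helim.eventually_le_const (ENNReal.pow_pos (by simp) j)
  have hDlim : ∀ᵐ t, Tendsto (fun j => D (k j) t) atTop (𝓝 0) := by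
    have hsum : ∫⁻ t, ∑' j, D (k j) t ≠ ⊤ := by
      rw [lintegral_tsum fun j => (hDm _).aemeasurable]
      refine ne_top_of_le_ne_top ?_ (ENNReal.tsum_le_tsum fun j => (hDe (k j)).trans (hke j))
      rw [ENNReal.tsum_geometric]
      simp
    filter_upwards [ae_lt_top (Measurable.tsum fun j => hDm (k j)) hsum] with t ht
    exact ENNReal.tendsto_atTop_zero_of_tsum_ne_top ht.ne
  -- By the chain rule this is the weighted gradient norm of the smooth level function; its integral
  -- over `t` is the gradient norm of `ψ n`.
  set Q : ℕ → ℝ → ℝ≥0∞ := fun n t => ∫⁻ x,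
    ‖deriv Real.smoothTransition ((ψ n x - t) / η n) / η n‖ₑ * ‖fderiv ℝ (ψ n) x‖ₑ
      ∂(weightedMeasure Ω φ) with hQ
  have hQm' : ∀ n, Measurable (Function.uncurry fun (t : ℝ) x =>
      ‖deriv Real.smoothTransition ((ψ n x - t) / η n) / η n‖ₑ * ‖fderiv ℝ (ψ n) x‖ₑ) := fun n => by
    have h1 := continuous_deriv_smoothTransition
    have h2 := (hψs n).continuous
    have h3 := (hψs n).continuous_fderiv (by simp)
    have h4 : Continuous fun p : ℝ × EuclideanSpace ℝ (Fin N) =>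
      deriv Real.smoothTransition ((ψ n p.2 - p.1) / η n) / η n := by fun_prop
    exact h4.measurable.enorm.mul (h3.measurable.comp measurable_snd).enorm
  have hQm : ∀ n, Measurable (Q n) := fun n => (hQm' n).lintegral_prod_right'
  have hQle : ∀ n, ∫⁻ t, Q n t ≤ c n * totalVariation Ω φ u := fun n => by
    refine le_trans (le_of_eq ?_) (hgrad n)
    rw [hQ]
    dsimp only
    rw [lintegral_lintegral_swap (hQm' n).aemeasurable]
    refine lintegral_congr fun x => ?_
    rw [lintegral_mul_const' _ _ enorm_ne_top, lintegral_enorm_deriv_smoothLevel (hη0 n), one_mul]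
  have hTV : ∀ n t, totalVariation Ω φ (fun x => smoothLevel (η n) t (ψ n x)) ≤ Q n t :=
    fun n t => by
      refine (totalVariation_le_lintegral_fderiv ((contDiff_smoothLevel (η n) t).comp (hψs n))
        ((hψc n).comp_left (smoothLevel_zero (η n) t))).trans (le_of_eq ?_)
      refine lintegral_congr fun x => ?_
      have h1 := (hasDerivAt_smoothLevel (η n) t (ψ n x)).comp_hasFDerivAt x
        ((hψs n).differentiable (by simp) x).hasFDerivAt
      rw [← enorm_smul, ← h1.fderiv]
  -- Fatou bounds the integral and lower semicontinuity bounds the variation at each good level.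
  -- Working with a measurable majorant avoids asking whether the variation is measurable in `t`.
  refine ⟨fun t => liminf (fun j => Q (k j) t) atTop, Measurable.liminf fun j => hQm (k j), ?_, ?_⟩
  · refine (lintegral_liminf_le fun j => hQm (k j)).trans ?_
    have hlim := ENNReal.Tendsto.mul_const (b := totalVariation Ω φ u)
      (hc.comp hk.tendsto_atTop) (Or.inl one_ne_zero)
    rw [one_mul] at hlim
    rw [← hlim.liminf_eq]
    exact liminf_le_liminf (.of_forall fun j => hQle (k j))
  · filter_upwards [hDlim] with t ht
    refine (totalVariation_le_liminf (fun j => h.integrable_of_continuous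
      ((contDiff_smoothLevel (η (k j)) t).continuous.comp (hψs (k j)).continuous))
      (h.integrable_signedLevel hum.aemeasurable t) ht).trans ?_
    exact liminf_le_liminf (.of_forall fun j => hTV (k j) t)

/-! ### Reduction to level sets -/

theorem massL1_ne_top {u : EuclideanSpace ℝ (Fin N) → ℝ}
    (hu : Integrable u (weightedMeasure Ω φ)) : massL1 Ω φ u ≠ ⊤ := hu.2.ne

theorem ConcaveWeight.inter_ae_eq (h : ConcaveWeight m Ω φ) (F : Set (EuclideanSpace ℝ (Fin N))) :
    (F ∩ Ω : Set _) =ᵐ[weightedMeasure Ω φ] F := by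
  filter_upwards [h.ae_mem] with x hx
  exact propext ⟨fun h => h.1, fun h => ⟨h, hx⟩⟩

theorem ConcaveWeight.measure_inter (h : ConcaveWeight m Ω φ)
    (F : Set (EuclideanSpace ℝ (Fin N))) :
    weightedMeasure Ω φ (F ∩ Ω) = weightedMeasure Ω φ F := measure_congr (h.inter_ae_eq F)

theorem ConcaveWeight.indicator_inter_ae_eq (h : ConcaveWeight m Ω φ)
    (F : Set (EuclideanSpace ℝ (Fin N))) :
    (F ∩ Ω).indicator (fun _ => (1 : ℝ)) =ᵐ[weightedMeasure Ω φ] F.indicator fun _ => 1 :=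
  indicator_ae_eq_of_ae_eq_set (h.inter_ae_eq F)

theorem ConcaveWeight.perimeter_inter (h : ConcaveWeight m Ω φ)
    (F : Set (EuclideanSpace ℝ (Fin N))) : perimeter Ω φ (F ∩ Ω) = perimeter Ω φ F :=
  totalVariation_congr (h.indicator_inter_ae_eq F)

theorem ConcaveWeight.isStarCompetitor_inter (h : ConcaveWeight m Ω φ)
    {F : Set (EuclideanSpace ℝ (Fin N))} (hF : NullMeasurableSet F (weightedMeasure Ω φ))
    (hF0 : weightedMeasure Ω φ F ≠ 0)
    (hle : weightedMeasure Ω φ F ≤ weightedMeasure Ω φ Ω / 2) (hper : perimeter Ω φ F ≠ ⊤) :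
    IsStarCompetitor Ω φ (F ∩ Ω) := by
  have := h.isFiniteMeasure
  have h1 := hF.mono_ac h.restrict_absolutelyContinuous
  rw [nullMeasurableSet_restrict h.isOpen.measurableSet.nullMeasurableSet] at h1
  refine ⟨inter_subset_right, h1, ⟨?_, ?_⟩, ?_, ?_⟩
  · exact (((integrable_const (1 : ℝ)).indicator₀ hF).congr (h.indicator_inter_ae_eq F).symm)
  · exact (h.perimeter_inter F).trans_lt hper.lt_top
  · rwa [h.measure_inter]
  · rwa [h.measure_inter]

/-- The product form also covers null sets and sets of infinite perimeter, so it can be applied to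
every level without case distinctions. -/
theorem ConcaveWeight.muStar_mul_le (h : ConcaveWeight m Ω φ)
    {F : Set (EuclideanSpace ℝ (Fin N))} (hF : NullMeasurableSet F (weightedMeasure Ω φ))
    (hle : weightedMeasure Ω φ F ≤ weightedMeasure Ω φ Ω / 2) :
    muStar Ω φ * weightedMeasure Ω φ F ≤ perimeter Ω φ F := by
  have := h.isFiniteMeasure
  by_cases hF0 : weightedMeasure Ω φ F = 0
  · simp [hF0]
  by_cases hper : perimeter Ω φ F = ⊤
  · simp [hper]
  rw [← ENNReal.le_div_iff_mul_le (Or.inl hF0) (Or.inl (measure_ne_top _ _))]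
  refine sInf_le ⟨F ∩ Ω, h.isStarCompetitor_inter hF hF0 hle hper, ?_⟩
  rw [h.perimeter_inter, h.measure_inter]

theorem nullMeasurableSet_preimage_of_integrable {u : EuclideanSpace ℝ (Fin N) → ℝ}
    (hu : Integrable u (weightedMeasure Ω φ)) {I : Set ℝ} (hI : MeasurableSet I) :
    NullMeasurableSet (u ⁻¹' I) (weightedMeasure Ω φ) :=
  hu.1.aemeasurable.nullMeasurableSet_preimage hI

theorem lintegral_enorm_indicator_one {F : Set (EuclideanSpace ℝ (Fin N))}
    (hF : NullMeasurableSet F (weightedMeasure Ω φ)) :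
    ∫⁻ x, ‖F.indicator (fun _ => (1 : ℝ)) x‖ₑ ∂(weightedMeasure Ω φ) = weightedMeasure Ω φ F := by
  rw [← lintegral_indicator_one₀ hF]
  refine lintegral_congr fun x => ?_
  by_cases hx : x ∈ F <;> simp [hx]

theorem signedLevel_comp_of_nonneg (u : EuclideanSpace ℝ (Fin N) → ℝ) {t : ℝ} (ht : 0 ≤ t) :
    (fun x => signedLevel t (u x)) = (u ⁻¹' Ioi t).indicator fun _ => 1 := by
  ext x
  rw [signedLevel_of_nonneg ht]
  by_cases hx : t < u x <;> simp [hx]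

theorem signedLevel_comp_of_neg (u : EuclideanSpace ℝ (Fin N) → ℝ) {t : ℝ} (ht : t < 0) :
    (fun x => signedLevel t (u x)) = -(u ⁻¹' Iic t).indicator fun _ => 1 := by
  ext x
  rw [signedLevel_of_neg ht]
  by_cases hx : u x ≤ t <;> simp [hx]

/-- For `t ≥ 0` the level is the indicator of `{u > t} ⊆ {u > 0}`; for `t < 0` it is minus that of
`{u ≤ t} ⊆ {u < 0}`. Either set has at most half of the mass. -/
theorem ConcaveWeight.muStar_mul_lintegral_signedLevel_le (h : ConcaveWeight m Ω φ)
    {u : EuclideanSpace ℝ (Fin N) → ℝ} (hu : Integrable u (weightedMeasure Ω φ))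
    (hpos : weightedMeasure Ω φ {x | 0 < u x} ≤ weightedMeasure Ω φ Ω / 2)
    (hneg : weightedMeasure Ω φ {x | u x < 0} ≤ weightedMeasure Ω φ Ω / 2) (t : ℝ) :
    muStar Ω φ * ∫⁻ x, ‖signedLevel t (u x)‖ₑ ∂(weightedMeasure Ω φ) ≤
      totalVariation Ω φ (fun x => signedLevel t (u x)) := by
  rcases le_or_gt 0 t with ht | ht
  · have hm := nullMeasurableSet_preimage_of_integrable hu (measurableSet_Ioi (a := t))
    have e := signedLevel_comp_of_nonneg u ht
    rw [e, lintegral_congr fun x => by rw [congrFun e x], lintegral_enorm_indicator_one hm]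
    exact h.muStar_mul_le hm ((measure_mono fun x hx => lt_of_le_of_lt ht hx).trans hpos)
  · have hm := nullMeasurableSet_preimage_of_integrable hu (measurableSet_Iic (a := t))
    have e := signedLevel_comp_of_neg u ht
    rw [e, totalVariation_neg, lintegral_congr fun x => by rw [congrFun e x, Pi.neg_apply,
      enorm_neg], lintegral_enorm_indicator_one hm]
    exact h.muStar_mul_le hm ((measure_mono fun x hx => lt_of_le_of_lt hx ht).trans hneg)

theorem ConcaveWeight.massL1_eq (h : ConcaveWeight m Ω φ)
    {u : EuclideanSpace ℝ (Fin N) → ℝ} (hu : Integrable u (weightedMeasure Ω φ)) :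
    AEMeasurable (fun t => ∫⁻ x, ‖signedLevel t (u x)‖ₑ ∂(weightedMeasure Ω φ)) ∧
    massL1 Ω φ u = ∫⁻ t, (∫⁻ x, ‖signedLevel t (u x)‖ₑ ∂(weightedMeasure Ω φ)) := by
  have := h.isFiniteMeasure
  have hm : AEMeasurable (Function.uncurry fun (t : ℝ) x => ‖signedLevel t (u x)‖ₑ)
      ((volume : Measure ℝ).prod (weightedMeasure Ω φ)) :=
    (measurable_signedLevel.comp_aemeasurable (measurable_fst.aemeasurable.prodMk
      (hu.1.aemeasurable.comp_quasiMeasurePreserving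
        Measure.quasiMeasurePreserving_snd))).enorm
  refine ⟨hm.lintegral_prod_right', ?_⟩
  rw [lintegral_lintegral_swap hm]
  exact lintegral_congr fun x => (lintegral_enorm_signedLevel (u x)).symm

/-- The inequality at each level, integrated over `t`: layer cake on the left, coarea on the right.
-/
theorem ConcaveWeight.muStar_mul_massL1_le (h : ConcaveWeight m Ω φ)
    {u : EuclideanSpace ℝ (Fin N) → ℝ} (hu : Integrable u (weightedMeasure Ω φ))
    (hpos : weightedMeasure Ω φ {x | 0 < u x} ≤ weightedMeasure Ω φ Ω / 2)
    (hneg : weightedMeasure Ω φ {x | u x < 0} ≤ weightedMeasure Ω φ Ω / 2) :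
    muStar Ω φ * massL1 Ω φ u ≤ totalVariation Ω φ u := by
  obtain ⟨P, hPm, hP, hPt⟩ := h.exists_coarea hu
  obtain ⟨hm, e⟩ := h.massL1_eq hu
  rw [e, ← lintegral_const_mul'' _ hm]
  refine le_trans (lintegral_mono_ae ?_) hP
  filter_upwards [hPt] with t ht
  exact (h.muStar_mul_lintegral_signedLevel_le hu hpos hneg t).trans ht

theorem measure_neg_eq_zero {u : EuclideanSpace ℝ (Fin N) → ℝ}
    (h : ∀ᵐ x ∂(weightedMeasure Ω φ), 0 ≤ u x) : weightedMeasure Ω φ {x | u x < 0} = 0 := by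
  simpa [ae_iff] using h

theorem ConcaveWeight.muStar_le_muBar (h : ConcaveWeight m Ω φ) : muStar Ω φ ≤ muBar Ω φ := by
  refine le_sInf ?_
  rintro _ ⟨u, ⟨hu, hnn, hmass, hpos⟩, rfl⟩
  rw [ENNReal.le_div_iff_mul_le (Or.inl hmass) (Or.inl (massL1_ne_top hu.1))]
  exact h.muStar_mul_massL1_le hu.1 hpos ((measure_neg_eq_zero hnn).trans_le zero_le)

theorem isBarCompetitor_indicator
    {F : Set (EuclideanSpace ℝ (Fin N))} (hF : IsStarCompetitor Ω φ F) :
    IsBarCompetitor Ω φ (F.indicator fun _ => 1) ∧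
      massL1 Ω φ (F.indicator fun _ => 1) = weightedMeasure Ω φ F := by
  obtain ⟨hFΩ, hFm, hBV, hF0, hle⟩ := hF
  have hmass : massL1 Ω φ (F.indicator fun _ => 1) = weightedMeasure Ω φ F :=
    lintegral_enorm_indicator_one (hFm.mono_ac ConcaveWeight.absolutelyContinuous)
  have hset : {x | 0 < F.indicator (fun _ => (1 : ℝ)) x} = F := by
    ext x
    by_cases hx : x ∈ F <;> simp [hx]
  refine ⟨⟨hBV, .of_forall fun x => indicator_nonneg (fun _ _ => zero_le_one) x, ?_, ?_⟩, hmass⟩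
  · rwa [hmass]
  · rwa [hset]

theorem muBar_le_muStar : muBar Ω φ ≤ muStar Ω φ := by
  refine le_sInf ?_
  rintro _ ⟨F, hF, rfl⟩
  obtain ⟨h1, h2⟩ := isBarCompetitor_indicator hF
  exact sInf_le ⟨_, h1, by rw [h2]; rfl⟩

theorem ConcaveWeight.muBar_eq_muStar (h : ConcaveWeight m Ω φ) : muBar Ω φ = muStar Ω φ :=
  le_antisymm muBar_le_muStar h.muStar_le_muBar

theorem integral_sign_eq [IsFiniteMeasure (weightedMeasure Ω φ)]
    {u : EuclideanSpace ℝ (Fin N) → ℝ} (hu : Integrable u (weightedMeasure Ω φ)) :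
    ∫ x, Real.sign (u x) ∂(weightedMeasure Ω φ) =
      (weightedMeasure Ω φ).real {x | 0 < u x} - (weightedMeasure Ω φ).real {x | u x < 0} := by
  have hp : NullMeasurableSet {x | 0 < u x} (weightedMeasure Ω φ) :=
    nullMeasurableSet_lt aemeasurable_const hu.1.aemeasurable
  have hn : NullMeasurableSet {x | u x < 0} (weightedMeasure Ω φ) :=
    nullMeasurableSet_lt hu.1.aemeasurable aemeasurable_const
  have e : (fun x => Real.sign (u x)) = fun x =>
      {x | 0 < u x}.indicator (fun _ => (1 : ℝ)) x - {x | u x < 0}.indicator (fun _ => 1) x := by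
    ext x
    rcases lt_trichotomy (u x) 0 with hx | hx | hx
    · simp [hx, Real.sign_of_neg hx, hx.not_gt]
    · simp [hx]
    · simp [hx, Real.sign_of_pos hx, hx.not_gt]
  rw [e, integral_sub ((integrable_const (1 : ℝ)).indicator₀ hp)
    ((integrable_const (1 : ℝ)).indicator₀ hn), integral_indicator₀ hp, integral_indicator₀ hn]
  simp

/-- A vanishing sign integral gives `{u > 0}` and `{u < 0}` equal masses; being disjoint, each has
at most half. -/
theorem ConcaveWeight.muStar_le_muOne (h : ConcaveWeight m Ω φ) : muStar Ω φ ≤ muOne Ω φ := by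
  have := h.isFiniteMeasure
  refine le_sInf ?_
  rintro _ ⟨u, G, hu, hsign, hmass, rfl⟩
  rw [ENNReal.le_div_iff_mul_le (Or.inl hmass) (Or.inl (massL1_ne_top hu.1))]
  rw [integral_sign_eq hu.1, sub_eq_zero, measureReal_eq_measureReal_iff] at hsign
  have hn : NullMeasurableSet {x | u x < 0} (weightedMeasure Ω φ) :=
    nullMeasurableSet_lt hu.1.1.aemeasurable aemeasurable_const
  have hdisj : Disjoint {x | 0 < u x} {x | u x < 0} :=
    Set.disjoint_left.2 fun x (hx : 0 < u x) (hx' : u x < 0) => lt_asymm hx hx'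
  have hsum : weightedMeasure Ω φ {x | 0 < u x} + weightedMeasure Ω φ {x | u x < 0} ≤
      weightedMeasure Ω φ Ω := by
    rw [← measure_union₀ hn hdisj.aedisjoint, ← h.measure_univ]
    exact measure_mono (subset_univ _)
  have hhalf : weightedMeasure Ω φ {x | 0 < u x} ≤ weightedMeasure Ω φ Ω / 2 := by
    rw [ENNReal.le_div_iff_mul_le (Or.inl two_ne_zero) (Or.inl ENNReal.ofNat_ne_top), mul_two]
    nth_rewrite 2 [hsign]
    exact hsum
  exact (h.muStar_mul_massL1_le hu.1 hhalf (hsign ▸ hhalf)).trans (h.totalVariation_le_of_memW11 hu)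

theorem ConcaveWeight.isStarOptimal_of_isBarOptimal (h : ConcaveWeight m Ω φ)
    {u : EuclideanSpace ℝ (Fin N) → ℝ} (hu : IsBarOptimal Ω φ u) :
    ∀ᵐ t : ℝ, 0 < t → weightedMeasure Ω φ {x ∈ Ω | t < u x} ≠ 0 →
      IsStarOptimal Ω φ {x ∈ Ω | t < u x} := by
  have := h.isFiniteMeasure
  obtain ⟨⟨hBV, hnn, hmass, hpos⟩, hopt⟩ := hu
  have hneg : weightedMeasure Ω φ {x | u x < 0} ≤ weightedMeasure Ω φ Ω / 2 :=
    (measure_neg_eq_zero hnn).trans_le zero_le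
  rw [h.muBar_eq_muStar] at hopt
  have hstar : muStar Ω φ ≠ ⊤ := hopt ▸ (ENNReal.div_lt_top hBV.2.ne hmass).ne
  have hTV : totalVariation Ω φ u = muStar Ω φ * massL1 Ω φ u := by
    rw [← hopt, ENNReal.div_mul_cancel hmass (massL1_ne_top hBV.1)]
  obtain ⟨P, hPm, hP, hPt⟩ := h.exists_coarea hBV.1
  obtain ⟨hm, e⟩ := h.massL1_eq hBV.1
  -- Optimality turns the integrated inequality into an equality of finite integrals, so the
  -- pointwise inequality between the two integrands is an equality almost everywhere.
  have heq := ae_eq_of_ae_le_of_lintegral_le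
    (f := fun t => muStar Ω φ * ∫⁻ x, ‖signedLevel t (u x)‖ₑ ∂(weightedMeasure Ω φ)) (g := P)
    (hPt.mono fun t ht =>
      (h.muStar_mul_lintegral_signedLevel_le hBV.1 hpos hneg t).trans ht)
    (by rw [lintegral_const_mul'' _ hm, ← e, ← hTV]; exact hBV.2.ne) hPm.aemeasurable
    (by rw [lintegral_const_mul'' _ hm, ← e, ← hTV]; exact hP)
  filter_upwards [heq, hPt] with t h1 h2 ht ht0
  have hset : {x ∈ Ω | t < u x} = u ⁻¹' Ioi t ∩ Ω := by
    ext x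
    exact and_comm
  have hmt := nullMeasurableSet_preimage_of_integrable hBV.1 (measurableSet_Ioi (a := t))
  rw [← h1] at h2
  have es := signedLevel_comp_of_nonneg u ht.le
  rw [es, lintegral_congr fun x => by rw [congrFun es x], lintegral_enorm_indicator_one hmt] at h2
  rw [hset, h.measure_inter] at ht0
  have hle : weightedMeasure Ω φ (u ⁻¹' Ioi t) ≤ weightedMeasure Ω φ Ω / 2 :=
    (measure_mono fun x hx => lt_trans ht hx).trans hpos
  have hmain : perimeter Ω φ (u ⁻¹' Ioi t) = muStar Ω φ * weightedMeasure Ω φ (u ⁻¹' Ioi t) :=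
    le_antisymm h2 (h.muStar_mul_le hmt hle)
  have htop := measure_ne_top (weightedMeasure Ω φ) (u ⁻¹' Ioi t)
  rw [hset]
  refine ⟨h.isStarCompetitor_inter hmt ht0 hle ?_, ?_⟩
  · rw [hmain]
    exact ENNReal.mul_ne_top hstar htop
  · rw [h.perimeter_inter, h.measure_inter, hmain, ENNReal.mul_div_cancel_right ht0 htop]

/-- Otherwise almost every superlevel set at a positive level would be null, and by the layer cake
formula the minimizer would have zero mass. -/
theorem ConcaveWeight.exists_isStarOptimal (h : ConcaveWeight m Ω φ)
    {u : EuclideanSpace ℝ (Fin N) → ℝ} (hu : IsBarOptimal Ω φ u) :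
    ∃ F, IsStarOptimal Ω φ F := by
  by_contra hcon
  have hae := h.isStarOptimal_of_isBarOptimal hu
  obtain ⟨⟨hBV, hnn, hmass, hpos⟩, -⟩ := hu
  refine hmass ?_
  rw [(h.massL1_eq hBV.1).2, lintegral_eq_zero_iff' (h.massL1_eq hBV.1).1]
  filter_upwards [hae, Measure.ae_ne volume (0 : ℝ)] with t ht ht0
  rcases lt_or_gt_of_ne ht0 with hlt | hgt
  · rw [Pi.zero_apply, lintegral_congr fun x => by
      rw [congrFun (signedLevel_comp_of_neg u hlt) x, Pi.neg_apply, enorm_neg],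
      lintegral_enorm_indicator_one
        (nullMeasurableSet_preimage_of_integrable hBV.1 measurableSet_Iic)]
    exact measure_mono_null (fun x hx => lt_of_le_of_lt hx hlt) (measure_neg_eq_zero hnn)
  · rw [Pi.zero_apply, lintegral_congr fun x => by
      rw [congrFun (signedLevel_comp_of_nonneg u hgt.le) x], lintegral_enorm_indicator_one
        (nullMeasurableSet_preimage_of_integrable hBV.1 measurableSet_Ioi), ← h.measure_inter]
    by_contra hne
    refine hcon ⟨_, ht hgt ?_⟩
    rw [inter_comm] at hne
    exact hne

/-! ### Exact medians and the comparison of μ₁ with μ₁* -/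

/-- A bounded function without level sets of positive measure has an exact median. -/
theorem exists_median {α : Type*} [MeasurableSpace α] {μ : Measure α} [IsFiniteMeasure μ]
    {w : α → ℝ} (hw : Measurable w) {B : ℝ} (hB : ∀ᵐ x ∂μ, ‖w x‖ ≤ B)
    (hnull : ∀ t, μ {x | w x = t} = 0) : ∃ c, μ {x | c < w x} = μ {x | w x < c} := by
  set T := μ univ with hT
  have hTtop : T ≠ ⊤ := measure_ne_top _ _
  by_cases hT0 : T = 0
  · exact ⟨0, by rw [measure_mono_null (subset_univ _) hT0, measure_mono_null (subset_univ _) hT0]⟩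
  have hcompl : ∀ t, μ {x | w x ≤ t} + μ {x | t < w x} = T := fun t => by
    rw [hT, ← measure_add_measure_compl (measurableSet_le hw (measurable_const (a := t)))]
    congr 2
    ext x
    simp
  set S : Set ℝ := {t | μ {x | w x ≤ t} ≤ T / 2} with hS
  have hne : S.Nonempty := ⟨-B - 1, by
    refine le_trans (le_of_eq ?_) (zero_le (a := T / 2))
    refine measure_eq_zero_iff_ae_notMem.2 ?_
    filter_upwards [hB] with x hx hx'
    have h1 : w x ≤ -B - 1 := hx'
    linarith [(abs_le.1 hx).1]⟩
  have hbdd : BddAbove S := ⟨B, fun t ht => by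
    by_contra! hlt
    have h1 : μ {x | w x ≤ t} = T := by
      refine measure_congr ?_
      filter_upwards [hB] with x hx
      exact propext ⟨fun _ => mem_univ x, fun _ => ((abs_le.1 hx).2.trans hlt.le : w x ≤ t)⟩
    have h2 : T ≤ T / 2 := h1.symm.le.trans ht
    exact absurd (ENNReal.half_lt_self hT0 hTtop) h2.not_gt⟩
  set c := sSup S with hc
  have hlow : μ {x | w x < c} ≤ T / 2 := by
    have e : {x | w x < c} = ⋃ n : ℕ, {x | w x ≤ c - 1 / ((n : ℝ) + 1)} := by
      ext x
      simp only [mem_iUnion, mem_ofPred_eq]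
      constructor
      · intro hx
        obtain ⟨n, hn⟩ := exists_nat_one_div_lt (sub_pos.2 hx)
        exact ⟨n, by linarith⟩
      · rintro ⟨n, hn⟩
        have : (0 : ℝ) < 1 / ((n : ℝ) + 1) := by positivity
        linarith
    have hmono : Monotone fun n : ℕ => {x | w x ≤ c - 1 / ((n : ℝ) + 1)} := by
      intro a b hab x hx
      have h1 : w x ≤ c - 1 / ((a : ℝ) + 1) := hx
      have h2 : 1 / ((b : ℝ) + 1) ≤ 1 / ((a : ℝ) + 1) := Nat.one_div_le_one_div hab
      show w x ≤ c - 1 / ((b : ℝ) + 1)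
      linarith
    rw [e, hmono.measure_iUnion]
    refine iSup_le fun n => ?_
    have : (0 : ℝ) < 1 / ((n : ℝ) + 1) := by positivity
    obtain ⟨t, ht, hlt⟩ := exists_lt_of_lt_csSup hne (show c - 1 / ((n : ℝ) + 1) < sSup S by linarith)
    exact (measure_mono fun x (hx : w x ≤ _) => hx.trans hlt.le).trans ht
  have hhigh : μ {x | c < w x} ≤ T / 2 := by
    have e : {x | c < w x} = ⋃ n : ℕ, {x | c + 1 / ((n : ℝ) + 1) < w x} := by
      ext x
      simp only [mem_iUnion, mem_ofPred_eq]
      constructor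
      · intro hx
        obtain ⟨n, hn⟩ := exists_nat_one_div_lt (sub_pos.2 hx)
        exact ⟨n, by linarith⟩
      · rintro ⟨n, hn⟩
        have : (0 : ℝ) < 1 / ((n : ℝ) + 1) := by positivity
        linarith
    have hmono : Monotone fun n : ℕ => {x | c + 1 / ((n : ℝ) + 1) < w x} := by
      intro a b hab x hx
      have h1 : c + 1 / ((a : ℝ) + 1) < w x := hx
      have h2 : 1 / ((b : ℝ) + 1) ≤ 1 / ((a : ℝ) + 1) := Nat.one_div_le_one_div hab
      show c + 1 / ((b : ℝ) + 1) < w x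
      linarith
    rw [e, hmono.measure_iUnion]
    refine iSup_le fun n => ?_
    have h0 : (0 : ℝ) < 1 / ((n : ℝ) + 1) := by positivity
    have h1 : c + 1 / ((n : ℝ) + 1) ∉ S := fun hmem => by
      have := le_csSup hbdd hmem
      linarith
    have h2 : T / 2 ≤ μ {x | w x ≤ c + 1 / ((n : ℝ) + 1)} := (not_le.1 h1).le
    by_contra! hlt
    have h3 := ENNReal.add_lt_add_of_le_of_lt (ne_top_of_le_ne_top hTtop
      (ENNReal.half_le_self)) h2 hlt
    rw [hcompl, ENNReal.add_halves] at h3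
    exact lt_irrefl _ h3
  -- At the supremum `c`, continuity from below leaves at most half of the mass strictly on each
  -- side. As `{w = c}` is null, the two sides exhaust the mass, so each has exactly half.
  have hsum : μ {x | c < w x} + μ {x | w x < c} = T := by
    rw [← hcompl c, add_comm]
    congr 1
    refine measure_congr ?_
    filter_upwards [measure_eq_zero_iff_ae_notMem.1 (hnull c)] with x hx
    exact propext ⟨fun h : w x < c => h.le, fun h : w x ≤ c => lt_of_le_of_ne h hx⟩
  have hhalf : T / 2 ≠ ⊤ := ne_top_of_le_ne_top hTtop ENNReal.half_le_self
  have h1 : T / 2 ≤ μ {x | c < w x} := by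
    by_contra! hlt
    have h3 := ENNReal.add_lt_add_of_lt_of_le (ne_top_of_le_ne_top hhalf hlow) hlt hlow
    rw [hsum, ENNReal.add_halves] at h3
    exact lt_irrefl _ h3
  have h2 : T / 2 ≤ μ {x | w x < c} := by
    by_contra! hlt
    have h3 := ENNReal.add_lt_add_of_le_of_lt (ne_top_of_le_ne_top hhalf hhigh) hhigh hlt
    rw [hsum, ENNReal.add_halves] at h3
    exact lt_irrefl _ h3
  exact ⟨c, (le_antisymm hhigh h1).trans (le_antisymm hlow h2).symm⟩

theorem measure_hyperplane (i : Fin N) (c : ℝ) :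
    weightedMeasure Ω φ {x | x i = c} = 0 := by
  refine ConcaveWeight.absolutelyContinuous ?_
  have h1 : volume {f : Fin N → ℝ | f i = c} = 0 := by
    rw [volume_pi]
    exact Measure.pi_hyperplane (fun _ : Fin N => (volume : Measure ℝ)) i c
  exact (PiLp.volume_preserving_ofLp (Fin N)).quasiMeasurePreserving.preimage_null h1

/-- Adding a suitable small multiple of a coordinate removes all level sets of positive
measure. -/
theorem ConcaveWeight.exists_null_levels (h : ConcaveWeight m Ω φ) (i : Fin N)
    {f : EuclideanSpace ℝ (Fin N) → ℝ} (hf : Measurable f) {δ : ℝ} (hδ : 0 < δ) :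
    ∃ ε ∈ Ioo 0 δ, ∀ t, weightedMeasure Ω φ {x | f x + ε * x i = t} = 0 := by
  have := h.isFiniteMeasure
  by_contra! hcon
  choose! t ht using hcon
  set A : Ioo (0 : ℝ) δ → Set (EuclideanSpace ℝ (Fin N)) :=
    fun ε => {x | f x + (ε : ℝ) * x i = t ε} with hA
  have hmeas : ∀ ε, NullMeasurableSet (A ε) (weightedMeasure Ω φ) := fun ε =>
    (measurableSet_eq_fun (hf.add (by fun_prop)) measurable_const).nullMeasurableSet
  -- Two such level sets, for different values of `ε`, meet inside a hyperplane `x i = const`, which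
  -- is null. A finite measure has at most countably many almost disjoint sets of positive mass,
  -- while the interval of parameters is uncountable.
  have hdisj : Pairwise (Function.onFun (AEDisjoint (weightedMeasure Ω φ)) A) := by
    intro a b hab
    have hne : (a : ℝ) - b ≠ 0 := sub_ne_zero.2 fun e => hab (Subtype.ext e)
    refine measure_mono_null ?_
      (measure_hyperplane (Ω := Ω) (φ := φ) i ((t a - t b) / ((a : ℝ) - b)))
    rintro x ⟨hxa, hxb⟩
    have h1 : f x + (a : ℝ) * x i = t a := hxa
    have h2 : f x + (b : ℝ) * x i = t b := hxb
    show x i = _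
    rw [eq_div_iff hne]
    linarith
  have hcount := Measure.countable_meas_pos_of_disjoint_iUnion₀ hmeas hdisj
  have huniv : {ε | 0 < weightedMeasure Ω φ (A ε)} = univ :=
    eq_univ_of_forall fun ε => pos_iff_ne_zero.2 (ht ε ε.2)
  rw [huniv, countable_univ_iff] at hcount
  exact absurd (Cardinal.Real.Ioo_countable_iff.1 (countable_coe_iff.1 hcount)) (not_le.2 hδ)

/-- The right-hand side equals `|1 - c|` times the mass of `F` plus `|c|` times that of its
complement. The complement has at least the mass of `F`, and `|1 - c| + |c| ≥ 1`. -/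
theorem ConcaveWeight.measure_le_lintegral_indicator_sub (h : ConcaveWeight m Ω φ)
    {F : Set (EuclideanSpace ℝ (Fin N))} (hF : NullMeasurableSet F (weightedMeasure Ω φ))
    (hle : weightedMeasure Ω φ F ≤ weightedMeasure Ω φ Ω / 2) (c : ℝ) :
    weightedMeasure Ω φ F ≤
      ∫⁻ x, ‖F.indicator (fun _ => 1) x - c‖ₑ ∂(weightedMeasure Ω φ) := by
  have := h.isFiniteMeasure
  have hcompl : weightedMeasure Ω φ F ≤ weightedMeasure Ω φ Fᶜ := by
    by_contra! hlt
    have h1 := ENNReal.add_lt_add_of_le_of_lt (measure_ne_top _ F) hle (hlt.trans_le hle)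
    rw [measure_add_measure_compl₀ hF, ENNReal.add_halves, h.measure_univ] at h1
    exact lt_irrefl _ h1
  have e : ∀ x, ‖F.indicator (fun _ => 1) x - c‖ₑ =
      F.indicator (fun _ => ‖1 - c‖ₑ) x + Fᶜ.indicator (fun _ => ‖c‖ₑ) x := fun x => by
    by_cases hx : x ∈ F <;> simp [hx]
  simp_rw [e]
  rw [lintegral_add_left' (aemeasurable_const.indicator₀ hF), lintegral_indicator₀ hF,
    lintegral_indicator₀ hF.compl, setLIntegral_const, setLIntegral_const]
  calc weightedMeasure Ω φ F = 1 * weightedMeasure Ω φ F := (one_mul _).symm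
    _ ≤ (‖1 - c‖ₑ + ‖c‖ₑ) * weightedMeasure Ω φ F := by
        gcongr
        have := enorm_add_le (1 - c) c
        simpa using this
    _ ≤ _ := by
        rw [add_mul]
        gcongr

theorem muOne_mul_massL1_le {u : EuclideanSpace ℝ (Fin N) → ℝ}
    {G : EuclideanSpace ℝ (Fin N) → EuclideanSpace ℝ (Fin N)} (hu : MemW11 Ω φ u G)
    (hsign : ∫ x, Real.sign (u x) ∂(weightedMeasure Ω φ) = 0) :
    muOne Ω φ * massL1 Ω φ u ≤ ∫⁻ x, ‖G x‖ₑ ∂(weightedMeasure Ω φ) := by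
  by_cases hmass : massL1 Ω φ u = 0
  · simp [hmass]
  · rw [← ENNReal.le_div_iff_mul_le (Or.inl hmass) (Or.inl (massL1_ne_top hu.1))]
    exact sInf_le ⟨u, G, hu, hsign, hmass, rfl⟩

theorem ConcaveWeight.muOne_le_muStar (h : ConcaveWeight m Ω φ) (hN : 0 < N) :
    muOne Ω φ ≤ muStar Ω φ := by
  have := h.isFiniteMeasure
  refine le_sInf ?_
  rintro _ ⟨F, ⟨hFΩ, hFm, hBV, hF0, hle⟩, rfl⟩
  replace hFm := hFm.mono_ac (ConcaveWeight.absolutelyContinuous (Ω := Ω) (φ := φ))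
  rw [ENNReal.le_div_iff_mul_le (Or.inl hF0) (Or.inl (measure_ne_top _ _))]
  obtain ⟨ψ, c, hψs, hψc, hψF, hc, hgrad⟩ := h.exists_testFunctions hBV.1
  set M := weightedMeasure Ω φ univ with hM
  have hMtop : M ≠ ⊤ := measure_ne_top _ _
  set i : Fin N := ⟨0, hN⟩
  set ℓ : EuclideanSpace ℝ (Fin N) →L[ℝ] ℝ := EuclideanSpace.proj i with hℓ
  set η : ℕ → ℝ := fun n => 1 / ((n : ℝ) + 1) with hη
  have hη0 : ∀ n, 0 < η n := fun n => by positivity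
  have hηlim : Tendsto (fun n => ENNReal.ofReal (η n)) atTop (𝓝 0) := by
    simpa [Function.comp_def, hη] using (ENNReal.continuous_ofReal.tendsto _).comp
      (tendsto_one_div_add_atTop_nhds_zero_nat (𝕜 := ℝ))
  obtain ⟨R, hR, hΩR⟩ := h.exists_norm_sub_le 0
  set δ : ℕ → ℝ≥0∞ := fun n =>
    ∫⁻ x, ‖ψ n x - F.indicator (fun _ => 1) x‖ₑ ∂(weightedMeasure Ω φ)
      + ENNReal.ofReal (η n) * (‖ℓ‖ₑ * ENNReal.ofReal R * M) with hδ
  have key : ∀ n, muOne Ω φ * (weightedMeasure Ω φ F - δ n) ≤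
      c n * perimeter Ω φ F + ENNReal.ofReal (η n) * (‖ℓ‖ₑ * M) := fun n => by
    -- The tilt `ε * x i` makes the median exact, as the sign constraint requires. Because `ε < η
    -- n`, its effect on mass and gradient vanishes in the limit.
    obtain ⟨ε, ⟨hε0, hεη⟩, hnull⟩ := h.exists_null_levels i (hψs n).continuous.measurable (hη0 n)
    have hεe : ‖ε‖ₑ ≤ ENNReal.ofReal (η n) := by
      rw [Real.enorm_of_nonneg hε0.le]
      exact ENNReal.ofReal_le_ofReal hεη.le
    set w : EuclideanSpace ℝ (Fin N) → ℝ := fun x => ψ n x + ε * ℓ x with hw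
    have hws : ContDiff ℝ 1 w :=
      ((hψs n).of_le (by simp)).add (contDiff_const.mul ℓ.contDiff)
    obtain ⟨B, hB⟩ := h.isBounded.isCompact_closure.exists_bound_of_continuousOn
      hws.continuous.continuousOn
    obtain ⟨a, ha⟩ := exists_median (μ := weightedMeasure Ω φ) hws.continuous.measurable
      (h.ae_mem.mono fun x hx => hB x (subset_closure hx)) hnull
    have hv : ContDiff ℝ 1 fun x => w x - a := hws.sub contDiff_const
    obtain ⟨G, hG, hGn⟩ := h.exists_memW11 hv
    have hsign : ∫ x, Real.sign (w x - a) ∂(weightedMeasure Ω φ) = 0 := by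
      rw [integral_sign_eq hG.1, sub_eq_zero, measureReal_eq_measureReal_iff]
      simpa only [sub_pos, sub_neg] using ha
    have hmass : weightedMeasure Ω φ F - δ n ≤ massL1 Ω φ fun x => w x - a := by
      rw [tsub_le_iff_right]
      refine (h.measure_le_lintegral_indicator_sub hFm hle a).trans ?_
      have hm2 : AEMeasurable (fun x => ‖ψ n x - F.indicator (fun _ => 1) x‖ₑ)
          (weightedMeasure Ω φ) :=
        ((hψs n).continuous.aestronglyMeasurable.sub hBV.1.1).enorm
      calc ∫⁻ x, ‖F.indicator (fun _ => 1) x - a‖ₑ ∂(weightedMeasure Ω φ)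
          ≤ ∫⁻ x, (‖w x - a‖ₑ + (‖ψ n x - F.indicator (fun _ => 1) x‖ₑ
              + ENNReal.ofReal (η n) * (‖ℓ‖ₑ * ENNReal.ofReal R))) ∂(weightedMeasure Ω φ) := by
            refine lintegral_mono_ae ?_
            filter_upwards [h.ae_mem] with x hx
            have e : F.indicator (fun _ => 1) x - a =
                (w x - a) - (ψ n x - F.indicator (fun _ => 1) x) - ε * ℓ x := by
              simp only [hw]
              ring
            rw [e, ← add_assoc]
            refine enorm_sub_le.trans (add_le_add enorm_sub_le ?_)
            rw [enorm_mul]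
            refine mul_le_mul' hεe ((ℓ.le_opENorm x).trans ?_)
            gcongr
            rw [← ofReal_norm]
            exact ENNReal.ofReal_le_ofReal (by simpa using hΩR x hx)
        _ = _ := by
            rw [lintegral_add_left hv.continuous.measurable.enorm, lintegral_add_left' hm2,
              lintegral_const, hδ, massL1, ← hM]
            simp only [mul_assoc]
    calc muOne Ω φ * (weightedMeasure Ω φ F - δ n)
        ≤ muOne Ω φ * massL1 Ω φ fun x => w x - a := by gcongr
      _ ≤ ∫⁻ x, ‖G x‖ₑ ∂(weightedMeasure Ω φ) := muOne_mul_massL1_le hG hsign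
      _ ≤ ∫⁻ x, (‖fderiv ℝ (ψ n) x‖ₑ + ENNReal.ofReal (η n) * ‖ℓ‖ₑ) ∂(weightedMeasure Ω φ) := by
          refine lintegral_mono fun x => ?_
          have hd : HasFDerivAt (fun x => w x - a) (fderiv ℝ (ψ n) x + ε • ℓ) x :=
            (((hψs n).differentiable (by simp) x).hasFDerivAt.add
              (ℓ.hasFDerivAt.const_mul ε)).sub_const a
          rw [hGn, hd.fderiv]
          refine (enorm_add_le (fderiv ℝ (ψ n) x) (ε • ℓ)).trans (add_le_add_right ?_ _)
          rw [enorm_smul]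
          gcongr
      _ ≤ _ := by
          rw [lintegral_add_right _ measurable_const, lintegral_const, ← hM, mul_assoc]
          gcongr
          exact hgrad n
  have hδlim : Tendsto δ atTop (𝓝 0) := by
    have h1 := ENNReal.Tendsto.mul_const (b := ‖ℓ‖ₑ * ENNReal.ofReal R * M) hηlim
      (Or.inr (ENNReal.mul_ne_top (ENNReal.mul_ne_top enorm_ne_top ENNReal.ofReal_ne_top) hMtop))
    simpa using hψF.add h1
  have hL : Tendsto (fun n => muOne Ω φ * (weightedMeasure Ω φ F - δ n)) atTop
      (𝓝 (muOne Ω φ * weightedMeasure Ω φ F)) := by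
    refine ENNReal.Tendsto.const_mul ?_ (Or.inl hF0)
    simpa using ENNReal.Tendsto.sub tendsto_const_nhds hδlim (Or.inl (measure_ne_top _ F))
  have hRlim : Tendsto (fun n => c n * perimeter Ω φ F + ENNReal.ofReal (η n) * (‖ℓ‖ₑ * M)) atTop
      (𝓝 (perimeter Ω φ F)) := by
    have h1 := ENNReal.Tendsto.mul_const (b := perimeter Ω φ F) hc (Or.inl one_ne_zero)
    have h2 := ENNReal.Tendsto.mul_const (b := ‖ℓ‖ₑ * M) hηlim
      (Or.inr (ENNReal.mul_ne_top enorm_ne_top hMtop))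
    simpa using h1.add h2
  exact le_of_tendsto_of_tendsto' hL hRlim key

/-! ### Compactness in the weighted L¹ space -/

theorem enorm_sub_le_lintegral_fderiv {ψ : EuclideanSpace ℝ (Fin N) → ℝ} (hψ : ContDiff ℝ 1 ψ)
    (x v : EuclideanSpace ℝ (Fin N)) :
    ‖ψ (x + v) - ψ x‖ₑ ≤ ∫⁻ θ in Ioc (0 : ℝ) 1, ‖fderiv ℝ ψ (x + θ • v)‖ₑ * ‖v‖ₑ := by
  have hc := hψ.continuous_fderiv one_ne_zero
  have hderiv : ∀ θ : ℝ, HasDerivAt (fun θ : ℝ => ψ (x + θ • v)) (fderiv ℝ ψ (x + θ • v) v) θ :=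
    fun θ => by
      have h1 : HasDerivAt (fun θ : ℝ => x + θ • v) v θ := by
        simpa using ((hasDerivAt_id θ).smul_const v).const_add x
      exact (hψ.differentiable one_ne_zero (x + θ • v)).hasFDerivAt.comp_hasDerivAt θ h1
  have hinteg := intervalIntegral.integral_eq_sub_of_hasDerivAt (a := 0) (b := 1)
    (fun θ _ => hderiv θ) (Continuous.intervalIntegrable (by fun_prop) 0 1)
  simp only [one_smul, zero_smul, add_zero] at hinteg
  rw [← hinteg, intervalIntegral.integral_of_le zero_le_one]
  refine (enorm_integral_le_lintegral_enorm _).trans (lintegral_mono fun θ => ?_)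
  exact ContinuousLinearMap.le_opENorm _ _

namespace SmoothingData

variable {x₀ : EuclideanSpace ℝ (Fin N)} {r s R : ℝ} {ρ : EuclideanSpace ℝ (Fin N) → ℝ}

theorem lintegral_shift_sub_le (D : SmoothingData m Ω φ x₀ r s ρ)
    (hR : ∀ x ∈ Ω, ‖x - x₀‖ ≤ R) {ψ : EuclideanSpace ℝ (Fin N) → ℝ} (hψ : ContDiff ℝ 1 ψ)
    {w : EuclideanSpace ℝ (Fin N)} (hw : ‖w‖ ≤ (1 - s) * r) :
    ∫⁻ x, ‖ψ (s • x + (1 - s) • x₀ - w) - ψ x‖ₑ ∂(weightedMeasure Ω φ) ≤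
      ENNReal.ofReal ((1 - s) * (R + r)) * (ENNReal.ofReal (s ^ (m + N))⁻¹ *
        ∫⁻ x, ‖fderiv ℝ ψ x‖ₑ ∂(weightedMeasure Ω φ)) := by
  have := D.weight.isFiniteMeasure
  have hc := hψ.continuous_fderiv one_ne_zero
  have hs := D.ratio_pos
  set v : EuclideanSpace ℝ (Fin N) → EuclideanSpace ℝ (Fin N) :=
    fun x => s • x + (1 - s) • x₀ - w - x with hv
  -- Each point of the segment from `x` to its image is itself the image of `x` under a homothety of
  -- ratio `1 - θ * (1 - s)`, at least `s`, followed by the shift `θ • w`. The distortion bound thus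
  -- holds uniformly along the path.
  have hpath : ∀ (θ : ℝ) x, x + θ • v x =
      (1 - θ * (1 - s)) • x + (1 - (1 - θ * (1 - s))) • x₀ - θ • w := fun θ x => by
    simp only [hv]
    module
  have hvc : Continuous v := by fun_prop
  have hmeas : Measurable (Function.uncurry fun (x : EuclideanSpace ℝ (Fin N)) (θ : ℝ) =>
      ‖fderiv ℝ ψ (x + θ • v x)‖ₑ) :=
    (hc.comp (by fun_prop : Continuous fun p : EuclideanSpace ℝ (Fin N) × ℝ =>
      p.1 + p.2 • v p.1)).measurable.enorm
  calc ∫⁻ x, ‖ψ (s • x + (1 - s) • x₀ - w) - ψ x‖ₑ ∂(weightedMeasure Ω φ)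
      ≤ ∫⁻ x, ENNReal.ofReal ((1 - s) * (R + r)) *
          (∫⁻ θ in Ioc (0 : ℝ) 1, ‖fderiv ℝ ψ (x + θ • v x)‖ₑ) ∂(weightedMeasure Ω φ) := by
        refine lintegral_mono_ae ?_
        filter_upwards [D.weight.ae_mem] with x hx
        have h1 := enorm_sub_le_lintegral_fderiv hψ x (v x)
        rw [show x + v x = s • x + (1 - s) • x₀ - w by simp [hv]] at h1
        refine h1.trans ?_
        rw [lintegral_mul_const' _ _ enorm_ne_top, mul_comm]
        gcongr
        rw [← ofReal_norm]
        exact ENNReal.ofReal_le_ofReal (D.norm_sub_le (hR x hx) hw)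
    _ = ENNReal.ofReal ((1 - s) * (R + r)) * ∫⁻ θ in Ioc (0 : ℝ) 1,
          (∫⁻ x, ‖fderiv ℝ ψ (x + θ • v x)‖ₑ ∂(weightedMeasure Ω φ)) := by
        rw [lintegral_const_mul' _ _ ENNReal.ofReal_ne_top,
          lintegral_lintegral_swap hmeas.aemeasurable]
    _ ≤ ENNReal.ofReal ((1 - s) * (R + r)) * ∫⁻ θ in Ioc (0 : ℝ) 1,
          ENNReal.ofReal (s ^ (m + N))⁻¹ * ∫⁻ x, ‖fderiv ℝ ψ x‖ₑ ∂(weightedMeasure Ω φ) := by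
        refine mul_le_mul_right ?_ _
        refine setLIntegral_mono measurable_const fun θ hθ => ?_
        have h1s := D.one_sub_pos
        have hle : s ≤ 1 - θ * (1 - s) := by nlinarith [hθ.2]
        have hle1 : 1 - θ * (1 - s) ≤ 1 := by nlinarith [hθ.1]
        simp_rw [hpath θ]
        refine (D.weight.lintegral_comp_le D.radius_pos.le D.ball_subset (hs.trans_le hle) hle1
          (w := θ • w) ?_ (f := fun x => ‖fderiv ℝ ψ x‖ₑ) hc.measurable.enorm).trans ?_
        · rw [norm_smul, Real.norm_of_nonneg hθ.1.le, sub_sub_cancel, mul_assoc]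
          exact mul_le_mul_of_nonneg_left hw hθ.1.le
        · gcongr
    _ = _ := by
        rw [setLIntegral_const, Real.volume_Ioc]
        simp

/-- Unlike the qualitative `tendsto_smoothing`, this rate depends on `ψ` only through its gradient
norm, so it is uniform over a bounded family. -/
theorem lintegral_smoothing_sub_le_fderiv (D : SmoothingData m Ω φ x₀ r s ρ)
    (hR : ∀ x ∈ Ω, ‖x - x₀‖ ≤ R) {ψ : EuclideanSpace ℝ (Fin N) → ℝ} (hψ : ContDiff ℝ 1 ψ) :
    ∫⁻ x, ‖smoothing Ω x₀ r s ρ ψ x - ψ x‖ₑ ∂(weightedMeasure Ω φ) ≤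
      ENNReal.ofReal ((1 - s) * (R + r)) * (ENNReal.ofReal (s ^ (m + N))⁻¹ *
        ∫⁻ x, ‖fderiv ℝ ψ x‖ₑ ∂(weightedMeasure Ω φ)) :=
  D.lintegral_smoothing_sub_le (D.weight.integrable_of_continuous hψ.continuous)
    hψ.continuous.measurable fun _ hw => D.lintegral_shift_sub_le hR hψ hw

/-- Smoothing maps bounded sets of `L¹` to bounded sets of Lipschitz functions. -/
theorem exists_smoothing_bound (D : SmoothingData m Ω φ x₀ r s ρ) {B : ℝ≥0∞} (hB : B ≠ ⊤) :
    ∃ C : NNReal, ∀ u : EuclideanSpace ℝ (Fin N) → ℝ, Integrable u (weightedMeasure Ω φ) →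
      massL1 Ω φ u ≤ B →
        (∀ x, ‖smoothing Ω x₀ r s ρ u x‖ ≤ C) ∧ LipschitzWith C (smoothing Ω x₀ r s ρ u) := by
  obtain ⟨c, hc, hle⟩ := D.exists_restrict_core_le
  obtain ⟨C₁, hC₁0, hC₁⟩ := D.mollifier.exists_bound
  obtain ⟨C₂, hC₂0, hC₂⟩ := D.mollifier.exists_fderiv_bound
  have hs := D.ratio_pos
  have hmass : ∀ u : EuclideanSpace ℝ (Fin N) → ℝ, Integrable u (weightedMeasure Ω φ) →
      massL1 Ω φ u ≤ B → ∫ y in core Ω x₀ r s, ‖u y‖ ≤ c * B.toReal := fun u hu huB => by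
    rw [integral_norm_eq_lintegral_enorm (D.integrableOn_core hu).1]
    refine ENNReal.toReal_le_of_le_ofReal (by positivity) ?_
    refine (lintegral_mono' hle le_rfl).trans ?_
    rw [lintegral_smul_measure, ENNReal.ofReal_mul hc.le, ENNReal.ofReal_toReal hB, smul_eq_mul]
    gcongr
    exact huB
  have hbound : ∀ (u k : EuclideanSpace ℝ (Fin N) → ℝ) (K : ℝ), 0 ≤ K →
      Integrable u (weightedMeasure Ω φ) → massL1 Ω φ u ≤ B → (∀ y, ‖k y‖ ≤ K) →
      ‖∫ y in core Ω x₀ r s, u y * k y‖ ≤ K * (c * B.toReal) := fun u k K hK hu huB hk => by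
    refine (norm_integral_le_of_norm_le ((D.integrableOn_core hu).norm.const_mul K)
      (.of_forall fun y => ?_)).trans ?_
    · rw [norm_mul, mul_comm]
      exact mul_le_mul_of_nonneg_right (hk y) (norm_nonneg _)
    · rw [integral_const_mul]
      exact mul_le_mul_of_nonneg_left (hmass u hu huB) hK
  refine ⟨⟨(C₁ + s * C₂) * (c * B.toReal), by positivity⟩, fun u hu huB => ⟨fun x => ?_, ?_⟩⟩
  · refine (hbound u _ C₁ hC₁0 hu huB fun y => hC₁ _).trans ?_
    exact mul_le_mul_of_nonneg_right (le_add_of_nonneg_right (by positivity)) (by positivity)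
  · refine lipschitzWith_of_nnnorm_fderiv_le
      ((D.contDiff_smoothing hu).differentiable (by simp)) fun x => ?_
    refine ContinuousLinearMap.opNorm_le_bound _ (NNReal.coe_nonneg _) fun e => ?_
    rw [D.fderiv_smoothing_apply hu]
    refine (hbound u _ (s * C₂ * ‖e‖) (by positivity) hu huB fun y => ?_).trans ?_
    · rw [norm_mul, Real.norm_of_nonneg hs.le, mul_assoc]
      exact mul_le_mul_of_nonneg_left (((fderiv ℝ ρ _).le_opNorm e).trans
        (mul_le_mul_of_nonneg_right (hC₂ _) (norm_nonneg e))) hs.le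
    · rw [mul_right_comm]
      refine mul_le_mul_of_nonneg_right ?_ (norm_nonneg e)
      exact mul_le_mul_of_nonneg_right (le_add_of_nonneg_left hC₁0) (by positivity)

/-- Smoothings of a bounded sequence of `L¹` fall into finitely many small uniform balls. -/
theorem exists_finite_discretization (D : SmoothingData m Ω φ x₀ r s ρ)
    {u : ℕ → EuclideanSpace ℝ (Fin N) → ℝ} (hu : ∀ n, Integrable (u n) (weightedMeasure Ω φ))
    {B : ℝ≥0∞} (hB : B ≠ ⊤) (huB : ∀ n, massL1 Ω φ (u n) ≤ B) {δ : ℝ} (hδ : 0 < δ) :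
    ∃ (β : Type) (_ : Finite β) (F : ℕ → β), ∀ i j, F i = F j → ∀ x ∈ Ω,
      ‖smoothing Ω x₀ r s ρ (u i) x - smoothing Ω x₀ r s ρ (u j) x‖ ≤ δ := by
  obtain ⟨C, hC⟩ := D.exists_smoothing_bound hB
  have : CompactSpace (closure Ω) :=
    isCompact_iff_compactSpace.1 D.weight.isBounded.isCompact_closure
  let f : ℕ → BoundedContinuousFunction (closure Ω) ℝ := fun n =>
    BoundedContinuousFunction.mkOfCompact ⟨fun x => smoothing Ω x₀ r s ρ (u n) x,
      (D.contDiff_smoothing (hu n)).continuous.comp continuous_subtype_val⟩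
  -- Arzelà–Ascoli: at a fixed ratio the L¹ bound makes the smoothings uniformly bounded and
  -- uniformly Lipschitz on the compact closure of Ω.
  have hcomp : IsCompact (closure (range f)) := by
    refine BoundedContinuousFunction.arzela_ascoli (closedBall 0 (C : ℝ))
      (isCompact_closedBall 0 _) _ ?_ ?_
    · rintro _ x ⟨n, rfl⟩
      exact mem_closedBall_zero_iff.2 ((hC (u n) (hu n) (huB n)).1 x)
    · refine (LipschitzWith.uniformEquicontinuous _ C ?_).equicontinuous
      rintro ⟨_, n, rfl⟩
      have h1 := (hC (u n) (hu n) (huB n)).2.comp (LipschitzWith.subtype_val (closure Ω))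
      rw [mul_one] at h1
      exact h1
  obtain ⟨t, ht, hcov⟩ := Metric.totallyBounded_iff.1
    (hcomp.totallyBounded.subset subset_closure) (δ / 2) (by positivity)
  have hex : ∀ n, ∃ y : t, dist (f n) y < δ / 2 := fun n => by
    obtain ⟨y, hy, hlt⟩ := mem_iUnion₂.1 (hcov (mem_range_self n))
    exact ⟨⟨y, hy⟩, hlt⟩
  choose F hF using hex
  refine ⟨t, ht, F, fun i j hij x hx => ?_⟩
  have h1 : dist (f i) (f j) ≤ δ := by
    have h2 := hF j
    rw [← hij, dist_comm] at h2
    linarith [dist_triangle (f i) (F i : BoundedContinuousFunction (closure Ω) ℝ) (f j), hF i]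
  have h2 := (BoundedContinuousFunction.dist_coe_le_dist (f := f i) (g := f j)
    ⟨x, subset_closure hx⟩).trans h1
  rwa [dist_eq_norm] at h2

end SmoothingData

/-- Compactness of bounded sequences of smooth functions in the weighted `L¹` space. -/
theorem ConcaveWeight.exists_subseq_tendsto (h : ConcaveWeight m Ω φ)
    {ψ : ℕ → EuclideanSpace ℝ (Fin N) → ℝ} (hψ : ∀ n, ContDiff ℝ 1 (ψ n)) {B : ℝ≥0∞} (hB : B ≠ ⊤)
    (hmass : ∀ n, massL1 Ω φ (ψ n) ≤ B)
    (hgrad : ∀ n, ∫⁻ x, ‖fderiv ℝ (ψ n) x‖ₑ ∂(weightedMeasure Ω φ) ≤ B) :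
    ∃ (u : EuclideanSpace ℝ (Fin N) → ℝ) (k : ℕ → ℕ), Integrable u (weightedMeasure Ω φ) ∧
      StrictMono k ∧
      Tendsto (fun j => ∫⁻ x, ‖ψ (k j) x - u x‖ₑ ∂(weightedMeasure Ω φ)) atTop (𝓝 0) := by
  have := h.isFiniteMeasure
  obtain ⟨x₀, r, s, ρ, hD, hs⟩ := h.exists_smoothingData
  obtain ⟨R, -, hR⟩ := h.exists_norm_sub_le x₀
  have hi : ∀ n, Integrable (ψ n) (weightedMeasure Ω φ) := fun n =>
    h.integrable_of_continuous (hψ n).continuous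
  set M := weightedMeasure Ω φ univ with hM
  have hMtop : M ≠ ⊤ := measure_ne_top _ _
  have hedist : ∀ i j, edist ((hi i).toL1 (ψ i)) ((hi j).toL1 (ψ j)) =
      ∫⁻ x, ‖ψ i x - ψ j x‖ₑ ∂(weightedMeasure Ω φ) := fun i j => by
    rw [Integrable.edist_toL1_toL1]
    simp_rw [edist_eq_enorm_sub]
  have htot : TotallyBounded (range fun n => (hi n).toL1 (ψ n)) := by
    refine Metric.totallyBounded_of_finite_discretization fun ε hε => ?_
    -- Two smoothing errors and one uniform discrepancy use three quarters; the fourth makes the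
    -- final inequality strict.
    set η := ENNReal.ofReal ε / 4 with hη
    have hη0 : 0 < η := ENNReal.div_pos (ENNReal.ofReal_pos.2 hε).ne' (by simp)
    obtain ⟨n, hn⟩ : ∃ n, ENNReal.ofReal ((1 - s n) * (R + r)) *
        (ENNReal.ofReal (s n ^ (m + N))⁻¹ * B) ≤ η := by
      have h1 : Tendsto (fun n => (1 - s n) * (R + r)) atTop (𝓝 0) := by
        simpa using (hs.const_sub 1).mul_const (R + r)
      have h2 := (ENNReal.continuous_ofReal.tendsto _).comp h1
      have h3 := ENNReal.Tendsto.mul_const (b := B) (tendsto_ofReal_inv_pow hs (m + N))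
        (Or.inl one_ne_zero)
      have h4 := ENNReal.Tendsto.mul h2 (Or.inr (by simpa using hB)) h3 (Or.inr (by simp))
      rw [ENNReal.ofReal_zero, zero_mul] at h4
      exact (h4.eventually_le_const hη0).exists
    set δ : ℝ := ε / 4 / (M.toReal + 1) with hδ
    have hδ0 : 0 < δ := by positivity
    have hδM : ENNReal.ofReal δ * M ≤ η := by
      rw [← ENNReal.ofReal_toReal hMtop, ← ENNReal.ofReal_mul hδ0.le, hη,
        show (4 : ℝ≥0∞) = ENNReal.ofReal 4 by simp, ← ENNReal.ofReal_div_of_pos (by norm_num)]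
      refine ENNReal.ofReal_le_ofReal ?_
      rw [hδ, div_mul_eq_mul_div, div_le_iff₀ (by positivity)]
      gcongr
      linarith
    obtain ⟨β, hβ, F, hF⟩ := (hD n).exists_finite_discretization hi hB hmass hδ0
    choose idx hidx using fun y : range fun n => (hi n).toL1 (ψ n) => y.2
    refine ⟨β, Fintype.ofFinite β, fun y => F (idx y), fun y z hyz => ?_⟩
    rw [← hidx y, ← hidx z]
    dsimp only
    rw [← ENNReal.ofReal_lt_ofReal_iff hε, ← edist_dist, hedist]
    have hT : ∀ i, ∫⁻ x, ‖smoothing Ω x₀ r (s n) (ρ n) (ψ i) x - ψ i x‖ₑ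
        ∂(weightedMeasure Ω φ) ≤ η := fun i =>
      ((hD n).lintegral_smoothing_sub_le_fderiv hR (hψ i)).trans (le_trans (by
        gcongr
        exact hgrad i) hn)
    have hTm : ∀ i, Measurable (smoothing Ω x₀ r (s n) (ρ n) (ψ i)) := fun i =>
      ((hD n).contDiff_smoothing (hi i)).continuous.measurable
    have hψm : ∀ i, Measurable (ψ i) := fun i => (hψ i).continuous.measurable
    set i := idx y
    set j := idx z
    calc ∫⁻ x, ‖ψ i x - ψ j x‖ₑ ∂(weightedMeasure Ω φ)
        ≤ ∫⁻ x, (‖smoothing Ω x₀ r (s n) (ρ n) (ψ i) x - ψ i x‖ₑ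
            + (‖smoothing Ω x₀ r (s n) (ρ n) (ψ j) x - ψ j x‖ₑ + ENNReal.ofReal δ))
              ∂(weightedMeasure Ω φ) := by
          refine lintegral_mono_ae ?_
          filter_upwards [h.ae_mem] with x hx
          have hδx : ‖smoothing Ω x₀ r (s n) (ρ n) (ψ i) x
              - smoothing Ω x₀ r (s n) (ρ n) (ψ j) x‖ₑ ≤ ENNReal.ofReal δ := by
            rw [← ofReal_norm]
            exact ENNReal.ofReal_le_ofReal (hF i j hyz x hx)
          have e : ψ i x - ψ j x = (smoothing Ω x₀ r (s n) (ρ n) (ψ j) x - ψ j x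
              + (smoothing Ω x₀ r (s n) (ρ n) (ψ i) x
              - smoothing Ω x₀ r (s n) (ρ n) (ψ j) x))
              - (smoothing Ω x₀ r (s n) (ρ n) (ψ i) x - ψ i x) := by ring
          rw [e, add_comm ‖smoothing Ω x₀ r (s n) (ρ n) (ψ i) x - ψ i x‖ₑ]
          refine enorm_sub_le.trans (add_le_add_left ?_ _)
          exact (enorm_add_le _ _).trans (add_le_add_right hδx _)
      _ = ∫⁻ x, ‖smoothing Ω x₀ r (s n) (ρ n) (ψ i) x - ψ i x‖ₑ ∂(weightedMeasure Ω φ)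
            + (∫⁻ x, ‖smoothing Ω x₀ r (s n) (ρ n) (ψ j) x - ψ j x‖ₑ ∂(weightedMeasure Ω φ)
            + ENNReal.ofReal δ * M) := by
          have hm : ∀ i, Measurable fun x =>
              ‖smoothing Ω x₀ r (s n) (ρ n) (ψ i) x - ψ i x‖ₑ := fun i =>
            ((hTm i).sub (hψm i)).enorm
          rw [lintegral_add_left (hm i), lintegral_add_left (hm j), lintegral_const]
      _ ≤ η + (η + η) := by
          gcongr
          exacts [hT i, hT j]
      _ < ENNReal.ofReal ε := by
          have h4 : η * 4 = ENNReal.ofReal ε :=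
            ENNReal.div_mul_cancel (by norm_num) (by simp)
          have hηtop : η ≠ ⊤ := (ENNReal.div_lt_top ENNReal.ofReal_ne_top (by norm_num)).ne
          have h5 : η + (η + η) < η + (η + η) + η :=
            ENNReal.lt_add_right (by finiteness) hη0.ne'
          rw [← h4]
          refine h5.trans_eq ?_
          ring
  have hcomp : IsCompact (closure (range fun n => (hi n).toL1 (ψ n))) :=
    htot.closure.isCompact_of_isClosed isClosed_closure
  obtain ⟨a, -, k, hk, hlim⟩ := hcomp.tendsto_subseq
    fun n => subset_closure (mem_range_self (f := fun n => (hi n).toL1 (ψ n)) n)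
  have ha := L1.integrable_coeFn a
  refine ⟨a, k, ha, hk, ?_⟩
  have h1 := (tendsto_iff_edist_tendsto_0).1 hlim
  refine h1.congr fun j => ?_
  have h2 : edist ((hi (k j)).toL1 (ψ (k j))) (ha.toL1 a) =
      ∫⁻ x, ‖ψ (k j) x - a x‖ₑ ∂(weightedMeasure Ω φ) := by
    rw [Integrable.edist_toL1_toL1]
    simp_rw [edist_eq_enorm_sub]
  rw [← h2, Integrable.toL1_coeFn]
  rfl

/-! ### Existence by the direct method -/

/-- In positive dimension a point is null, so outer regularity gives it a neighbourhood of less than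
half the mass; a bump function supported there is a competitor. -/
theorem ConcaveWeight.exists_isBarCompetitor (h : ConcaveWeight m Ω φ) (hN : 0 < N) :
    ∃ u, IsBarCompetitor Ω φ u := by
  have := h.isFiniteMeasure
  have : Nonempty (Fin N) := ⟨⟨0, hN⟩⟩
  obtain ⟨x₀, hx₀⟩ := h.nonempty
  have hhalf : weightedMeasure Ω φ {x₀} < weightedMeasure Ω φ Ω / 2 := by
    rw [ConcaveWeight.absolutelyContinuous (measure_singleton x₀)]
    exact ENNReal.half_pos h.measure_ne_zero
  obtain ⟨U, hU, hUo, hUm⟩ := Set.exists_isOpen_lt_of_lt {x₀} _ hhalf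
  obtain ⟨r, hr, hball⟩ := Metric.nhds_basis_closedBall.mem_iff.1
    ((hUo.inter h.isOpen).mem_nhds ⟨hU rfl, hx₀⟩)
  let b : ContDiffBump x₀ := ⟨r / 2, r, by linarith, by linarith⟩
  have hbs : ContDiff ℝ (⊤ : ℕ∞) b := b.contDiff
  refine ⟨b, ⟨h.integrable_of_continuous b.continuous, ?_⟩, .of_forall fun x => b.nonneg, ?_, ?_⟩
  · refine (totalVariation_le_lintegral_fderiv hbs b.hasCompactSupport).trans_lt ?_
    exact (h.integrable_of_continuous (hbs.continuous_fderiv (by simp))).2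
  · intro h0
    rw [massL1, lintegral_eq_zero_iff b.continuous.measurable.enorm] at h0
    have h1 := h.restrict_absolutelyContinuous h0
    have h2 : volume (closedBall x₀ (r / 2)) = 0 := by
      rw [← Measure.restrict_eq_self volume
        ((closedBall_subset_closedBall (by linarith)).trans (hball.trans inter_subset_right) :
          closedBall x₀ (r / 2) ⊆ Ω)]
      refine measure_mono_null (fun x hx => ?_) h1
      have h3 : b x = 1 := b.one_of_mem_closedBall hx
      simp [h3]
    exact (measure_closedBall_pos volume x₀ (by linarith : (0 : ℝ) < r / 2)).ne' h2
  · refine (measure_mono fun x (hx : 0 < b x) => ?_).trans hUm.le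
    have h1 : x ∈ ball x₀ r := by
      have : x ∈ Function.support b := hx.ne'
      rwa [b.support_eq] at this
    exact (hball (ball_subset_closedBall h1)).1

theorem totalVariation_const_mul_le {c : ℝ} (hc : 0 ≤ c) (u : EuclideanSpace ℝ (Fin N) → ℝ) :
    totalVariation Ω φ (fun x => c * u x) ≤ ENNReal.ofReal c * totalVariation Ω φ u := by
  refine iSup_le fun σ => iSup_le fun g => iSup_le fun h => ?_
  simp_rw [mul_assoc]
  rw [integral_const_mul, ← mul_neg, ENNReal.ofReal_mul hc]
  gcongr
  exact le_totalVariation u h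

theorem massL1_const_mul (c : ℝ) (u : EuclideanSpace ℝ (Fin N) → ℝ) :
    massL1 Ω φ (fun x => c * u x) = ‖c‖ₑ * massL1 Ω φ u := by
  simp_rw [massL1, enorm_mul]
  rw [lintegral_const_mul' _ _ enorm_ne_top]

/-- A competitor of the relaxed problem can be normalized to have unit mass. -/
theorem IsBarCompetitor.exists_normalized {u : EuclideanSpace ℝ (Fin N) → ℝ}
    (hu : IsBarCompetitor Ω φ u) : ∃ v, IsBarCompetitor Ω φ v ∧ massL1 Ω φ v = 1 ∧
      totalVariation Ω φ v ≤ totalVariation Ω φ u / massL1 Ω φ u := by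
  obtain ⟨hBV, hnn, hmass, hpos⟩ := hu
  have htop := massL1_ne_top hBV.1
  set c : ℝ := (massL1 Ω φ u).toReal⁻¹ with hc
  have hc0 : 0 < c := inv_pos.2 (ENNReal.toReal_pos hmass htop)
  have hce : ENNReal.ofReal c = (massL1 Ω φ u)⁻¹ := by
    rw [hc, ENNReal.ofReal_inv_of_pos (ENNReal.toReal_pos hmass htop), ENNReal.ofReal_toReal htop]
  have hone : massL1 Ω φ (fun x => c * u x) = 1 := by
    rw [massL1_const_mul, Real.enorm_of_nonneg hc0.le, hce, ENNReal.inv_mul_cancel hmass htop]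
  have hTV : totalVariation Ω φ (fun x => c * u x) ≤ totalVariation Ω φ u / massL1 Ω φ u := by
    refine (totalVariation_const_mul_le hc0.le u).trans_eq ?_
    rw [hce, mul_comm, div_eq_mul_inv]
  refine ⟨_, ⟨⟨hBV.1.const_mul c, hTV.trans_lt (ENNReal.div_lt_top hBV.2.ne hmass)⟩, ?_, ?_, ?_⟩,
    hone, hTV⟩
  · filter_upwards [hnn] with x hx using mul_nonneg hc0.le hx
  · rw [hone]
    exact one_ne_zero
  · simpa only [mul_pos_iff_of_pos_left hc0] using hpos

/-- Limits in the weighted `L¹` space of normalized competitors are competitors. -/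
theorem ConcaveWeight.nonneg_and_measure_pos_le (h : ConcaveWeight m Ω φ)
    {v : ℕ → EuclideanSpace ℝ (Fin N) → ℝ} (hv : ∀ n, IsBarCompetitor Ω φ (v n))
    {u : EuclideanSpace ℝ (Fin N) → ℝ} (hu : Integrable u (weightedMeasure Ω φ))
    (hlim : Tendsto (fun n => ∫⁻ x, ‖v n x - u x‖ₑ ∂(weightedMeasure Ω φ)) atTop (𝓝 0)) :
    (∀ᵐ x ∂(weightedMeasure Ω φ), 0 ≤ u x) ∧
      weightedMeasure Ω φ {x | 0 < u x} ≤ weightedMeasure Ω φ Ω / 2 := by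
  have := h.isFiniteMeasure
  have hmeas : TendstoInMeasure (weightedMeasure Ω φ) v atTop u := by
    refine tendstoInMeasure_of_tendsto_eLpNorm (p := 1) one_ne_zero (fun n => (hv n).1.1.1) hu.1 ?_
    simp_rw [eLpNorm_one_eq_lintegral_enorm]
    exact hlim
  obtain ⟨k, -, hk⟩ := hmeas.exists_seq_tendsto_ae
  have hnn : ∀ᵐ x ∂(weightedMeasure Ω φ), ∀ n, 0 ≤ v n x := ae_all_iff.2 fun n => (hv n).2.1
  refine ⟨?_, ?_⟩
  · filter_upwards [hk, hnn] with x hx hx0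
    exact ge_of_tendsto' hx fun j => hx0 (k j)
  · have hset : ∀ f : EuclideanSpace ℝ (Fin N) → ℝ, Integrable f (weightedMeasure Ω φ) →
        NullMeasurableSet {x | 0 < f x} (weightedMeasure Ω φ) := fun f hf =>
      nullMeasurableSet_lt aemeasurable_const hf.1.aemeasurable
    calc weightedMeasure Ω φ {x | 0 < u x}
        = ∫⁻ x, {x | 0 < u x}.indicator 1 x ∂(weightedMeasure Ω φ) :=
          (lintegral_indicator_one₀ (hset u hu)).symm
      _ ≤ ∫⁻ x, liminf (fun j => {x | 0 < v (k j) x}.indicator 1 x) atTop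
            ∂(weightedMeasure Ω φ) := by
          refine lintegral_mono_ae ?_
          filter_upwards [hk] with x hx
          -- If the limit is positive at `x`, the terms are eventually positive there; Fatou then
          -- passes the bound by half of the mass to the limit.
          by_cases hux : 0 < u x
          · refine le_liminf_of_le (by isBoundedDefault) ?_
            filter_upwards [hx.eventually_const_lt hux] with j hj
            simp [hj, hux]
          · simp [hux]
      _ ≤ liminf (fun j => ∫⁻ x, {x | 0 < v (k j) x}.indicator 1 x ∂(weightedMeasure Ω φ)) atTop :=
          lintegral_liminf_le' fun j => aemeasurable_const.indicator₀ (hset _ (hv (k j)).1.1)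
      _ ≤ liminf (fun _ : ℕ => weightedMeasure Ω φ Ω / 2) atTop := by
          refine liminf_le_liminf (.of_forall fun j => ?_)
          rw [lintegral_indicator_one₀ (hset _ (hv (k j)).1.1)]
          exact (hv (k j)).2.2.2
      _ = _ := liminf_const _

theorem massL1_le_add {u v : EuclideanSpace ℝ (Fin N) → ℝ}
    (hu : Integrable u (weightedMeasure Ω φ)) :
    massL1 Ω φ v ≤ massL1 Ω φ u + ∫⁻ x, ‖v x - u x‖ₑ ∂(weightedMeasure Ω φ) := by
  rw [massL1, massL1, ← lintegral_add_left' hu.1.enorm]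
  refine lintegral_mono fun x => ?_
  simpa using enorm_add_le (u x) (v x - u x)

/-- The infimum of the relaxed problem is attained. -/
theorem ConcaveWeight.exists_isBarOptimal (h : ConcaveWeight m Ω φ) (hN : 0 < N) :
    ∃ u, IsBarOptimal Ω φ u := by
  have := h.isFiniteMeasure
  obtain ⟨w, hw⟩ := h.exists_isBarCompetitor hN
  obtain ⟨q, hqanti, hqlim, hq⟩ := exists_seq_tendsto_sInf
    (S := {q | ∃ u, IsBarCompetitor Ω φ u ∧ q = totalVariation Ω φ u / massL1 Ω φ u})
    ⟨_, w, hw, rfl⟩ (OrderBot.bddBelow _)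
  have hex : ∀ n, ∃ v, IsBarCompetitor Ω φ v ∧ massL1 Ω φ v = 1 ∧ totalVariation Ω φ v ≤ q n :=
    fun n => by
      obtain ⟨u, hu, e⟩ := hq n
      rw [e]
      exact hu.exists_normalized
  choose v hv hv1 hvq using hex
  have hq0 : q 0 ≠ ⊤ := by
    obtain ⟨u, hu, e⟩ := hq 0
    rw [e]
    exact (ENNReal.div_lt_top hu.1.2.ne hu.2.2.1).ne
  -- Compactness is available for smooth functions, so the minimizing sequence is replaced by nearby
  -- test functions. Their L¹ distance to it tends to zero, and a factor 2 in the gradient bound is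
  -- harmless.
  have hψex : ∀ n : ℕ, ∃ ψ : EuclideanSpace ℝ (Fin N) → ℝ, ContDiff ℝ (⊤ : ℕ∞) ψ ∧
      ∫⁻ x, ‖ψ x - v n x‖ₑ ∂(weightedMeasure Ω φ) ≤ ((n : ℝ≥0∞) + 1)⁻¹ ∧
      ∫⁻ x, ‖fderiv ℝ ψ x‖ₑ ∂(weightedMeasure Ω φ) ≤ 2 * q 0 := fun n => by
    obtain ⟨ψ, c, hψs, -, hψv, hc, hgrad⟩ := h.exists_testFunctions (hv n).1.1
    obtain ⟨j, hj1, hj2⟩ := ((hψv.eventually_le_const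
      (ENNReal.inv_pos.2 (by finiteness : (n : ℝ≥0∞) + 1 ≠ ⊤))).and
      (hc.eventually_le_const ENNReal.one_lt_two)).exists
    refine ⟨ψ j, hψs j, hj1, (hgrad j).trans ?_⟩
    gcongr
    exact (hvq n).trans (hqanti (Nat.zero_le n))
  choose ψ hψs hψv hψg using hψex
  have hψv1 : ∀ n, ∫⁻ x, ‖ψ n x - v n x‖ₑ ∂(weightedMeasure Ω φ) ≤ 1 := fun n =>
    (hψv n).trans (ENNReal.inv_le_one.2 (by simp))
  obtain ⟨u, k, hu, hk, hlim⟩ := h.exists_subseq_tendsto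
    (fun n => (hψs n).of_le (by simp)) (B := 2 + 2 * q 0) (by finiteness)
    (fun n => by
      refine (massL1_le_add (hv n).1.1).trans (le_trans (add_le_add (hv1 n).le (hψv1 n)) ?_)
      rw [one_add_one_eq_two]
      exact le_self_add) (fun n => (hψg n).trans le_add_self)
  have hvlim : Tendsto (fun j => ∫⁻ x, ‖v (k j) x - u x‖ₑ ∂(weightedMeasure Ω φ)) atTop (𝓝 0) := by
    have h1 : Tendsto (fun n : ℕ => ((n : ℝ≥0∞) + 1)⁻¹) atTop (𝓝 0) := by
      simpa [Function.comp_def] using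
        ENNReal.tendsto_inv_nat_nhds_zero.comp (tendsto_add_atTop_nat 1)
    have h2 := (h1.comp hk.tendsto_atTop).add hlim
    rw [add_zero] at h2
    refine tendsto_of_tendsto_of_tendsto_of_le_of_le tendsto_const_nhds h2
      (fun _ => zero_le) fun j => ?_
    refine le_trans ?_ (add_le_add_left (hψv (k j)) _)
    have hm : AEMeasurable (fun x => ‖ψ (k j) x - v (k j) x‖ₑ) (weightedMeasure Ω φ) :=
      ((hψs (k j)).continuous.aestronglyMeasurable.sub (hv (k j)).1.1.1).enorm
    rw [← lintegral_add_left' hm]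
    refine lintegral_mono fun x => ?_
    rw [enorm_sub_rev (ψ (k j) x)]
    simpa using enorm_add_le (v (k j) x - ψ (k j) x) (ψ (k j) x - u x)
  have hTV : totalVariation Ω φ u ≤ muBar Ω φ := by
    refine (totalVariation_le_liminf (fun j => (hv (k j)).1.1) hu hvlim).trans ?_
    have h1 := hqlim.comp hk.tendsto_atTop
    rw [muBar, ← h1.liminf_eq]
    exact liminf_le_liminf (.of_forall fun j => hvq (k j))
  -- L¹ convergence preserves the normalization, so the limit is nonzero and its quotient is just
  -- its total variation.
  have hmass : massL1 Ω φ u = 1 := by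
    refine le_antisymm ?_ ?_
    · have h1 := hvlim.const_add (1 : ℝ≥0∞)
      rw [add_zero] at h1
      refine ge_of_tendsto' h1 fun j => ?_
      have h2 := massL1_le_add (v := u) (hv (k j)).1.1
      rw [hv1] at h2
      simpa only [enorm_sub_rev] using h2
    · have h1 := hvlim.const_add (massL1 Ω φ u)
      rw [add_zero] at h1
      refine ge_of_tendsto' h1 fun j => ?_
      rw [← hv1 (k j)]
      exact massL1_le_add hu
  obtain ⟨hnn, hpos⟩ := h.nonneg_and_measure_pos_le (fun j => hv (k j)) hu hvlim
  have hfin : muBar Ω φ ≠ ⊤ := ne_top_of_le_ne_top hq0 (sInf_le (hq 0))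
  have hcomp : IsBarCompetitor Ω φ u :=
    ⟨⟨hu, hTV.trans_lt hfin.lt_top⟩, hnn, by rw [hmass]; exact one_ne_zero, hpos⟩
  refine ⟨u, hcomp, le_antisymm ?_ (sInf_le ⟨u, hcomp, rfl⟩)⟩
  rw [hmass, div_one]
  exact hTV

end WeightedBV

end

theorem proposition2p1 {N : ℕ} (hN : 0 < N) {m : ℕ} (hm : 0 < m)
    (Ω : Set (EuclideanSpace ℝ (Fin N))) (hne : Ω.Nonempty) (hopen : IsOpen Ω)
    (hbdd : Bornology.IsBounded Ω) (φ : EuclideanSpace ℝ (Fin N) → ℝ)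
    (hpos : ∀ x ∈ Ω, 0 < φ x)
    (hconc : ConcaveOn ℝ Ω (fun x => φ x ^ (1 / (m : ℝ)))) :
    WeightedBV.muOne Ω φ = WeightedBV.muBar Ω φ ∧
    WeightedBV.muBar Ω φ = WeightedBV.muStar Ω φ ∧
    (∃ u, WeightedBV.IsBarOptimal Ω φ u) ∧
    (∃ E, WeightedBV.IsStarOptimal Ω φ E) ∧
    ∀ u, WeightedBV.IsBarOptimal Ω φ u →
      ∀ᵐ t : ℝ, 0 < t → WeightedBV.weightedMeasure Ω φ {x ∈ Ω | t < u x} ≠ 0 →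
        WeightedBV.IsStarOptimal Ω φ {x ∈ Ω | t < u x} := by
  have h : WeightedBV.ConcaveWeight m Ω φ := ⟨hm, hne, hopen, hbdd, hpos, hconc⟩
  obtain ⟨u, hu⟩ := h.exists_isBarOptimal hN
  have hBS := h.muBar_eq_muStar
  exact ⟨hBS ▸ le_antisymm (h.muOne_le_muStar hN) h.muStar_le_muOne, hBS, ⟨u, hu⟩,
    h.exists_isStarOptimal hu, fun u hu => h.isStarOptimal_of_isBarOptimal hu⟩
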